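/- **Setting.** Let $a,b,c\in\mathbb R$ satisfy $a<0$, $c<0$, $b>0$ and, for some $\theta\in[0,1]$, $$a+1=\frac1{2b}\Big(\theta^2-\frac13\Big),\qquad c+1=\frac1{2b}\,(1-\theta^2).$$ Consider the rescaled Hamiltonian generic $abcd$ Boussinesq system for real-valued functions $u,\eta$ of $(t,x)\in\mathbb R\times\mathbb R$: $$\begin{cases}(1-\partial_x^2)\,\partial_t\eta+\partial_x\big(a\,\partial_x^2u+u+u\eta\big)=0,\\[2pt] (1-\partial_x^2)\,\partial_tu+\partial_x\big(c\,\partial_x^2\eta+\eta+\tfrac12u^2\big)=0.\end{cases}$$ Let $H^1=H^1(\mathbb R)$ with $\|v\|_{H^1}^2=\int_{\mathbb R}(v^2+(\partial_xv)^2)\,dx$. A global solution in $C(\mathbb R,H^1\times H^1)$ is a pair $(u,\eta)$ that is continuous in $t\in\mathbb R$ with values in $H^1\times H^1$ and satisfies the two equations in the sense of distributions. For an interval $I\subset\mathbb R$ put $$\|(u,\eta)(t)\|_{(H^1\times H^1)(I)}^2=\int_I\big(u^2+(\partial_xu)^2+\eta^2+(\partial_x\eta)^2\big)(t,x)\,dx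 ,$$ and for $C_0>0$ and $|t|\ge2$ let $$I(t)=\Big(-\frac{C_0|t|}{\log^2|t|},\ \frac{C_0|t|}{\log^2|t|}\Big).$$ **Theorem 1.1.** Suppose in addition that the parameters are dispersion-like, that is, $3(a+c)+2<8ac$. Then there is $\varepsilon>0$, depending only on the parameters $(a,b,c)$, such that for every global solution $(u,\eta)\in C(\mathbb R,H^1\times H^1)$ of the system with $$\|(u,\eta)(0)\|_{H^1\times H^1}<\varepsilon$$ and for every $C_0>0$ one has $$\lim_{t\to+\infty}\|(u,\eta)(t)\|_{(H^1\times H^1)(I(t))}=0\qquad\text{and}\qquad\lim_{t\to-\infty}\|(u,\eta)(t)\|_{(H^1\times H^1)(I(t))}=0 .$$ -/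

import Mathlib

open MeasureTheory Filter Topology
open scoped ContDiff

namespace Abcd

/-- Real-valued test functions on the line: smooth with compact support. -/
def IsTest (φ : ℝ → ℝ) : Prop :=
  ContDiff ℝ ∞ φ ∧ HasCompactSupport φ

/-- The real Lebesgue space `L²(ℝ)`. -/
abbrev L2 : Type := Lp ℝ 2 (volume : Measure ℝ)

/-- `g` is the weak derivative of `f`. -/
def IsWeakDeriv (f g : ℝ → ℝ) : Prop :=
  ∀ φ : ℝ → ℝ, IsTest φ → ∫ x, f x * deriv φ x = -∫ x, g x * φ x

theorem integrable_mul_of_compactSupport (f : L2) {φ : ℝ → ℝ} (hc : Continuous φ)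
    (hs : HasCompactSupport φ) : Integrable (fun x => f x * φ x) volume :=
  (Lp.memLp f).integrable_mul (q := 2) (hc.memLp_of_hasCompactSupport hs)

theorem IsTest.integrable_mul {φ : ℝ → ℝ} (hφ : IsTest φ) (f : L2) :
    Integrable (fun x => f x * φ x) volume :=
  integrable_mul_of_compactSupport f hφ.1.continuous hφ.2

theorem IsTest.integrable_mul_deriv {φ : ℝ → ℝ} (hφ : IsTest φ) (f : L2) :
    Integrable (fun x => f x * deriv φ x) volume :=
  integrable_mul_of_compactSupport f (hφ.1.continuous_deriv (by simp)) hφ.2.deriv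

/-- The Sobolev space `H¹(ℝ)` of real-valued functions, as the space of the pairs `(f, f')` in
`L² × L²` whose second entry is the weak derivative of the first; the norm inherited from the
Hilbert sum `L² ⊕ L²` is `(‖f‖² + ‖f'‖²)^(1/2)`. -/
def h1Submodule : Submodule ℝ (WithLp 2 (L2 × L2)) where
  carrier := {p | IsWeakDeriv p.fst p.snd}
  zero_mem' := by
    intro φ _
    have h : ∀ ψ : ℝ → ℝ, ∫ x, (0 : L2) x * ψ x = 0 := by
      intro ψ
      rw [← integral_zero ℝ ℝ (μ := volume)]
      refine integral_congr_ae ?_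
      filter_upwards [Lp.coeFn_zero ℝ 2 (volume : Measure ℝ)] with x hx
      rw [hx, Pi.zero_apply, zero_mul]
    rw [WithLp.zero_fst, WithLp.zero_snd, h, h, neg_zero]
  add_mem' := by
    intro p q hp hq φ hφ
    have h : ∀ (f g : L2) (ψ : ℝ → ℝ), Integrable (fun x => f x * ψ x) volume →
        Integrable (fun x => g x * ψ x) volume →
        ∫ x, (f + g) x * ψ x = (∫ x, f x * ψ x) + ∫ x, g x * ψ x := by
      intro f g ψ hf hg
      rw [← integral_add hf hg]
      refine integral_congr_ae ?_
      filter_upwards [Lp.coeFn_add f g] with x hx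
      rw [hx, Pi.add_apply, add_mul]
    have h1 := hp φ hφ
    have h2 := hq φ hφ
    rw [WithLp.add_fst, WithLp.add_snd,
      h _ _ _ (hφ.integrable_mul_deriv _) (hφ.integrable_mul_deriv _),
      h _ _ _ (hφ.integrable_mul _) (hφ.integrable_mul _), h1, h2]
    ring
  smul_mem' := by
    intro r p hp φ hφ
    have h : ∀ (f : L2) (ψ : ℝ → ℝ), ∫ x, (r • f) x * ψ x = r * ∫ x, f x * ψ x := by
      intro f ψ
      rw [← integral_const_mul]
      refine integral_congr_ae ?_
      filter_upwards [Lp.coeFn_smul r f] with x hx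
      rw [hx, Pi.smul_apply, smul_eq_mul, mul_assoc]
    have h1 := hp φ hφ
    rw [WithLp.smul_fst, WithLp.smul_snd, h, h, h1]
    ring

/-- The real Hilbert space `H¹(ℝ)`. -/
abbrev H1 : Type := ↥h1Submodule

/-- The function itself (defined almost everywhere). -/
noncomputable def H1.fn (f : H1) : ℝ → ℝ := (f : WithLp 2 (L2 × L2)).fst

/-- Its weak derivative (defined almost everywhere). -/
noncomputable def H1.dx (f : H1) : ℝ → ℝ := (f : WithLp 2 (L2 × L2)).snd

/-- The norm of a pair in `H¹(ℝ) × H¹(ℝ)`. -/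
noncomputable def pairNorm (v w : H1) : ℝ := Real.sqrt (‖v‖ ^ 2 + ‖w‖ ^ 2)

/-- The norm of (the restriction of) a pair in `(H¹ × H¹)(I)`. -/
noncomputable def localNorm (I : Set ℝ) (v w : H1) : ℝ :=
  Real.sqrt (∫ x in I, (v.fn x ^ 2 + v.dx x ^ 2 + w.fn x ^ 2 + w.dx x ^ 2))

/-- The parameters of the rescaled Hamiltonian generic `abcd` system (with `b` the original,
not rescaled, parameter). -/
def Admissible (a b c : ℝ) : Prop :=
  a < 0 ∧ c < 0 ∧ 0 < b ∧
    ∃ θ ∈ Set.Icc (0 : ℝ) 1,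
      a + 1 = 1 / (2 * b) * (θ ^ 2 - 1 / 3) ∧ c + 1 = 1 / (2 * b) * (1 - θ ^ 2)

/-- Dispersion-like parameters. -/
def DispersionLike (a b c : ℝ) : Prop :=
  Admissible a b c ∧ 3 * (a + c) + 2 < 8 * a * c

/-- `(u, η)` is a global solution, in `C(ℝ, H¹ × H¹)`, of
`(1 - ∂ₓ²) ∂ₜη + ∂ₓ (a ∂ₓ²u + u + u η) = 0`, `(1 - ∂ₓ²) ∂ₜu + ∂ₓ (c ∂ₓ²η + η + u² / 2) = 0`.
The equations hold in the sense of distributions: at every time they are tested against an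
arbitrary test function of `x`, on which all the spatial derivatives are put. -/
structure IsGlobalSolution (a c : ℝ) (u η : ℝ → H1) : Prop where
  continuous_u : Continuous u
  continuous_η : Continuous η
  eq_η : ∀ φ : ℝ → ℝ, IsTest φ → ∀ t : ℝ,
    HasDerivAt (fun s => ∫ x, (η s).fn x * (φ x - iteratedDeriv 2 φ x))
      (∫ x, (a * (u t).fn x * iteratedDeriv 3 φ x
        + ((u t).fn x + (u t).fn x * (η t).fn x) * deriv φ x)) t
  eq_u : ∀ φ : ℝ → ℝ, IsTest φ → ∀ t : ℝ,
    HasDerivAt (fun s => ∫ x, (u s).fn x * (φ x - iteratedDeriv 2 φ x))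
      (∫ x, (c * (η t).fn x * iteratedDeriv 3 φ x
        + ((η t).fn x + 1 / 2 * (u t).fn x ^ 2) * deriv φ x)) t

/-- The interval `I(t)`, meant for `|t| ≥ 2`. -/
noncomputable def decayInterval (C₀ t : ℝ) : Set ℝ :=
  Set.Ioo (-(C₀ * |t| / Real.log |t| ^ 2)) (C₀ * |t| / Real.log |t| ^ 2)

end Abcd

open scoped BoundedContinuousFunction

namespace Abcd

/-! The proof is a virial argument at the moving scale `l = t / log² t`. With `G = (1 - ∂ₓ²)⁻¹` and
`K = ∂ₓ G` the system reads `∂ₜu = c ∂ₓη - (1+c) K η - K(u²)/2`, `∂ₜη = a ∂ₓu - (1+a) K u - K(uη)`,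
an evolution equation in `L²` for curves in `H¹` (`IsGlobalSolution.isL2Solution`).

Conservation of the Hamiltonian keeps small data small for all times (`exists_forall_small`). The
momentum `∫ ψ (uη + ∂ₓu ∂ₓη)` with `ψ = arctan (x/l)`, corrected by `-(β/2) ∫ ψ' u ∂ₓη`, is
therefore bounded. Its derivative is a sum of two quadratic forms, one in `u` and one in `η`, plus
cubic terms and errors coming from `ψ''` and from the motion of `l`. In the variable `F = G u`, each
form becomes a combination of weighted squares of `F` and its first three derivatives. A number `β`
making both forms coercive exists because `3(a+c) + 2 < 8ac` (`exists_multiplier`,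
`exists_virialForm_ge`, `exists_virialRate_ge`).

Hence `e(t) = ∫ ψ' (u² + (∂ₓu)² + η² + (∂ₓη)²)` is integrable in time: the error due to the motion
of `l` is at most a multiple of `l'² / l ≤ 1 / (t log² t)`. The energy localized by `l² / (l² + x²)`
has a derivative bounded by a multiple of `e` (`abs_energy_deriv_le`), so it converges. It is itself
bounded by a multiple of `l e`, so a nonzero limit would force `e` to be at least a multiple of
`1/t`, which is not integrable (`tendsto_zero_of_virial`). That weight is bounded below on `I(t)`,
which gives the limit at `+∞`; the symmetry `(u, η)(t) ↦ (-u, η)(-t)` gives the one at `-∞`.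

Since `∂ₜu` and `∂ₜη` are only in `L²`, functionals containing `∂ₓu` or `∂ₓη` cannot be
differentiated naively; `hasDerivAt_T_D_D` and `hasDerivAt_T_D` justify these computations. -/

/-! ### Weighted bilinear forms on `L²`. -/

theorem memLp_bcf_mul (ψ : ℝ →ᵇ ℝ) (f : L2) : MemLp (fun x => ψ x * f x) 2 volume := by
  refine MemLp.of_le_mul (c := ‖ψ‖) (Lp.memLp f)
    (ψ.continuous.aestronglyMeasurable.mul (Lp.aestronglyMeasurable f)) (ae_of_all _ fun x => ?_)
  rw [norm_mul]
  exact mul_le_mul_of_nonneg_right (ψ.norm_coe_le_norm x) (norm_nonneg _)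

/-- Multiplication of an `L²` function by a bounded continuous function. -/
noncomputable def M : (ℝ →ᵇ ℝ) →L[ℝ] L2 →L[ℝ] L2 :=
  LinearMap.mkContinuous₂
    (LinearMap.mk₂ ℝ (fun ψ f => (memLp_bcf_mul ψ f).toLp _)
      (fun ψ φ f => by
        rw [← MemLp.toLp_add]
        refine MemLp.toLp_congr _ _ (ae_of_all _ fun x => ?_)
        simp [add_mul])
      (fun r ψ f => by
        rw [← MemLp.toLp_const_smul]
        refine MemLp.toLp_congr _ _ (ae_of_all _ fun x => ?_)
        simp [mul_assoc])
      (fun ψ f g => by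
        rw [← MemLp.toLp_add]
        refine MemLp.toLp_congr _ _ ?_
        filter_upwards [Lp.coeFn_add f g] with x hx
        simp only [hx, Pi.add_apply, mul_add])
      (fun r ψ f => by
        rw [← MemLp.toLp_const_smul]
        refine MemLp.toLp_congr _ _ ?_
        filter_upwards [Lp.coeFn_smul r f] with x hx
        simp only [hx, Pi.smul_apply, smul_eq_mul, mul_left_comm]))
    1 (fun ψ f => by
      rw [one_mul]
      refine Lp.norm_le_mul_norm_of_ae_le_mul ?_
      filter_upwards [(memLp_bcf_mul ψ f).coeFn_toLp] with x hx
      simp only [LinearMap.mk₂_apply]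
      rw [hx, norm_mul]
      exact mul_le_mul_of_nonneg_right (ψ.norm_coe_le_norm x) (norm_nonneg _))

theorem coeFn_M (ψ : ℝ →ᵇ ℝ) (f : L2) : M ψ f =ᵐ[volume] fun x => ψ x * f x :=
  (memLp_bcf_mul ψ f).coeFn_toLp

theorem norm_M_le (ψ : ℝ →ᵇ ℝ) (f : L2) : ‖M ψ f‖ ≤ ‖ψ‖ * ‖f‖ := by
  refine Lp.norm_le_mul_norm_of_ae_le_mul ?_
  filter_upwards [coeFn_M ψ f] with x hx
  rw [hx, norm_mul]
  exact mul_le_mul_of_nonneg_right (ψ.norm_coe_le_norm x) (norm_nonneg _)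

theorem M_mul (ψ φ : ℝ →ᵇ ℝ) (f : L2) : M (ψ * φ) f = M ψ (M φ f) := by
  refine Lp.ext ?_
  filter_upwards [coeFn_M (ψ * φ) f, coeFn_M ψ (M φ f), coeFn_M φ f] with x h1 h2 h3
  rw [h1, h2, h3, BoundedContinuousFunction.mul_apply, mul_assoc]

theorem M_one (f : L2) : M 1 f = f := by
  refine Lp.ext ?_
  filter_upwards [coeFn_M 1 f] with x h1
  rw [h1]; simp

/-- The weighted inner product `∫ ψ f g`. -/
noncomputable def T (ψ : ℝ →ᵇ ℝ) (f g : L2) : ℝ := inner ℝ (M ψ f) g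

theorem T_eq_integral (ψ : ℝ →ᵇ ℝ) (f g : L2) : T ψ f g = ∫ x, ψ x * f x * g x := by
  rw [T, L2.inner_def]
  refine integral_congr_ae ?_
  filter_upwards [coeFn_M ψ f] with x hx
  simp [hx, mul_comm]

theorem integrable_T (ψ : ℝ →ᵇ ℝ) (f g : L2) : Integrable (fun x => ψ x * f x * g x) volume :=
  (memLp_bcf_mul ψ f).integrable_mul (Lp.memLp g)

theorem T_comm (ψ : ℝ →ᵇ ℝ) (f g : L2) : T ψ f g = T ψ g f := by
  simp only [T_eq_integral]
  congr 1; ext x; ring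

section linear
variable (ψ φ : ℝ →ᵇ ℝ) (f f' g g' : L2) (r : ℝ)

theorem T_add_left : T ψ (f + f') g = T ψ f g + T ψ f' g := by simp [T, inner_add_left]
theorem T_sub_left : T ψ (f - f') g = T ψ f g - T ψ f' g := by simp [T, inner_sub_left]
theorem T_neg_left : T ψ (-f) g = -T ψ f g := by simp [T]
theorem T_smul_left : T ψ (r • f) g = r * T ψ f g := by simp [T, inner_smul_left]
theorem T_add_right : T ψ f (g + g') = T ψ f g + T ψ f g' := by simp [T, inner_add_right]
theorem T_sub_right : T ψ f (g - g') = T ψ f g - T ψ f g' := by simp [T, inner_sub_right]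
theorem T_neg_right : T ψ f (-g) = -T ψ f g := by simp [T]
theorem T_smul_right : T ψ f (r • g) = r * T ψ f g := by simp [T, inner_smul_right]
theorem T_add_weight : T (ψ + φ) f g = T ψ f g + T φ f g := by simp [T, inner_add_left]
theorem T_sub_weight : T (ψ - φ) f g = T ψ f g - T φ f g := by simp [T, inner_sub_left]
theorem T_neg_weight : T (-ψ) f g = -T ψ f g := by simp [T]
theorem T_smul_weight : T (r • ψ) f g = r * T ψ f g := by simp [T, inner_smul_left]
theorem T_one : T 1 f g = inner ℝ f g := by rw [T, M_one]
theorem T_zero_weight : T 0 f g = 0 := by simp [T]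
theorem T_M_left : T ψ (M φ f) g = T (ψ * φ) f g := by rw [T, T, M_mul]
theorem T_M_right : T ψ f (M φ g) = T (ψ * φ) f g := by
  rw [T_comm, T_M_left, T_comm]

theorem abs_T_le_norm : |T ψ f g| ≤ ‖ψ‖ * ‖f‖ * ‖g‖ :=
  (abs_real_inner_le_norm _ _).trans
    (mul_le_mul_of_nonneg_right (norm_M_le ψ f) (norm_nonneg _))

end linear

theorem T_le_T {ψ w : ℝ →ᵇ ℝ} (h : ∀ x, ψ x ≤ w x) (f : L2) : T ψ f f ≤ T w f f := by
  rw [T_eq_integral, T_eq_integral]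
  refine integral_mono (integrable_T _ _ _) (integrable_T _ _ _) fun x => ?_
  have := mul_le_mul_of_nonneg_right (h x) (mul_self_nonneg (f x))
  simpa [mul_assoc] using this

theorem T_nonneg {w : ℝ →ᵇ ℝ} (h : ∀ x, 0 ≤ w x) (f : L2) : 0 ≤ T w f f := by
  rw [← T_zero_weight f f]
  exact T_le_T (by simpa using h) f

/-- Weighted Young inequality. -/
theorem abs_T_le {ψ w : ℝ →ᵇ ℝ} (h : ∀ x, |ψ x| ≤ w x) (f g : L2) :
    |T ψ f g| ≤ (T w f f + T w g g) / 2 := by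
  have key : ∀ x, |ψ x * f x * g x| ≤ (w x * f x * f x + w x * g x * g x) / 2 := by
    intro x
    rw [mul_assoc, abs_mul]
    have h1 : |f x * g x| ≤ (f x * f x + g x * g x) / 2 := by
      rw [abs_le]; constructor <;> nlinarith [sq_nonneg (f x + g x), sq_nonneg (f x - g x)]
    have h2 : 0 ≤ (f x * f x + g x * g x) / 2 := (abs_nonneg _).trans h1
    calc |ψ x| * |f x * g x| ≤ w x * ((f x * f x + g x * g x) / 2) :=
          mul_le_mul (h x) h1 (abs_nonneg _) ((abs_nonneg _).trans (h x))
      _ = _ := by ring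
  rw [T_eq_integral, T_eq_integral, T_eq_integral,
    ← integral_add (integrable_T _ _ _) (integrable_T _ _ _), ← integral_div]
  refine abs_integral_le_integral_abs.trans (integral_mono (integrable_T _ _ _).abs ?_ key)
  exact ((integrable_T _ _ _).add (integrable_T _ _ _)).div_const 2

theorem T_M_M_le {w : ℝ →ᵇ ℝ} (h : ∀ x, 0 ≤ w x) (φ : ℝ →ᵇ ℝ) {m : ℝ} (hφ : ∀ x, |φ x| ≤ m)
    (f : L2) : T w (M φ f) (M φ f) ≤ m ^ 2 * T w f f := by
  rw [T_M_left, T_M_right, ← T_smul_weight]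
  refine T_le_T (fun x => ?_) f
  have h1 : φ x * φ x ≤ m ^ 2 := by
    rw [← sq, ← sq_abs]
    exact pow_le_pow_left₀ (abs_nonneg _) (hφ x) 2
  simp only [BoundedContinuousFunction.mul_apply, BoundedContinuousFunction.smul_apply, smul_eq_mul]
  nlinarith [mul_le_mul_of_nonneg_left h1 (h x)]

theorem _root_.HasDerivAt.T {Φ : ℝ → ℝ →ᵇ ℝ} {Φ' : ℝ →ᵇ ℝ} {U V : ℝ → L2} {U' V' : L2} {t : ℝ}
    (hΦ : HasDerivAt Φ Φ' t) (hU : HasDerivAt U U' t) (hV : HasDerivAt V V' t) :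
    HasDerivAt (fun s => T (Φ s) (U s) (V s))
      (T Φ' (U t) (V t) + T (Φ t) U' (V t) + T (Φ t) (U t) V') t := by
  have h := (ContinuousLinearMap.hasDerivAt_of_bilinear (B := M) (fun _ => hΦ)
    (fun _ => hU)).inner ℝ hV
  refine h.congr_deriv ?_
  simp only [Abcd.T, inner_add_left]
  ring

theorem continuous_T {X : Type*} [TopologicalSpace X] {Φ : X → ℝ →ᵇ ℝ} {U V : X → L2}
    (hΦ : Continuous Φ) (hU : Continuous U) (hV : Continuous V) :
    Continuous fun s => T (Φ s) (U s) (V s) :=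
  ((M.continuous.comp hΦ).clm_apply hU).inner hV

/-! ### The space `H¹`, test functions, completeness. -/

/-- The inclusion of `H¹` in `L²`. -/
noncomputable def ι : H1 →L[ℝ] L2 := (WithLp.fstL 2 ℝ L2 L2).comp h1Submodule.subtypeL

/-- The derivative `H¹ → L²`. -/
noncomputable def D : H1 →L[ℝ] L2 := (WithLp.sndL 2 ℝ L2 L2).comp h1Submodule.subtypeL

theorem H1.fn_eq (f : H1) : f.fn = ι f := rfl
theorem H1.dx_eq (f : H1) : f.dx = D f := rfl

theorem H1.norm_sq (f : H1) : ‖f‖ ^ 2 = ‖ι f‖ ^ 2 + ‖D f‖ ^ 2 :=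
  WithLp.prod_norm_sq_eq_of_L2 (f : WithLp 2 (L2 × L2))

theorem H1.inner_eq (f g : H1) : inner ℝ f g = inner ℝ (ι f) (ι g) + inner ℝ (D f) (D g) :=
  WithLp.prod_inner_apply (f : WithLp 2 (L2 × L2)) (g : WithLp 2 (L2 × L2))

theorem norm_ι_le (f : H1) : ‖ι f‖ ≤ ‖f‖ := by
  refine abs_le_of_sq_le_sq' ?_ (norm_nonneg _) |>.2
  rw [f.norm_sq]; nlinarith [sq_nonneg ‖D f‖]

theorem norm_D_le (f : H1) : ‖D f‖ ≤ ‖f‖ := by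
  refine abs_le_of_sq_le_sq' ?_ (norm_nonneg _) |>.2
  rw [f.norm_sq]; nlinarith [sq_nonneg ‖ι f‖]

/-- An element of `H¹` from a function and its weak derivative. -/
def H1.mk (f g : L2) (h : IsWeakDeriv f g) : H1 := ⟨WithLp.toLp 2 (f, g), h⟩

theorem H1.isWeakDeriv (f : H1) : IsWeakDeriv (ι f) (D f) := f.2

theorem IsTest.isTest_deriv {φ : ℝ → ℝ} (hφ : IsTest φ) : IsTest (deriv φ) :=
  ⟨(contDiff_infty_iff_deriv.1 hφ.1).2, hφ.2.deriv⟩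

theorem IsTest.hasDerivAt {φ : ℝ → ℝ} (hφ : IsTest φ) (x : ℝ) :
    HasDerivAt φ (deriv φ x) x :=
  ((hφ.1.differentiable (by simp)) x).hasDerivAt

/-- A test function as a bounded continuous function. -/
noncomputable def IsTest.bcf {φ : ℝ → ℝ} (hφ : IsTest φ) : ℝ →ᵇ ℝ :=
  BoundedContinuousFunction.ofNormedAddCommGroup φ hφ.1.continuous
    (hφ.2.exists_bound_of_continuous hφ.1.continuous).choose
    (hφ.2.exists_bound_of_continuous hφ.1.continuous).choose_spec

@[simp] theorem IsTest.bcf_apply {φ : ℝ → ℝ} (hφ : IsTest φ) (x : ℝ) : hφ.bcf x = φ x := rfl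

theorem IsTest.memLp {φ : ℝ → ℝ} (hφ : IsTest φ) : MemLp φ 2 volume :=
  hφ.1.continuous.memLp_of_hasCompactSupport hφ.2

/-- A test function as an element of `L²`. -/
noncomputable def IsTest.toL2 {φ : ℝ → ℝ} (hφ : IsTest φ) : L2 := hφ.memLp.toLp φ

theorem IsTest.coeFn_toL2 {φ : ℝ → ℝ} (hφ : IsTest φ) : hφ.toL2 =ᵐ[volume] φ :=
  hφ.memLp.coeFn_toLp

theorem IsTest.inner_toL2 {φ : ℝ → ℝ} (hφ : IsTest φ) (f : L2) :
    inner ℝ f hφ.toL2 = ∫ x, f x * φ x := by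
  rw [L2.inner_def]
  refine integral_congr_ae ?_
  filter_upwards [hφ.coeFn_toL2] with x hx
  simp [hx, mul_comm]

theorem integrable_deriv_mul_test {φ χ : ℝ → ℝ} (hφ : IsTest φ) (hχ : IsTest χ) :
    ∫ x, φ x * deriv χ x = -∫ x, deriv φ x * χ x := by
  refine integral_mul_deriv_eq_deriv_mul_of_integrable (fun x _ => hφ.hasDerivAt x)
    (fun x _ => hχ.hasDerivAt x) ?_ ?_ ?_
  · exact (hφ.memLp.integrable_mul hχ.isTest_deriv.memLp)
  · exact (hφ.isTest_deriv.memLp.integrable_mul hχ.memLp)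
  · exact (hφ.memLp.integrable_mul hχ.memLp)

/-- A test function as an element of `H¹`. -/
noncomputable def IsTest.toH1 {φ : ℝ → ℝ} (hφ : IsTest φ) : H1 :=
  H1.mk hφ.toL2 hφ.isTest_deriv.toL2 (by
    intro χ hχ
    have h1 : ∫ x, hφ.toL2 x * deriv χ x = ∫ x, φ x * deriv χ x := by
      refine integral_congr_ae ?_
      filter_upwards [hφ.coeFn_toL2] with x hx; rw [hx]
    have h2 : ∫ x, hφ.isTest_deriv.toL2 x * χ x = ∫ x, deriv φ x * χ x := by
      refine integral_congr_ae ?_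
      filter_upwards [hφ.isTest_deriv.coeFn_toL2] with x hx; rw [hx]
    rw [h1, h2, integrable_deriv_mul_test hφ hχ])

@[simp] theorem IsTest.ι_toH1 {φ : ℝ → ℝ} (hφ : IsTest φ) : ι hφ.toH1 = hφ.toL2 := rfl
@[simp] theorem IsTest.D_toH1 {φ : ℝ → ℝ} (hφ : IsTest φ) : D hφ.toH1 = hφ.isTest_deriv.toL2 := rfl

theorem isWeakDeriv_iff_inner (f g : L2) :
    IsWeakDeriv f g ↔ ∀ φ, ∀ hφ : IsTest φ,
      inner ℝ f hφ.isTest_deriv.toL2 + inner ℝ g hφ.toL2 = 0 := by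
  simp only [IsTest.inner_toL2]
  exact forall₂_congr fun φ hφ => eq_neg_iff_add_eq_zero

theorem eq_zero_of_forall_inner_test {f : L2}
    (h : ∀ φ, ∀ hφ : IsTest φ, inner ℝ f hφ.toL2 = 0) : f = 0 := by
  rw [Lp.eq_zero_iff_ae_eq_zero]
  refine ae_eq_zero_of_integral_contDiff_smul_eq_zero
    ((Lp.memLp f).locallyIntegrable (by norm_num)) fun φ h1 h2 => ?_
  have hφ : IsTest φ := ⟨h1, h2⟩
  have := h φ hφ
  rw [hφ.inner_toL2] at this
  simpa [mul_comm] using this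

/-- The defining relation is an intersection of closed linear conditions on `L² × L²`, one per test
function. Completeness is what allows the adjoint of `ι` to be taken in `G`. -/
instance : CompleteSpace H1 := by
  have : IsClosed (h1Submodule : Set (WithLp 2 (L2 × L2))) := by
    have h : (h1Submodule : Set (WithLp 2 (L2 × L2))) =
        ⋂ φ, ⋂ hφ : IsTest φ,
          {p | inner ℝ p.fst hφ.isTest_deriv.toL2 + inner ℝ p.snd hφ.toL2 = 0} := by
      ext p
      simp only [Set.mem_iInter, Set.mem_ofPred_eq]
      exact isWeakDeriv_iff_inner p.fst p.snd
    rw [h]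
    refine isClosed_iInter fun φ => isClosed_iInter fun hφ => isClosed_eq ?_ continuous_const
    exact ((WithLp.fstL 2 ℝ L2 L2).continuous.inner continuous_const).add
      ((WithLp.sndL 2 ℝ L2 L2).continuous.inner continuous_const)
  exact this.completeSpace_coe

/-! ### Primitives, integration by parts, Sobolev embedding. -/

theorem locallyIntegrable_L2 (f : L2) : LocallyIntegrable f volume :=
  (Lp.memLp f).locallyIntegrable (by norm_num)

theorem intervalIntegrable_L2 (f : L2) (a b : ℝ) : IntervalIntegrable f volume a b :=
  ((locallyIntegrable_L2 f).integrableOn_isCompact isCompact_uIcc).intervalIntegrable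

theorem exists_test_integral_one : ∃ ρ, IsTest ρ ∧ ∫ x, ρ x = 1 := by
  let b : ContDiffBump (0 : ℝ) := ⟨1, 2, one_pos, one_lt_two⟩
  exact ⟨b.normed volume, ⟨b.contDiff_normed, b.hasCompactSupport_normed⟩, b.integral_normed⟩

/-- A test function of zero mean is the derivative of a test function. -/
theorem IsTest.exists_primitive {φ : ℝ → ℝ} (hφ : IsTest φ) (h0 : ∫ x, φ x = 0) :
    ∃ χ, IsTest χ ∧ deriv χ = φ := by
  have hc := hφ.1.continuous
  obtain ⟨R, hR0, hR⟩ : ∃ R, 0 < R ∧ ∀ x, R ≤ |x| → φ x = 0 := by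
    obtain ⟨R, hR0, hR⟩ := hφ.2.isCompact.isBounded.subset_closedBall_lt 0 0
    refine ⟨R + 1, by linarith, fun x hx => ?_⟩
    refine image_eq_zero_of_notMem_tsupport fun hx' => ?_
    have := hR hx'
    rw [mem_closedBall_zero_iff, Real.norm_eq_abs] at this
    linarith
  have hd : ∀ x, HasDerivAt (fun x => ∫ t in (-R)..x, φ t) (φ x) x := fun x =>
    intervalIntegral.integral_hasDerivAt_right (hc.intervalIntegrable _ _)
      (hc.stronglyMeasurableAtFilter _ _) hc.continuousAt
  have hde : deriv (fun x => ∫ t in (-R)..x, φ t) = φ := funext fun x => (hd x).deriv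
  refine ⟨fun x => ∫ t in (-R)..x, φ t, ⟨?_, ?_⟩, hde⟩
  · rw [contDiff_infty_iff_deriv, hde]
    exact ⟨fun x => (hd x).differentiableAt, hφ.1⟩
  · refine HasCompactSupport.intro (isCompact_Icc (a := -R) (b := R)) fun x hx => ?_
    have hx' : x < -R ∨ R < x := by
      by_contra hcon; push Not at hcon; exact hx ⟨hcon.1, hcon.2⟩
    rcases hx' with hx' | hx'
    · rw [← neg_eq_zero, ← intervalIntegral.integral_symm]
      rw [intervalIntegral.integral_of_le hx'.le]
      refine setIntegral_eq_zero_of_forall_eq_zero fun t ht => hR t ?_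
      rw [abs_of_neg (by linarith [ht.2])]; linarith [ht.2]
    · rw [intervalIntegral.integral_of_le (by linarith), setIntegral_eq_integral_of_forall_compl_eq_zero, h0]
      intro t ht
      refine hR t ?_
      by_contra hcon
      push Not at hcon
      rw [abs_lt] at hcon
      exact ht ⟨hcon.1, by linarith [hcon.2]⟩

/-- The du Bois-Reymond lemma. -/
theorem exists_ae_eq_const {h : ℝ → ℝ} (hl : LocallyIntegrable h volume)
    (h0 : ∀ φ, IsTest φ → ∫ x, h x * deriv φ x = 0) : ∃ c, ∀ᵐ x, h x = c := by
  obtain ⟨ρ, hρ, hρ1⟩ := exists_test_integral_one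
  have hint : ∀ φ, IsTest φ → Integrable (fun x => h x * φ x) volume := fun φ hφ => by
    simpa [mul_comm] using hl.integrable_smul_left_of_hasCompactSupport hφ.1.continuous hφ.2
  refine ⟨∫ x, h x * ρ x, ?_⟩
  set c := ∫ x, h x * ρ x
  have key : ∀ᵐ x, h x - c = 0 := by
    refine ae_eq_zero_of_integral_contDiff_smul_eq_zero
      (hl.sub (locallyIntegrable_const c)) fun φ h1 h2 => ?_
    have hφ : IsTest φ := ⟨h1, h2⟩
    have hφi : Integrable φ volume := hφ.1.continuous.integrable_of_hasCompactSupport hφ.2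
    have hρi : Integrable ρ volume := hρ.1.continuous.integrable_of_hasCompactSupport hρ.2
    -- Removing the mean of `φ` with the unit-mass `ρ` leaves a function that is the derivative of a
    -- test function.
    have ht : IsTest (fun x => φ x - (∫ y, φ y) * ρ x) :=
      ⟨hφ.1.sub (contDiff_const.mul hρ.1), hφ.2.sub hρ.2.mul_left⟩
    obtain ⟨χ, hχ, hχ'⟩ := ht.exists_primitive (by
      rw [integral_sub hφi (hρi.const_mul _), integral_const_mul, hρ1]; ring)
    have := h0 χ hχ
    rw [hχ'] at this
    have e : ∀ x, h x * (φ x - (∫ y, φ y) * ρ x) = h x * φ x - (∫ y, φ y) * (h x * ρ x) :=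
      fun x => by ring
    simp only [e] at this
    rw [integral_sub (hint φ hφ) ((hint ρ hρ).const_mul _), integral_const_mul] at this
    have e2 : ∀ x, φ x • (h x - c) = h x * φ x - c * φ x := fun x => by
      rw [smul_eq_mul]; ring
    simp only [e2]
    rw [integral_sub (hint φ hφ) (hφi.const_mul _), integral_const_mul]
    linarith
  filter_upwards [key] with x hx
  linarith

theorem absolutelyContinuous_primitive (g : L2) (c : ℝ) {a b : ℝ} (h0 : (0 : ℝ) ∈ Set.uIcc a b) :
    AbsolutelyContinuousOnInterval (fun x => c + ∫ t in (0 : ℝ)..x, g t) a b := by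
  have h1 := (intervalIntegrable_L2 g a b).absolutelyContinuousOnInterval_intervalIntegral h0
  have h2 : AbsolutelyContinuousOnInterval (fun _ : ℝ => c) a b :=
    (LipschitzWith.const c).lipschitzOnWith.absolutelyContinuousOnInterval
  exact h2.add h1

theorem hasDerivAt_primitive (g : L2) (c : ℝ) :
    ∀ᵐ x, HasDerivAt (fun x => c + ∫ t in (0 : ℝ)..x, g t) (g x) x := by
  filter_upwards [LocallyIntegrable.ae_hasDerivAt_integral (locallyIntegrable_L2 g)] with x hx
  simpa using (hx 0).const_add c

/-- The difference between `f` and the primitive of its weak derivative has zero weak derivative,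
hence is constant by du Bois-Reymond. This supplies the locally absolutely continuous representative
on which integration by parts and the Sobolev embedding rest. -/
theorem H1.exists_primitive (f : H1) :
    ∃ c, ι f =ᵐ[volume] fun x => c + ∫ t in (0 : ℝ)..x, D f t := by
  set F : ℝ → ℝ := fun x => ∫ t in (0 : ℝ)..x, D f t with hF
  have hFc : Continuous F :=
    intervalIntegral.continuous_primitive (fun a b => intervalIntegrable_L2 _ a b) 0
  have hl : LocallyIntegrable (fun x => ι f x - F x) volume :=
    (locallyIntegrable_L2 _).sub hFc.locallyIntegrable
  obtain ⟨c, hc⟩ := exists_ae_eq_const hl (by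
    intro φ hφ
    have hF' : ∫ x, F x * deriv φ x = -∫ x, D f x * φ x := by
      obtain ⟨R, hR0, hR⟩ := hφ.2.isCompact.isBounded.subset_closedBall_lt 0 0
      have hz : ∀ x, x ∉ Set.Ioc (-(R + 1)) (R + 1) → φ x = 0 ∧ deriv φ x = 0 := by
        intro x hx
        have hx' : x ∉ tsupport φ := fun hx' => by
          have := hR hx'
          rw [mem_closedBall_zero_iff, Real.norm_eq_abs, abs_le] at this
          exact hx ⟨by linarith, by linarith⟩
        exact ⟨image_eq_zero_of_notMem_tsupport hx',
          image_eq_zero_of_notMem_tsupport fun h => hx' (tsupport_deriv_subset h)⟩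
      have hz1 : ∀ x, |x| = R + 1 → φ x = 0 := by
        intro x hx
        refine image_eq_zero_of_notMem_tsupport fun hx' => ?_
        have := hR hx'
        rw [mem_closedBall_zero_iff, Real.norm_eq_abs] at this
        linarith
      have hac := absolutelyContinuous_primitive (D f) 0 (a := -(R + 1)) (b := R + 1)
        (by rw [Set.uIcc_of_le (by linarith)]; constructor <;> linarith)
      simp only [zero_add] at hac
      have hφac : AbsolutelyContinuousOnInterval φ (-(R + 1)) (R + 1) :=
        (hφ.1.of_le (by simp)).contDiffOn.absolutelyContinuousOnInterval
      have := hac.integral_mul_deriv_eq_deriv_mul hφac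
      have hle : -(R + 1) ≤ R + 1 := by linarith
      rw [hz1 (R + 1) (abs_of_pos (by linarith)), hz1 (-(R + 1)) (by
        rw [abs_neg]; exact abs_of_pos (by linarith)), intervalIntegral.integral_of_le hle,
        intervalIntegral.integral_of_le hle,
        setIntegral_eq_integral_of_forall_compl_eq_zero (fun x hx => by rw [(hz x hx).2, mul_zero]),
        setIntegral_eq_integral_of_forall_compl_eq_zero (fun x hx => by rw [(hz x hx).1, mul_zero])]
        at this
      rw [this, mul_zero, mul_zero, sub_zero, zero_sub, neg_inj]
      refine integral_congr_ae ?_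
      filter_upwards [LocallyIntegrable.ae_hasDerivAt_integral (locallyIntegrable_L2 (D f))] with x hx
      rw [(hx 0).deriv]
    have h1 := f.isWeakDeriv φ hφ
    have e : ∀ x, (ι f x - F x) * deriv φ x = ι f x * deriv φ x - F x * deriv φ x :=
      fun x => by ring
    simp only [e]
    rw [integral_sub (hφ.integrable_mul_deriv _), h1, hF', sub_self]
    exact (hFc.mul hφ.isTest_deriv.1.continuous).integrable_of_hasCompactSupport hφ.isTest_deriv.2.mul_left)
  refine ⟨c, ?_⟩
  filter_upwards [hc] with x hx
  linarith

/-- There is no boundary term at infinity: `F R - F (-R)` converges as `R → ∞` and is integrable in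
`R`, so its limit can only be zero. -/
theorem integral_eq_zero_of_primitive {F h : ℝ → ℝ} (hF : Integrable F volume)
    (hh : Integrable h volume) (hFh : ∀ R, 0 < R → ∫ x in (-R)..R, h x = F R - F (-R)) :
    ∫ x, h x = 0 := by
  have h1 : Tendsto (fun R : ℝ => ∫ x in (-R)..R, h x) atTop (𝓝 (∫ x, h x)) :=
    intervalIntegral_tendsto_integral hh tendsto_neg_atTop_atBot tendsto_id
  have h2 : Tendsto (fun R : ℝ => F R - F (-R)) atTop (𝓝 (∫ x, h x)) := by
    refine h1.congr' ?_
    filter_upwards [eventually_gt_atTop 0] with R hR using hFh R hR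
  have h3 : Integrable (fun R : ℝ => F R - F (-R)) volume := hF.sub hF.comp_neg
  refine IntegrableAtFilter.eq_zero_of_tendsto (h3.integrableAtFilter atTop) (fun s hs => ?_) h2
  obtain ⟨b, hb⟩ := mem_atTop_sets.1 hs
  rw [← top_le_iff, ← Real.volume_Ici (a := b)]
  exact measure_mono hb

/-- `ψ'` is the derivative of `ψ`, both being bounded and continuous. -/
def IsDer (ψ ψ' : ℝ →ᵇ ℝ) : Prop := ∀ x, HasDerivAt ψ (ψ' x) x

theorem IsDer.contDiff {ψ ψ' : ℝ →ᵇ ℝ} (h : IsDer ψ ψ') : ContDiff ℝ 1 ψ := by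
  rw [contDiff_one_iff_deriv]
  have : deriv ψ = ψ' := funext fun x => (h x).deriv
  exact ⟨fun x => (h x).differentiableAt, this ▸ ψ'.continuous⟩

theorem isDer_one : IsDer 1 0 := fun x => hasDerivAt_const x (1 : ℝ)

theorem IsTest.isDer {φ : ℝ → ℝ} (hφ : IsTest φ) : IsDer hφ.bcf hφ.isTest_deriv.bcf :=
  fun x => hφ.hasDerivAt x

/-- Integration by parts in `H¹` with a weight. -/
theorem T_by_parts {ψ ψ' : ℝ →ᵇ ℝ} (hψ : IsDer ψ ψ') (f g : H1) :
    T ψ' (ι f) (ι g) + T ψ (D f) (ι g) + T ψ (ι f) (D g) = 0 := by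
  obtain ⟨c, hc⟩ := f.exists_primitive
  obtain ⟨d, hd⟩ := g.exists_primitive
  have hi₀ : Integrable (fun x => ψ' x * ι f x * ι g x + ψ x * D f x * ι g x) volume :=
    (integrable_T _ _ _).add (integrable_T _ _ _)
  have hi : Integrable (fun x => ψ' x * ι f x * ι g x + ψ x * D f x * ι g x
      + ψ x * ι f x * D g x) volume := hi₀.add (integrable_T _ _ _)
  rw [T_eq_integral, T_eq_integral, T_eq_integral,
    ← integral_add (integrable_T _ _ _) (integrable_T _ _ _),
    ← integral_add hi₀ (integrable_T _ _ _)]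
  set F : ℝ → ℝ := fun x => c + ∫ t in (0 : ℝ)..x, D f t with hF
  set H : ℝ → ℝ := fun x => d + ∫ t in (0 : ℝ)..x, D g t with hH
  refine integral_eq_zero_of_primitive (F := fun x => ψ x * F x * H x) ?_ hi fun R hR => ?_
  · refine (integrable_T ψ (ι f) (ι g)).congr ?_
    filter_upwards [hc, hd] with x h1 h2
    rw [h1, h2]
  · have h0 : (0 : ℝ) ∈ Set.uIcc (-R) R := by
      rw [Set.uIcc_of_le (by linarith)]; constructor <;> linarith
    have hac : AbsolutelyContinuousOnInterval (fun x => ψ x * F x * H x) (-R) R :=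
      ((hψ.contDiff.contDiffOn.absolutelyContinuousOnInterval).mul
        (absolutelyContinuous_primitive (D f) c h0)).mul (absolutelyContinuous_primitive (D g) d h0)
    rw [← hac.integral_deriv_eq_sub]
    refine intervalIntegral.integral_congr_ae ?_
    filter_upwards [hc, hd, hasDerivAt_primitive (D f) c, hasDerivAt_primitive (D g) d]
      with x h1 h2 h3 h4 _
    have h5 : HasDerivAt (fun x => ψ x * F x * H x) _ x :=
      HasDerivAt.mul (HasDerivAt.mul (c := ψ) (d := F) (hψ x) h3) (d := H) h4
    rw [h5.deriv, h1, h2]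
    ring

theorem T_self_D {ψ ψ' : ℝ →ᵇ ℝ} (hψ : IsDer ψ ψ') (f : H1) :
    T ψ (ι f) (D f) = -(1 / 2) * T ψ' (ι f) (ι f) := by
  have := T_by_parts hψ f f
  rw [T_comm ψ (D f)] at this
  linarith

/-- Averages over an interval of unit length are controlled by the `L²` norm. -/
theorem integral_abs_unit_le (f : L2) (x : ℝ) : ∫ y in Set.Icc x (x + 1), |f y| ≤ ‖f‖ := by
  have hfin : volume (Set.Icc x (x + 1)) ≠ ⊤ := by simp
  have h := L2.inner_indicatorConstLp_one (𝕜 := ℝ) measurableSet_Icc hfin |f|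
  have h1 : ∫ y in Set.Icc x (x + 1), |f y| = ∫ y in Set.Icc x (x + 1), (|f| : L2) y := by
    refine integral_congr_ae (ae_restrict_of_ae ?_)
    filter_upwards [Lp.coeFn_abs f] with y hy
    rw [hy]
  rw [h1, ← h]
  refine (real_inner_le_norm _ _).trans ?_
  rw [norm_indicatorConstLp (by norm_num) (by norm_num), norm_abs_eq_norm]
  simp [Measure.real]

/-- The value at `x` is compared with the values on `[x, x + 1]`: averaging over that interval
leaves the mean of `|f|` plus that of `|f'|`, each at most the `H¹` norm. -/
theorem H1.exists_rep (f : H1) :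
    ∃ r : ℝ →ᵇ ℝ, ι f =ᵐ[volume] r ∧ ∀ x, |r x| ≤ 2 * ‖f‖ := by
  obtain ⟨c, hc⟩ := f.exists_primitive
  set F : ℝ → ℝ := fun x => c + ∫ t in (0 : ℝ)..x, D f t with hF
  have hFc : Continuous F := continuous_const.add
    (intervalIntegral.continuous_primitive (fun a b => intervalIntegrable_L2 _ a b) 0)
  have key : ∀ x, |F x| ≤ 2 * ‖f‖ := by
    intro x
    have hle : x ≤ x + 1 := by linarith
    have h1 : ∀ y ∈ Set.Icc x (x + 1),
        |F x| ≤ |ι f y - F y| + |ι f y| + ∫ z in Set.Icc x (x + 1), |D f z| := by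
      intro y hy
      have e : F x = -(ι f y - F y) + ι f y - ∫ z in x..y, D f z := by
        have := intervalIntegral.integral_add_adjacent_intervals
          (intervalIntegrable_L2 (D f) 0 x) (intervalIntegrable_L2 (D f) x y)
        simp only [hF]
        linarith
      have h2 : |∫ z in x..y, D f z| ≤ ∫ z in Set.Icc x (x + 1), |D f z| := by
        refine (intervalIntegral.abs_integral_le_integral_abs hy.1).trans ?_
        rw [intervalIntegral.integral_of_le hy.1]
        refine setIntegral_mono_set ?_ (ae_of_all _ fun _ => abs_nonneg _)
          (Set.Ioc_subset_Icc_self.trans (Set.Icc_subset_Icc_right hy.2)).eventuallyLE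
        exact ((locallyIntegrable_L2 (D f)).integrableOn_isCompact isCompact_Icc).abs
      calc |F x| = |-(ι f y - F y) + ι f y - ∫ z in x..y, D f z| := by rw [← e]
        _ ≤ |-(ι f y - F y) + ι f y| + |∫ z in x..y, D f z| := abs_sub _ _
        _ ≤ |-(ι f y - F y)| + |ι f y| + |∫ z in x..y, D f z| := by
          gcongr; exact abs_add_le _ _
        _ ≤ _ := by rw [abs_neg]; gcongr
    have h3 : ∫ y in Set.Icc x (x + 1), |F x| ≤
        ∫ y in Set.Icc x (x + 1), (|ι f y| + ∫ z in Set.Icc x (x + 1), |D f z|) := by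
      refine integral_mono_ae (integrable_const _) ?_ ?_
      · exact ((locallyIntegrable_L2 (ι f)).integrableOn_isCompact isCompact_Icc).abs.add
          (integrable_const _)
      · filter_upwards [ae_restrict_of_ae hc, ae_restrict_mem measurableSet_Icc] with y hy hy'
        have := h1 y hy'
        rw [hy, sub_self, abs_zero, zero_add, ← hy] at this
        exact this
    rw [integral_add ((locallyIntegrable_L2 (ι f)).integrableOn_isCompact isCompact_Icc).abs
      (integrable_const _)] at h3
    simp only [integral_const, MeasurableSet.univ, measureReal_restrict_apply, Set.univ_inter,
      Real.volume_real_Icc_of_le hle, add_sub_cancel_left, smul_eq_mul, one_mul] at h3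
    linarith [integral_abs_unit_le (ι f) x, integral_abs_unit_le (D f) x, norm_ι_le f, norm_D_le f]
  exact ⟨BoundedContinuousFunction.ofNormedAddCommGroup F hFc _ key, hc, key⟩

theorem bcf_ext_ae {r s : ℝ →ᵇ ℝ} (h : r =ᵐ[volume] s) : r = s :=
  DFunLike.coe_injective ((r.continuous.ae_eq_iff_eq volume s.continuous).1 h)

/-- The continuous representative: the Sobolev embedding of `H¹` in the bounded continuous
functions. -/
noncomputable def rep : H1 →L[ℝ] ℝ →ᵇ ℝ :=
  LinearMap.mkContinuous
    { toFun := fun f => f.exists_rep.choose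
      map_add' := fun f g => bcf_ext_ae (by
        have h : ι (f + g) =ᵐ[volume] ι f + ι g := by rw [map_add]; exact Lp.coeFn_add _ _
        filter_upwards [f.exists_rep.choose_spec.1, g.exists_rep.choose_spec.1,
          (f + g).exists_rep.choose_spec.1, h] with x h1 h2 h3 h4
        rw [← h3, h4, Pi.add_apply, h1, h2]
        rfl)
      map_smul' := fun r f => bcf_ext_ae (by
        have h : ι (r • f) =ᵐ[volume] r • ι f := by rw [map_smul]; exact Lp.coeFn_smul _ _
        filter_upwards [f.exists_rep.choose_spec.1,
          (r • f).exists_rep.choose_spec.1, h] with x h1 h3 h4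
        rw [← h3, h4, Pi.smul_apply, h1]
        rfl) } 2
    (fun f => (BoundedContinuousFunction.norm_le (by positivity)).2 f.exists_rep.choose_spec.2)

theorem coeFn_rep (f : H1) : ι f =ᵐ[volume] rep f := f.exists_rep.choose_spec.1

theorem abs_rep_le (f : H1) (x : ℝ) : |rep f x| ≤ 2 * ‖f‖ := f.exists_rep.choose_spec.2 x

theorem M_rep_comm (f g : H1) : M (rep f) (ι g) = M (rep g) (ι f) := by
  refine Lp.ext ?_
  filter_upwards [coeFn_M (rep f) (ι g), coeFn_M (rep g) (ι f), coeFn_rep f, coeFn_rep g]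
    with x h1 h2 h3 h4
  rw [h1, h2, h3, h4, mul_comm]

/-- The product of two functions of `H¹`. -/
noncomputable def mulH (f g : H1) : H1 :=
  H1.mk (M (rep f) (ι g)) (M (rep f) (D g) + M (rep g) (D f)) (by
    rw [isWeakDeriv_iff_inner]
    intro φ hφ
    have h := T_by_parts hφ.isDer f g
    have e : ∀ (χ : ℝ → ℝ) (hχ : IsTest χ) (k : H1) (v : L2),
        inner ℝ (M (rep k) v) hχ.toL2 = T hχ.bcf v (ι k) := by
      intro χ hχ k v
      rw [hχ.inner_toL2, T_eq_integral]
      refine integral_congr_ae ?_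
      filter_upwards [coeFn_M (rep k) v, coeFn_rep k] with x h1 h2
      rw [h1, h2, IsTest.bcf_apply]; ring
    rw [inner_add_left, e, e, e, T_comm _ (ι g), T_comm _ (D g)]
    linarith)

@[simp] theorem D_mulH (f g : H1) : D (mulH f g) = M (rep f) (D g) + M (rep g) (D f) := rfl

/-! ### The operators `(1 - ∂ₓ²)⁻¹` and `∂ₓ (1 - ∂ₓ²)⁻¹`. -/

/-- The operator `(1 - ∂ₓ²)⁻¹ : L² → H¹`. -/
noncomputable def G : L2 →L[ℝ] H1 := ContinuousLinearMap.adjoint ι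

theorem inner_G (v : L2) (f : H1) : inner ℝ (G v) f = inner ℝ v (ι f) :=
  ContinuousLinearMap.adjoint_inner_left ι f v

/-- The adjoint relation `inner_G`, tested on smooth functions, is the weak form of `g - g'' = v`.
It shows that `D (G v)` is again in `H¹`, which is how `K` is built. -/
theorem isWeakDeriv_D_G (v : L2) : IsWeakDeriv (D (G v)) (ι (G v) - v : L2) := by
  rw [isWeakDeriv_iff_inner]
  intro φ hφ
  have h := inner_G v hφ.toH1
  rw [H1.inner_eq, IsTest.ι_toH1, IsTest.D_toH1] at h
  rw [inner_sub_left]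
  linarith

/-- The operator `∂ₓ (1 - ∂ₓ²)⁻¹ : L² → H¹`. -/
noncomputable def K : L2 →L[ℝ] H1 :=
  ((WithLp.prodContinuousLinearEquiv 2 ℝ L2 L2).symm.toContinuousLinearMap.comp
    ((D.comp G).prod (ι.comp G - ContinuousLinearMap.id ℝ L2))).codRestrict h1Submodule
    fun v => isWeakDeriv_D_G v

theorem D_G (v : L2) : D (G v) = ι (K v) := rfl
theorem D_K (v : L2) : D (K v) = ι (G v) - v := rfl

/-! ### Translations, density of `φ - φ''`, difference quotients. -/

/-- Translation in `L²`. -/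
noncomputable def τ (h : ℝ) : L2 →L[ℝ] L2 :=
  (Lp.compMeasurePreservingₗᵢ ℝ (fun x : ℝ => x + h)
    (measurePreserving_add_right volume h)).toContinuousLinearMap

theorem coeFn_τ (h : ℝ) (f : L2) : τ h f =ᵐ[volume] fun x => f (x + h) :=
  Lp.coeFn_compMeasurePreserving f (measurePreserving_add_right volume h)

theorem norm_τ (h : ℝ) (f : L2) : ‖τ h f‖ = ‖f‖ :=
  Lp.norm_compMeasurePreserving f (measurePreserving_add_right volume h)

theorem continuous_τ (f : L2) : Continuous fun h => τ h f := by
  refine Continuous.compMeasurePreservingLp (p := 2) (μ := (volume : Measure ℝ))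
    (ν := (volume : Measure ℝ)) (f := fun _ : ℝ => f)
    (g := fun h : ℝ => (⟨fun x => x + h, by fun_prop⟩ : C(ℝ, ℝ))) continuous_const ?_
    (fun h => measurePreserving_add_right volume h) (by norm_num)
  exact ContinuousMap.continuous_of_continuous_uncurry _
    (show Continuous fun p : ℝ × ℝ => p.2 + p.1 by fun_prop)

theorem IsTest.shift {φ : ℝ → ℝ} (hφ : IsTest φ) (h : ℝ) : IsTest fun x => φ (x - h) :=
  ⟨hφ.1.comp (contDiff_id.sub contDiff_const),
    hφ.2.comp_homeomorph (Homeomorph.subRight h)⟩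

theorem inner_τ_test (h : ℝ) (f : L2) {φ : ℝ → ℝ} (hφ : IsTest φ) :
    inner ℝ (τ h f) hφ.toL2 = inner ℝ f (hφ.shift h).toL2 := by
  rw [IsTest.inner_toL2, IsTest.inner_toL2]
  rw [← integral_add_right_eq_self (fun x => f x * φ (x - h)) h]
  refine integral_congr_ae ?_
  filter_upwards [coeFn_τ h f] with x hx
  rw [hx, add_sub_cancel_right]

theorem deriv_shift (φ : ℝ → ℝ) (h : ℝ) :
    deriv (fun x => φ (x - h)) = fun x => deriv φ (x - h) :=
  funext fun x => deriv_comp_sub_const φ h x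

theorem IsTest.toL2_congr {φ χ : ℝ → ℝ} (hφ : IsTest φ) (hχ : IsTest χ) (h : φ = χ) :
    hφ.toL2 = hχ.toL2 := by
  subst h; rfl

theorem IsTest.toL2_deriv_shift {φ : ℝ → ℝ} (hφ : IsTest φ) (h : ℝ) :
    (hφ.shift h).isTest_deriv.toL2 = (hφ.isTest_deriv.shift h).toL2 :=
  IsTest.toL2_congr _ _ (deriv_shift φ h)

/-- As a function of the shift, the pairing is the convolution of `f` with the reflected test
function, so the derivative falls on the smooth factor. -/
theorem hasDerivAt_inner_shift (f : L2) {φ : ℝ → ℝ} (hφ : IsTest φ) (s : ℝ) :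
    HasDerivAt (fun s => inner ℝ f (hφ.shift s).toL2)
      (-inner ℝ f (hφ.isTest_deriv.shift s).toL2) s := by
  have h1 : IsTest fun y => φ (-y) :=
    ⟨hφ.1.comp contDiff_neg, hφ.2.comp_homeomorph (Homeomorph.neg ℝ)⟩
  have h := h1.2.hasDerivAt_convolution_right (ContinuousLinearMap.mul ℝ ℝ) (μ := volume)
    (locallyIntegrable_L2 f) (h1.1.of_le (by simp)) s
  have e : (fun s => inner ℝ f (hφ.shift s).toL2) =
      convolution f (fun y => φ (-y)) (ContinuousLinearMap.mul ℝ ℝ) volume := by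
    funext s
    rw [IsTest.inner_toL2, convolution_def]
    simp
  rw [e]
  refine h.congr_deriv ?_
  rw [IsTest.inner_toL2, convolution_def, ← integral_neg]
  refine integral_congr_ae (ae_of_all _ fun x => ?_)
  simp [deriv_comp_neg]

/-- The equation is `y'' = y`. Both `(y + y') e^{-s}` and `(y - y') e^{s}` are constant, and
boundedness makes them vanish at `+∞` and `-∞` respectively. -/
theorem eq_zero_of_bounded_of_deriv_deriv_eq {y y' : ℝ → ℝ} {B : ℝ} (h1 : ∀ s, HasDerivAt y (y' s) s)
    (h2 : ∀ s, HasDerivAt y' (y s) s) (hy : ∀ s, |y s| ≤ B) (hy' : ∀ s, |y' s| ≤ B) (s : ℝ) :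
    y s = 0 := by
  have ha : ∀ s, HasDerivAt (fun s => (y s + y' s) * Real.exp (-s)) 0 s := fun s => by
    have := ((h1 s).add (h2 s)).mul ((hasDerivAt_neg s).exp)
    refine this.congr_deriv ?_
    simp only [Pi.add_apply]; ring
  have hb : ∀ s, HasDerivAt (fun s => (y s - y' s) * Real.exp s) 0 s := fun s => by
    have := ((h1 s).sub (h2 s)).mul (Real.hasDerivAt_exp s)
    refine this.congr_deriv ?_
    simp only [Pi.sub_apply]; ring
  have ca : ∀ r, (y r + y' r) * Real.exp (-r) = (y s + y' s) * Real.exp (-s) := fun r =>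
    is_const_of_deriv_eq_zero (fun x => (ha x).differentiableAt) (fun x => (ha x).deriv) r s
  have cb : ∀ r, (y r - y' r) * Real.exp r = (y s - y' s) * Real.exp s := fun r =>
    is_const_of_deriv_eq_zero (fun x => (hb x).differentiableAt) (fun x => (hb x).deriv) r s
  have za : (y s + y' s) * Real.exp (-s) = 0 := by
    have t1 : Tendsto (fun r : ℝ => 2 * B * Real.exp (-r)) atTop (𝓝 0) := by
      simpa using (Real.tendsto_exp_neg_atTop_nhds_zero.const_mul (2 * B))
    refine abs_eq_zero.1 (le_antisymm (ge_of_tendsto' t1 fun r => ?_) (abs_nonneg _))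
    rw [← ca r, abs_mul, abs_of_pos (Real.exp_pos _)]
    refine mul_le_mul_of_nonneg_right ?_ (Real.exp_pos _).le
    linarith [abs_add_le (y r) (y' r), hy r, hy' r]
  have zb : (y s - y' s) * Real.exp s = 0 := by
    have t1 : Tendsto (fun r : ℝ => 2 * B * Real.exp r) atBot (𝓝 0) := by
      simpa using (Real.tendsto_exp_atBot.const_mul (2 * B))
    refine abs_eq_zero.1 (le_antisymm (ge_of_tendsto' t1 fun r => ?_) (abs_nonneg _))
    rw [← cb r, abs_mul, abs_of_pos (Real.exp_pos _)]
    refine mul_le_mul_of_nonneg_right ?_ (Real.exp_pos _).le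
    linarith [abs_sub (y r) (y' r), hy r, hy' r]
  have za' := (mul_eq_zero.1 za).resolve_right (Real.exp_pos _).ne'
  have zb' := (mul_eq_zero.1 zb).resolve_right (Real.exp_pos _).ne'
  linarith

theorem IsTest.norm_shift {φ : ℝ → ℝ} (hφ : IsTest φ) (h : ℝ) :
    ‖(hφ.shift h).toL2‖ = ‖hφ.toL2‖ := by
  rw [← norm_τ h (hφ.shift h).toL2]
  congr 1
  refine Lp.ext ?_
  have h2 := (measurePreserving_add_right (volume : Measure ℝ) h).quasiMeasurePreserving.ae
    (hφ.shift h).coeFn_toL2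
  filter_upwards [coeFn_τ h (hφ.shift h).toL2, hφ.coeFn_toL2, h2] with x h1 h3 h4
  rw [h1, h3, h4, add_sub_cancel_right]

/-- The functions `φ - φ''`, for test functions `φ`, span a dense subspace of `L²`. -/
theorem eq_zero_of_forall_inner_test_sub {f : L2}
    (h : ∀ φ, ∀ hφ : IsTest φ, inner ℝ f hφ.toL2 = inner ℝ f hφ.isTest_deriv.isTest_deriv.toL2) :
    f = 0 := by
  refine eq_zero_of_forall_inner_test fun φ hφ => ?_
  have e0 : hφ.toL2 = (hφ.shift 0).toL2 := IsTest.toL2_congr _ _ (by simp)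
  rw [e0]
  -- Applied to all translates of `φ`, the hypothesis says that the pairing of `f` with the
  -- translate by `s` is a bounded solution of `y'' = y`.
  refine eq_zero_of_bounded_of_deriv_deriv_eq (y := fun s => inner ℝ f (hφ.shift s).toL2)
    (y' := fun s => -inner ℝ f (hφ.isTest_deriv.shift s).toL2)
    (B := max (‖f‖ * ‖hφ.toL2‖) (‖f‖ * ‖hφ.isTest_deriv.toL2‖))
    (fun s => hasDerivAt_inner_shift f hφ s) (fun s => ?_) (fun s => ?_) (fun s => ?_) 0
  · refine (hasDerivAt_inner_shift f hφ.isTest_deriv s).neg.congr_deriv ?_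
    rw [neg_neg, h _ (hφ.shift s)]
    congr 1
    refine IsTest.toL2_congr _ _ ?_
    rw [deriv_shift, deriv_shift]
  · rw [← hφ.norm_shift s]
    exact (abs_real_inner_le_norm _ _).trans (le_max_left _ _)
  · rw [abs_neg, ← hφ.isTest_deriv.norm_shift s]
    exact (abs_real_inner_le_norm _ _).trans (le_max_right _ _)

/-- Translation in `H¹`. -/
noncomputable def τH (h : ℝ) : H1 →L[ℝ] H1 :=
  ((WithLp.prodContinuousLinearEquiv 2 ℝ L2 L2).symm.toContinuousLinearMap.comp
    (((τ h).comp ι).prod ((τ h).comp D))).codRestrict h1Submodule fun f => by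
      have key : IsWeakDeriv (τ h (ι f)) (τ h (D f)) := by
        rw [isWeakDeriv_iff_inner]
        intro φ hφ
        rw [inner_τ_test, inner_τ_test, ← IsTest.toL2_deriv_shift hφ]
        exact (isWeakDeriv_iff_inner _ _).1 f.isWeakDeriv _ (hφ.shift h)
      exact key

theorem ι_τH (h : ℝ) (f : H1) : ι (τH h f) = τ h (ι f) := rfl
theorem D_τH (h : ℝ) (f : H1) : D (τH h f) = τ h (D f) := rfl

theorem τ_zero (f : L2) : τ 0 f = f := by
  refine Lp.ext ?_
  filter_upwards [coeFn_τ 0 f] with x hx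
  rw [hx, add_zero]

/-- Against each test function, both sides vanish at `h = 0` and have the same derivative in `h`.
This yields both the uniform bound and the limit of the difference quotients. -/
theorem τ_sub_eq_integral (h : ℝ) (f : H1) : τ h (ι f) - ι f = ∫ s in (0 : ℝ)..h, τ s (D f) := by
  rw [← sub_eq_zero]
  refine eq_zero_of_forall_inner_test fun φ hφ => ?_
  have hd : ∀ r, HasDerivAt (fun r => inner ℝ (τ r (ι f) - ι f - ∫ s in (0 : ℝ)..r, τ s (D f))
      hφ.toL2) 0 r := by
    intro r
    have h1 : HasDerivAt (fun r => ∫ s in (0 : ℝ)..r, τ s (D f)) (τ r (D f)) r :=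
      intervalIntegral.integral_hasDerivAt_right ((continuous_τ _).intervalIntegrable _ _)
        ((continuous_τ _).stronglyMeasurableAtFilter _ _) (continuous_τ _).continuousAt
    have h2 := h1.inner ℝ (hasDerivAt_const r hφ.toL2)
    have h3 := ((hasDerivAt_inner_shift (ι f) hφ r).sub_const (inner ℝ (ι f) hφ.toL2)).sub h2
    refine (h3.congr_deriv ?_).congr_of_eventuallyEq (Eventually.of_forall fun r => ?_)
    · have h4 := (isWeakDeriv_iff_inner _ _).1 f.isWeakDeriv _ (hφ.shift r)
      rw [IsTest.toL2_deriv_shift hφ] at h4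
      rw [inner_zero_right, zero_add, inner_τ_test]
      linarith
    · simp only [inner_sub_left, inner_τ_test, Pi.sub_apply]
  have := is_const_of_deriv_eq_zero (fun x => (hd x).differentiableAt) (fun x => (hd x).deriv) h 0
  rw [this, τ_zero]
  simp

/-- Difference quotients in `L²`. -/
noncomputable def Δ (h : ℝ) : L2 →L[ℝ] L2 := h⁻¹ • (τ h - ContinuousLinearMap.id ℝ L2)

/-- Difference quotients in `H¹`. -/
noncomputable def ΔH (h : ℝ) : H1 →L[ℝ] H1 := h⁻¹ • (τH h - ContinuousLinearMap.id ℝ H1)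

theorem ι_ΔH (h : ℝ) (f : H1) : ι (ΔH h f) = Δ h (ι f) := by
  simp [ΔH, Δ, ι_τH]

theorem D_ΔH (h : ℝ) (f : H1) : D (ΔH h f) = Δ h (D f) := by
  simp [ΔH, Δ, D_τH]

theorem Δ_eq (h : ℝ) (f : L2) : Δ h f = h⁻¹ • (τ h f - f) := rfl

theorem norm_Δ_le (h : ℝ) (f : H1) : ‖Δ h (ι f)‖ ≤ ‖D f‖ := by
  rw [Δ_eq, norm_smul, norm_inv, Real.norm_eq_abs, τ_sub_eq_integral]
  have h1 : ‖∫ s in (0 : ℝ)..h, τ s (D f)‖ ≤ ‖D f‖ * |h - 0| :=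
    intervalIntegral.norm_integral_le_of_norm_le_const fun s _ => (norm_τ s (D f)).le
  rw [sub_zero] at h1
  by_cases hh : h = 0
  · simp [hh]
  · rw [inv_mul_le_iff₀ (abs_pos.2 hh), mul_comm]
    exact h1

theorem tendsto_Δ (f : H1) : Tendsto (fun h => Δ h (ι f)) (𝓝[≠] 0) (𝓝 (D f)) := by
  have h1 : HasDerivAt (fun r => ∫ s in (0 : ℝ)..r, τ s (D f)) (τ 0 (D f)) 0 :=
    intervalIntegral.integral_hasDerivAt_right ((continuous_τ _).intervalIntegrable _ _)
      ((continuous_τ _).stronglyMeasurableAtFilter _ _) (continuous_τ _).continuousAt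
  rw [τ_zero] at h1
  refine (hasDerivAt_iff_tendsto_slope.1 h1).congr fun h => ?_
  rw [slope_def_module, intervalIntegral.integral_same, sub_zero, sub_zero, ← τ_sub_eq_integral,
    Δ_eq]

/-! ### Time derivatives of functionals of curves differentiable only in `L²`. -/

/-- A curve in `L²` is differentiable as soon as it is so when tested against the functions
`φ - φ''`, with a continuous candidate for the derivative. -/
theorem hasDerivAt_of_forall_test {Y R : ℝ → L2} (hR : Continuous R)
    (h : ∀ φ, ∀ hφ : IsTest φ, ∀ t,
      HasDerivAt (fun s => inner ℝ (Y s) (hφ.toL2 - hφ.isTest_deriv.isTest_deriv.toL2))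
        (inner ℝ (R t) (hφ.toL2 - hφ.isTest_deriv.isTest_deriv.toL2)) t) (t : ℝ) :
    HasDerivAt Y (R t) t := by
  have h1 : ∀ t, HasDerivAt (fun r => ∫ s in (0 : ℝ)..r, R s) (R t) t := fun t =>
    intervalIntegral.integral_hasDerivAt_right (hR.intervalIntegrable _ _)
      (hR.stronglyMeasurableAtFilter _ _) hR.continuousAt
  have key : ∀ t, Y t = Y 0 + ∫ s in (0 : ℝ)..t, R s := by
    intro t
    rw [← sub_eq_zero]
    refine eq_zero_of_forall_inner_test_sub fun φ hφ => ?_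
    rw [← sub_eq_zero, ← inner_sub_right]
    set χ := hφ.toL2 - hφ.isTest_deriv.isTest_deriv.toL2
    have hd : ∀ r, HasDerivAt (fun r => inner ℝ (Y r - (Y 0 + ∫ s in (0 : ℝ)..r, R s)) χ) 0 r := by
      intro r
      have h2 := ((h1 r).const_add (Y 0)).inner ℝ (hasDerivAt_const r χ)
      refine (((h φ hφ r).sub h2).congr_deriv ?_).congr_of_eventuallyEq
        (Eventually.of_forall fun r => ?_)
      · simp [χ]
      · simp only [inner_sub_left, Pi.sub_apply, χ]
    rw [is_const_of_deriv_eq_zero (fun x => (hd x).differentiableAt) (fun x => (hd x).deriv) t 0]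
    simp
  have : Y = fun t => Y 0 + ∫ s in (0 : ℝ)..t, R s := funext key
  rw [this]
  exact (h1 t).const_add _

/-- A product rule in which the operator factor need only be continuous, because the vector factor
vanishes at the point. It stands in for the missing time derivative of curves in `H¹`. -/
theorem hasDerivAt_clm_apply_of_eq_zero {E F : Type*} [NormedAddCommGroup E] [NormedSpace ℝ E]
    [NormedAddCommGroup F] [NormedSpace ℝ F] {A : ℝ → E →L[ℝ] F} {w : ℝ → E} {w' : E} {t : ℝ}
    (hA : ContinuousAt A t) (hw : HasDerivAt w w' t) (h0 : w t = 0) :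
    HasDerivAt (fun s => A s (w s)) (A t w') t := by
  rw [hasDerivAt_iff_tendsto_slope] at hw ⊢
  have h1 : Tendsto A (𝓝[≠] t) (𝓝 (A t)) := hA.mono_left nhdsWithin_le_nhds
  refine ((isBoundedBilinearMap_apply.continuous.tendsto (A t, w')).comp (h1.prodMk_nhds hw)).congr fun s => ?_
  simp [slope_def_module, h0]

/-- The derivative of a product of two curves of `H¹` that are differentiable in `L²`. -/
theorem hasDerivAt_M_rep {U V : ℝ → H1} {U' V' : L2} {t : ℝ} (cU : ContinuousAt U t)
    (hU : HasDerivAt (fun s => ι (U s)) U' t) (hV : HasDerivAt (fun s => ι (V s)) V' t) :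
    HasDerivAt (fun s => M (rep (U s)) (ι (V s))) (M (rep (U t)) V' + M (rep (V t)) U') t := by
  have hA : ContinuousAt (fun s => M (rep (U s))) t :=
    M.continuous.continuousAt.comp (rep.continuous.continuousAt.comp cU)
  -- Splitting `UV - U(t)V(t) = U (V - V(t)) + V(t) (U - U(t))`: only continuity of the
  -- representative of `U` in the uniform norm is used.
  have h1 := hasDerivAt_clm_apply_of_eq_zero hA (hV.sub_const (ι (V t))) (sub_self _)
  have h2 := (M (rep (V t))).hasFDerivAt.comp_hasDerivAt t hU
  refine (h1.add h2).congr_of_eventuallyEq (Eventually.of_forall fun s => ?_)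
  simp only [Pi.add_apply, Function.comp_apply, map_sub, M_rep_comm (V t) (U s)]
  abel

/-- Isolates the effect of a moving weight, so that only continuity of `U` and `V` is needed. The
effect of the motion of the solution is then computed with the weight frozen at time `t`. -/
theorem hasDerivAt_T_sub_weight {Φ : ℝ → ℝ →ᵇ ℝ} {Φ' : ℝ →ᵇ ℝ} {U V : ℝ → L2} {t : ℝ}
    (hΦ : HasDerivAt Φ Φ' t) (hU : ContinuousAt U t) (hV : ContinuousAt V t) :
    HasDerivAt (fun s => T (Φ s - Φ t) (U s) (V s)) (T Φ' (U t) (V t)) t := by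
  have hA : ContinuousAt (fun s => (innerSL ℝ (V s)).comp (M.flip (U s))) t :=
    ((innerSL ℝ).continuous.continuousAt.comp hV).clm_comp
      (M.flip.continuous.continuousAt.comp hU)
  have h1 := hasDerivAt_clm_apply_of_eq_zero hA (hΦ.sub_const (Φ t)) (sub_self _)
  refine (h1.congr_deriv ?_).congr_of_eventuallyEq (Eventually.of_forall fun s => ?_)
  · simp [T, real_inner_comm]
  · simp [T, real_inner_comm]

/-- The increment in `U` is paired with `D (V s)`, which is merely continuous; in the increment of
`D V` the derivative is moved onto the weight and `U t` by parts, so that no derivative of `V'`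
appears. -/
theorem hasDerivAt_T_D {ψ ψ' : ℝ →ᵇ ℝ} (hψ : IsDer ψ ψ') {U V : ℝ → H1} {U' V' : L2} {t : ℝ}
    (cV : ContinuousAt V t)
    (hU : HasDerivAt (fun s => ι (U s)) U' t) (hV : HasDerivAt (fun s => ι (V s)) V' t) :
    HasDerivAt (fun s => T ψ (ι (U s)) (D (V s)))
      (T ψ U' (D (V t)) - T ψ' (ι (U t)) V' - T ψ (D (U t)) V') t := by
  have hA : ContinuousAt (fun s => (innerSL ℝ (D (V s))).comp (M ψ)) t :=
    ((innerSL ℝ).continuous.continuousAt.comp (D.continuous.continuousAt.comp cV)).clm_comp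
      continuousAt_const
  have h1 := hasDerivAt_clm_apply_of_eq_zero hA (hU.sub_const (ι (U t))) (sub_self _)
  have h2 := (hasDerivAt_const t ψ').T (hasDerivAt_const t (ι (U t))) hV
  have h3 := (hasDerivAt_const t ψ).T (hasDerivAt_const t (D (U t))) hV
  refine (((h1.sub h2).sub h3).congr_deriv ?_).congr_of_eventuallyEq
    (Eventually.of_forall fun s => ?_)
  · have e : ∀ f g, T (0 : ℝ →ᵇ ℝ) f g = 0 := T_zero_weight
    have e' : ∀ (ψ : ℝ →ᵇ ℝ) g, T ψ 0 g = 0 := fun ψ g => by simp [T]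
    simp only [e, e', zero_add]
    simp [T, real_inner_comm]
  · have h4 := T_by_parts hψ (U t) (V s)
    simp only [Pi.sub_apply, ContinuousLinearMap.comp_apply, innerSL_apply_apply]
    have h5 : inner ℝ (D (V s)) (M ψ (ι (U s) - ι (U t))) =
        T ψ (ι (U s)) (D (V s)) - T ψ (ι (U t)) (D (V s)) := by
      rw [← T_sub_left, T, real_inner_comm]
    rw [h5]
    linarith

/-- The approximations are written as integrals of their derivatives, the limit is taken by
dominated convergence, and the resulting integral is differentiated using continuity of `F'`. -/
theorem hasDerivAt_of_tendsto_dominated {F F' B : ℝ → ℝ} {Fn Fn' : ℕ → ℝ → ℝ}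
    (hd : ∀ n s, HasDerivAt (Fn n) (Fn' n s) s) (hc : ∀ n, Continuous (Fn' n))
    (h1 : ∀ s, Tendsto (fun n => Fn n s) atTop (𝓝 (F s)))
    (h2 : ∀ s, Tendsto (fun n => Fn' n s) atTop (𝓝 (F' s)))
    (hB : Continuous B) (hle : ∀ n s, |Fn' n s| ≤ B s) (hF' : Continuous F') (t : ℝ) :
    HasDerivAt F (F' t) t := by
  have key : ∀ t, F t = F 0 + ∫ s in (0 : ℝ)..t, F' s := by
    intro t
    have e : ∀ n, Fn n t - Fn n 0 = ∫ s in (0 : ℝ)..t, Fn' n s := fun n =>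
      (intervalIntegral.integral_eq_sub_of_hasDerivAt (fun s _ => hd n s)
        ((hc n).intervalIntegrable _ _)).symm
    have l1 := (h1 t).sub (h1 0)
    simp only [e] at l1
    have l2 : Tendsto (fun n => ∫ s in (0 : ℝ)..t, Fn' n s) atTop (𝓝 (∫ s in (0 : ℝ)..t, F' s)) :=
      intervalIntegral.tendsto_integral_filter_of_dominated_convergence B
        (Eventually.of_forall fun n => (hc n).aestronglyMeasurable)
        (Eventually.of_forall fun n => ae_of_all _ fun s _ => hle n s)
        (hB.intervalIntegrable _ _) (ae_of_all _ fun s _ => h2 s)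
    linarith [tendsto_nhds_unique l1 l2]
  have h3 : HasDerivAt (fun r => ∫ s in (0 : ℝ)..r, F' s) (F' t) t :=
    intervalIntegral.integral_hasDerivAt_right (hF'.intervalIntegrable _ _)
      (hF'.stronglyMeasurableAtFilter _ _) hF'.continuousAt
  rw [show F = fun t => F 0 + ∫ s in (0 : ℝ)..t, F' s from funext key]
  exact h3.const_add _

theorem tendsto_T {X : Type*} {l : Filter X} (ψ : ℝ →ᵇ ℝ) {U V : X → L2} {f g : L2}
    (hU : Tendsto U l (𝓝 f)) (hV : Tendsto V l (𝓝 g)) :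
    Tendsto (fun s => T ψ (U s) (V s)) l (𝓝 (T ψ f g)) :=
  (((M ψ).continuous.tendsto f).comp hU).inner hV

/-- The derivative of the quadratic forms `∫ ψ (k₁ ∂ₓu ∂ₓη + k₂ / 2 (a (∂ₓu)² + c (∂ₓη)²))` along the
solutions of `∂ₜu = c ∂ₓη + f`, `∂ₜη = a ∂ₓu + g`. -/
theorem hasDerivAt_T_D_D {ψ ψ' : ℝ →ᵇ ℝ} (hψ : IsDer ψ ψ') (k₁ k₂ a c : ℝ) {U V f g : ℝ → H1}
    (cU : Continuous U) (cV : Continuous V) (cf : Continuous f) (cg : Continuous g)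
    (hU : ∀ t, HasDerivAt (fun s => ι (U s)) (c • D (V t) + ι (f t)) t)
    (hV : ∀ t, HasDerivAt (fun s => ι (V s)) (a • D (U t) + ι (g t)) t) (t : ℝ) :
    HasDerivAt (fun s => k₁ * T ψ (D (U s)) (D (V s))
        + k₂ / 2 * (a * T ψ (D (U s)) (D (U s)) + c * T ψ (D (V s)) (D (V s))))
      (k₁ * (-(1 / 2) * (c * T ψ' (D (V t)) (D (V t)) + a * T ψ' (D (U t)) (D (U t)))
          + T ψ (D (f t)) (D (V t)) + T ψ (D (U t)) (D (g t)))
        + k₂ * (-(a * c) * T ψ' (D (U t)) (D (V t)) + a * T ψ (D (U t)) (D (f t))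
          + c * T ψ (D (V t)) (D (g t)))) t := by
  -- The spatial derivatives are replaced by difference quotients of step `1/(n+1)`. These are
  -- differentiable in time, satisfy the same linear equations with difference-quotient forcing, and
  -- are bounded by the true derivatives uniformly in `n`.
  set h : ℕ → ℝ := fun n => 1 / ((n : ℝ) + 1) with hh
  have hh0 : Tendsto h atTop (𝓝[≠] 0) := by
    refine tendsto_nhdsWithin_iff.2 ⟨tendsto_one_div_add_atTop_nhds_zero_nat, ?_⟩
    exact Eventually.of_forall fun n => by
      simp only [hh, Set.mem_compl_iff, Set.mem_singleton_iff]; positivity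
  have lim : ∀ v : H1, Tendsto (fun n => Δ (h n) (ι v)) atTop (𝓝 (D v)) := fun v =>
    (tendsto_Δ v).comp hh0
  set E : L2 → L2 → ℝ := fun p q => k₁ * T ψ p q + k₂ / 2 * (a * T ψ p p + c * T ψ q q) with hE
  set E' : L2 → L2 → L2 → L2 → ℝ := fun p q r s =>
    k₁ * (-(1 / 2) * (c * T ψ' q q + a * T ψ' p p) + T ψ r q + T ψ p s)
      + k₂ * (-(a * c) * T ψ' p q + a * T ψ p r + c * T ψ q s) with hE'
  have cont : ∀ {P Q R S : ℝ → L2}, Continuous P → Continuous Q → Continuous R → Continuous S →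
      Continuous fun t => E' (P t) (Q t) (R t) (S t) := by
    intro P Q R S hP hQ hR hS
    have := continuous_T (Φ := fun _ : ℝ => ψ') continuous_const hQ hQ
    have := continuous_T (Φ := fun _ : ℝ => ψ') continuous_const hP hP
    have := continuous_T (Φ := fun _ : ℝ => ψ') continuous_const hP hQ
    have := continuous_T (Φ := fun _ : ℝ => ψ) continuous_const hR hQ
    have := continuous_T (Φ := fun _ : ℝ => ψ) continuous_const hP hS
    have := continuous_T (Φ := fun _ : ℝ => ψ) continuous_const hP hR
    have := continuous_T (Φ := fun _ : ℝ => ψ) continuous_const hQ hS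
    simp only [hE']
    fun_prop
  have cD : ∀ {W : ℝ → H1}, Continuous W → Continuous fun s => D (W s) := fun hW =>
    D.continuous.comp hW
  have cΔ : ∀ n {W : ℝ → H1}, Continuous W → Continuous fun s => Δ (h n) (ι (W s)) := fun n _ hW =>
    (Δ (h n)).continuous.comp (ι.continuous.comp hW)
  set N : ℝ → ℝ := fun s => ‖D (U s)‖ + ‖D (V s)‖ + ‖D (f s)‖ + ‖D (g s)‖ with hN
  have cN : Continuous N := (((cD cU).norm.add (cD cV).norm).add (cD cf).norm).add (cD cg).norm
  set m := ‖ψ‖ + ‖ψ'‖ with hm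
  refine hasDerivAt_of_tendsto_dominated
    (Fn := fun n s => E (Δ (h n) (ι (U s))) (Δ (h n) (ι (V s))))
    (Fn' := fun n s => E' (Δ (h n) (ι (U s))) (Δ (h n) (ι (V s))) (Δ (h n) (ι (f s)))
      (Δ (h n) (ι (g s))))
    (F' := fun s => E' (D (U s)) (D (V s)) (D (f s)) (D (g s)))
    (B := fun s => (|k₁| * (|c| + |a| + 2) + |k₂| * (|a * c| + |a| + |c|)) * (m * N s ^ 2))
    ?_ ?_ ?_ ?_ ?_ ?_ ?_ t
  · intro n s
    have dU : HasDerivAt (fun s => Δ (h n) (ι (U s))) (c • D (ΔH (h n) (V s)) + Δ (h n) (ι (f s))) s := by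
      refine ((Δ (h n)).hasFDerivAt.comp_hasDerivAt s (hU s)).congr_deriv ?_
      rw [map_add, map_smul, D_ΔH]
    have dV : HasDerivAt (fun s => Δ (h n) (ι (V s))) (a • D (ΔH (h n) (U s)) + Δ (h n) (ι (g s))) s := by
      refine ((Δ (h n)).hasFDerivAt.comp_hasDerivAt s (hV s)).congr_deriv ?_
      rw [map_add, map_smul, D_ΔH]
    have cψ := hasDerivAt_const s ψ
    have key := ((cψ.T dU dV).const_mul k₁).add
      ((((cψ.T dU dU).const_mul a).add ((cψ.T dV dV).const_mul c)).const_mul (k₂ / 2))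
    refine key.congr_deriv ?_
    have i1 := T_by_parts hψ (ΔH (h n) (U s)) (ΔH (h n) (V s))
    have i2 := T_self_D hψ (ΔH (h n) (U s))
    have i3 := T_self_D hψ (ΔH (h n) (V s))
    simp only [ι_ΔH] at i1 i2 i3
    simp only [T_zero_weight, T_add_left, T_add_right, T_smul_left, T_smul_right, hE']
    -- The terms of highest order enter only in combinations that are total derivatives: `i2` and
    -- `i3` treat the squares in the momentum part, and `i1` the mixed product in the energy part,
    -- where the coefficients `a` and `c` match.
    linear_combination k₁ * c * (T_comm ψ (D (ΔH (h n) (V s))) (Δ (h n) (ι (V s))) + i3)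
      + k₁ * a * i2 + k₂ * a * c * i1
      + k₂ / 2 * a * c * T_comm ψ (D (ΔH (h n) (V s))) (Δ (h n) (ι (U s)))
      + k₂ / 2 * a * c * T_comm ψ (Δ (h n) (ι (V s))) (D (ΔH (h n) (U s)))
      + k₂ / 2 * a * T_comm ψ (Δ (h n) (ι (f s))) (Δ (h n) (ι (U s)))
      + k₂ / 2 * c * T_comm ψ (Δ (h n) (ι (g s))) (Δ (h n) (ι (V s)))
  · exact fun n => cont (cΔ n cU) (cΔ n cV) (cΔ n cf) (cΔ n cg)
  · intro s
    exact ((tendsto_T ψ (lim _) (lim _)).const_mul _).add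
      ((((tendsto_T ψ (lim _) (lim _)).const_mul _).add
        ((tendsto_T ψ (lim _) (lim _)).const_mul _)).const_mul _)
  · intro s
    exact (((((((tendsto_T ψ' (lim _) (lim _)).const_mul _).add
        ((tendsto_T ψ' (lim _) (lim _)).const_mul _)).const_mul _).add
        (tendsto_T ψ (lim _) (lim _))).add (tendsto_T ψ (lim _) (lim _))).const_mul _).add
      ((((tendsto_T ψ' (lim _) (lim _)).const_mul _).add
        ((tendsto_T ψ (lim _) (lim _)).const_mul _)).add
        ((tendsto_T ψ (lim _) (lim _)).const_mul _)|>.const_mul _)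
  · exact continuous_const.mul (continuous_const.mul (cN.pow 2))
  · intro n s
    have p1 := norm_nonneg (D (U s))
    have p2 := norm_nonneg (D (V s))
    have p3 := norm_nonneg (D (f s))
    have p4 := norm_nonneg (D (g s))
    have nb : ∀ v : H1, ‖D v‖ ≤ N s → ‖Δ (h n) (ι v)‖ ≤ N s := fun v hv =>
      (norm_Δ_le _ v).trans hv
    have n1 := nb (U s) (by simp only [hN]; linarith)
    have n2 := nb (V s) (by simp only [hN]; linarith)
    have n3 := nb (f s) (by simp only [hN]; linarith)
    have n4 := nb (g s) (by simp only [hN]; linarith)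
    have hTb : ∀ (k : ℝ) (χ : ℝ →ᵇ ℝ) (v w : L2), ‖χ‖ ≤ m → ‖v‖ ≤ N s → ‖w‖ ≤ N s →
        |k * T χ v w| ≤ |k| * (m * N s ^ 2) := by
      intro k χ v w h1 h2 h3
      rw [abs_mul]
      refine mul_le_mul_of_nonneg_left ((abs_T_le_norm χ v w).trans ?_) (abs_nonneg _)
      rw [sq, ← mul_assoc]
      have : 0 ≤ N s := (norm_nonneg _).trans h2
      have : 0 ≤ m := (norm_nonneg _).trans h1
      gcongr
    have m1 : ‖ψ‖ ≤ m := by simp [hm]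
    have m2 : ‖ψ'‖ ≤ m := by simp [hm]
    generalize Δ (h n) (ι (U s)) = p at *
    generalize Δ (h n) (ι (V s)) = q at *
    generalize Δ (h n) (ι (f s)) = r at *
    generalize Δ (h n) (ι (g s)) = z at *
    have b1 := hTb (k₁ * c) ψ' q q m2 n2 n2
    have b2 := hTb (k₁ * a) ψ' p p m2 n1 n1
    have b3 := hTb k₁ ψ r q m1 n3 n2
    have b4 := hTb k₁ ψ p z m1 n1 n4
    have b5 := hTb (k₂ * (a * c)) ψ' p q m2 n1 n2
    have b6 := hTb (k₂ * a) ψ p r m1 n1 n3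
    have b7 := hTb (k₂ * c) ψ q z m1 n2 n4
    simp only [hE']
    rw [abs_mul k₁] at b1 b2
    rw [abs_mul k₂] at b5 b6 b7
    rw [abs_le] at b1 b2 b3 b4 b5 b6 b7 ⊢
    constructor <;> linarith
  · exact cont (cD cU) (cD cV) (cD cf) (cD cg)

/-! ### The system as an evolution equation in `L²`. -/

/-- The product of two functions of `H¹`, as an element of `L²`. -/
noncomputable def prodL2 (u v : H1) : L2 := M (rep u) (ι v)

theorem prodL2_comm (u v : H1) : prodL2 u v = prodL2 v u := M_rep_comm u v

theorem coeFn_prodL2 (u v : H1) : prodL2 u v =ᵐ[volume] fun x => u.fn x * v.fn x := by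
  filter_upwards [coeFn_M (rep u) (ι v), coeFn_rep u] with x h1 h2
  rw [prodL2, h1, ← h2]; rfl

theorem T_M_swap (ψ φ : ℝ →ᵇ ℝ) (f g : L2) : T ψ (M φ f) g = T ψ f (M φ g) := by
  rw [T_M_left, T_M_right]

theorem continuous_prodL2 {X : Type*} [TopologicalSpace X] {u v : X → H1} (hu : Continuous u)
    (hv : Continuous v) : Continuous fun s => prodL2 (u s) (v s) :=
  (M.continuous.comp (rep.continuous.comp hu)).clm_apply (ι.continuous.comp hv)

/-- The part of order zero in the equation for `u`. -/
noncomputable def lowerU (c : ℝ) (u η : H1) : H1 :=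
  (-(1 + c)) • K (ι η) - (1 / 2 : ℝ) • K (prodL2 u u)

/-- The part of order zero in the equation for `η`. -/
noncomputable def lowerη (a : ℝ) (u η : H1) : H1 :=
  (-(1 + a)) • K (ι u) - K (prodL2 u η)

/-- The time derivative of `u`. -/
noncomputable def velU (c : ℝ) (u η : H1) : L2 := c • D η + ι (lowerU c u η)

/-- The time derivative of `η`. -/
noncomputable def velη (a : ℝ) (u η : H1) : L2 := a • D u + ι (lowerη a u η)

/-- Continuous curves in `H¹ × H¹` that solve the `abcd` system, as an evolution equation
in `L² × L²`. -/
structure IsL2Solution (a c : ℝ) (u η : ℝ → H1) : Prop where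
  cu : Continuous u
  cη : Continuous η
  du : ∀ t, HasDerivAt (fun s => ι (u s)) (velU c (u t) (η t)) t
  dη : ∀ t, HasDerivAt (fun s => ι (η s)) (velη a (u t) (η t)) t

theorem continuous_lowerU (c : ℝ) {u η : ℝ → H1} (hu : Continuous u) (hη : Continuous η) :
    Continuous fun t => lowerU c (u t) (η t) := by
  have := continuous_prodL2 hu hu
  unfold lowerU
  fun_prop

theorem continuous_lowerη (a : ℝ) {u η : ℝ → H1} (hu : Continuous u) (hη : Continuous η) :
    Continuous fun t => lowerη a (u t) (η t) := by
  have := continuous_prodL2 hu hη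
  unfold lowerη
  fun_prop

theorem continuous_velU (c : ℝ) {u η : ℝ → H1} (hu : Continuous u) (hη : Continuous η) :
    Continuous fun t => velU c (u t) (η t) := by
  have := continuous_lowerU c hu hη
  unfold velU
  fun_prop

theorem continuous_velη (a : ℝ) {u η : ℝ → H1} (hu : Continuous u) (hη : Continuous η) :
    Continuous fun t => velη a (u t) (η t) := by
  have := continuous_lowerη a hu hη
  unfold velη
  fun_prop

theorem inner_D_test (u : H1) {φ : ℝ → ℝ} (hφ : IsTest φ) :
    inner ℝ (D u) hφ.toL2 = -inner ℝ (ι u) hφ.isTest_deriv.toL2 := by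
  linarith [(isWeakDeriv_iff_inner _ _).1 u.isWeakDeriv φ hφ]

theorem inner_K_test (v : L2) {φ : ℝ → ℝ} (hφ : IsTest φ) :
    inner ℝ (ι (K v)) (hφ.toL2 - hφ.isTest_deriv.isTest_deriv.toL2) =
      -inner ℝ v hφ.isTest_deriv.toL2 := by
  have h1 := inner_D_test (G v) hφ
  have h2 := inner_D_test (K v) hφ.isTest_deriv
  rw [D_G] at h1
  rw [D_K, inner_sub_left] at h2
  rw [inner_sub_right]
  linarith

/-- Testing against `φ - φ''` undoes the inverse hidden in `K`. The choice of coefficients reflects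
`k u'' = k u - k (u - u'')`, whence `-K(k u'' + u) = k u' - (1 + k) K u`. -/
theorem inner_vel_test (k : ℝ) (u : H1) (v : L2) {φ : ℝ → ℝ} (hφ : IsTest φ) :
    inner ℝ (k • D u + ι ((-(1 + k)) • K (ι u) - K v))
        (hφ.toL2 - hφ.isTest_deriv.isTest_deriv.toL2) =
      k * inner ℝ (ι u) hφ.isTest_deriv.isTest_deriv.isTest_deriv.toL2
        + inner ℝ (ι u) hφ.isTest_deriv.toL2 + inner ℝ v hφ.isTest_deriv.toL2 := by
  rw [map_sub, map_smul, inner_add_left, inner_sub_left, inner_smul_left, inner_smul_left,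
    inner_K_test, inner_K_test, inner_sub_right, inner_D_test, inner_D_test]
  simp only [conj_trivial]
  ring

theorem inner_test_sub_eq_integral (f : L2) {φ : ℝ → ℝ} (hφ : IsTest φ) :
    inner ℝ f (hφ.toL2 - hφ.isTest_deriv.isTest_deriv.toL2) =
      ∫ x, f x * (φ x - iteratedDeriv 2 φ x) := by
  have e2 : iteratedDeriv 2 φ = deriv (deriv φ) := by
    rw [iteratedDeriv_succ, iteratedDeriv_one]
  rw [inner_sub_right, hφ.inner_toL2, IsTest.inner_toL2, e2, ← integral_sub (hφ.integrable_mul f)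
    (hφ.isTest_deriv.isTest_deriv.integrable_mul f)]
  refine integral_congr_ae (ae_of_all _ fun x => ?_)
  ring

theorem integral_eq_inner_test (k : ℝ) (f g : L2) {φ h : ℝ → ℝ} (hφ : IsTest φ)
    (hg : g =ᵐ[volume] h) :
    ∫ x, (k * f x * iteratedDeriv 3 φ x + (f x + h x) * deriv φ x) =
      k * inner ℝ f hφ.isTest_deriv.isTest_deriv.isTest_deriv.toL2
        + inner ℝ f hφ.isTest_deriv.toL2 + inner ℝ g hφ.isTest_deriv.toL2 := by
  have e3 : iteratedDeriv 3 φ = deriv (deriv (deriv φ)) := by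
    rw [iteratedDeriv_succ, iteratedDeriv_succ, iteratedDeriv_one]
  have i1 := (hφ.isTest_deriv.isTest_deriv.isTest_deriv.integrable_mul f).const_mul k
  have i2 := hφ.isTest_deriv.integrable_mul f
  have i3 := hφ.isTest_deriv.integrable_mul g
  have i12 : Integrable (fun x => k * (f x * deriv (deriv (deriv φ)) x) + f x * deriv φ x)
    volume := i1.add i2
  rw [IsTest.inner_toL2, IsTest.inner_toL2, IsTest.inner_toL2, ← integral_const_mul,
    ← integral_add i1 i2, ← integral_add i12 i3, e3]
  refine integral_congr_ae ?_
  filter_upwards [hg] with x hx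
  rw [hx]; ring

/-- The distributional equations identify the pairings with `φ - φ''`; these functions span a dense
subspace and the candidate velocities are continuous in `L²`, so the weak derivatives are strong
ones. -/
theorem IsGlobalSolution.isL2Solution {a c : ℝ} {u η : ℝ → H1} (h : IsGlobalSolution a c u η) :
    IsL2Solution a c u η where
  cu := h.continuous_u
  cη := h.continuous_η
  du := hasDerivAt_of_forall_test (continuous_velU c h.continuous_u h.continuous_η)
    fun φ hφ t => by
      have h1 := h.eq_u φ hφ t
      have e : velU c (u t) (η t) = c • D (η t) +
          ι ((-(1 + c)) • K (ι (η t)) - K ((1 / 2 : ℝ) • prodL2 (u t) (u t))) := by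
        rw [map_smul]; rfl
      have e2 : ((1 / 2 : ℝ) • prodL2 (u t) (u t) : L2) =ᵐ[volume]
          fun x => 1 / 2 * (u t).fn x ^ 2 := by
        filter_upwards [Lp.coeFn_smul (1 / 2 : ℝ) (prodL2 (u t) (u t)),
          coeFn_prodL2 (u t) (u t)] with x h1 h2
        rw [h1, Pi.smul_apply, h2, smul_eq_mul, sq]
      rw [e, inner_vel_test]
      simp only [inner_test_sub_eq_integral]
      exact h1.congr_deriv (integral_eq_inner_test c (ι (η t)) _ hφ e2)
  dη := hasDerivAt_of_forall_test (continuous_velη a h.continuous_u h.continuous_η)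
    fun φ hφ t => by
      have h1 := h.eq_η φ hφ t
      rw [velη, lowerη, inner_vel_test]
      simp only [inner_test_sub_eq_integral]
      exact h1.congr_deriv (integral_eq_inner_test a (ι (u t)) _ hφ (coeFn_prodL2 (u t) (η t)))

/-! ### Localized momentum and energy identities. -/

/-- The time derivative of the momentum `∫ ψ (u η + ∂ₓu ∂ₓη)`, where `w = ψ'`. -/
noncomputable def momentumRate (a c : ℝ) (w : ℝ →ᵇ ℝ) (u η : H1) : ℝ :=
  (-(a / 2) * T w (D u) (D u) - (1 / 2 + a) * T w (ι u) (ι u)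
      + (1 + a) * T w (ι u) (ι (G (ι u))))
    + (-(c / 2) * T w (D η) (D η) - (1 / 2 + c) * T w (ι η) (ι η)
      + (1 + c) * T w (ι η) (ι (G (ι η))))
    + (T w (ι u) (ι (G (prodL2 u η))) + 1 / 2 * T w (ι η) (ι (G (prodL2 u u)))
      - 1 / 2 * T w (ι u) (prodL2 u η))

/-- Every contribution is a total derivative once `K` is read as `D ∘ G`, so only terms weighted by
`w` survive. `i5` and `i6` treat the nonlocal cubic terms, and `i7`, applied to `u² η`, the local
one. -/
theorem momentum_identity (a c : ℝ) {ψ w : ℝ →ᵇ ℝ} (hψ : IsDer ψ w) (u η : H1) :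
    T ψ (velU c u η) (ι η) + T ψ (ι u) (velη a u η)
      + (-(1 / 2) * (c * T w (D η) (D η) + a * T w (D u) (D u))
        + T ψ (D (lowerU c u η)) (D η) + T ψ (D u) (D (lowerη a u η))) =
      momentumRate a c w u η := by
  have i1 := T_self_D hψ u
  have i2 := T_self_D hψ η
  have i3 := T_by_parts hψ (G (ι u)) u
  have i4 := T_by_parts hψ (G (ι η)) η
  have i5 := T_by_parts hψ (G (prodL2 u η)) u
  have i6 := T_by_parts hψ (G (prodL2 u u)) η
  have i7 := T_by_parts hψ (mulH u u) η
  have e1 : T ψ (M (rep u) (D u)) (ι η) = T ψ (D u) (prodL2 u η) := T_M_swap _ _ _ _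
  have e2 : T w (prodL2 u u) (ι η) = T w (ι u) (prodL2 u η) := T_M_swap _ _ _ _
  rw [D_G] at i3 i4 i5 i6
  have e3 : ι (mulH u u) = prodL2 u u := rfl
  rw [D_mulH, T_add_left, e1, e3, e2] at i7
  simp only [velU, velη, lowerU, lowerη, momentumRate, map_sub, map_smul, D_K,
    T_add_left, T_add_right, T_sub_left, T_sub_right, T_smul_left, T_smul_right]
  linear_combination (-(1 + a)) * (i3 - T_comm w (ι (G (ι u))) (ι u)
      + T_comm ψ (ι u) (ι (K (ι u))) + T_comm ψ (D u) (ι (G (ι u))) - T_comm ψ (D u) (ι u) - i1)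
    + a * i1
    - (1 + c) * (i4 - T_comm w (ι (G (ι η))) (ι η) - i2) + c * (T_comm ψ (D η) (ι η) + i2)
    - (i5 - T_comm w (ι (G (prodL2 u η))) (ι u) + T_comm ψ (ι u) (ι (K (prodL2 u η)))
      + T_comm ψ (D u) (ι (G (prodL2 u η))))
    - 1 / 2 * (i6 - T_comm w (ι (G (prodL2 u u))) (ι η)) + 1 / 2 * i7

theorem IsL2Solution.hasDerivAt_momentum {a c : ℝ} {u η : ℝ → H1} (h : IsL2Solution a c u η)
    {ψ w : ℝ →ᵇ ℝ} (hψ : IsDer ψ w) (t : ℝ) :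
    HasDerivAt (fun s => T ψ (ι (u s)) (ι (η s)) + T ψ (D (u s)) (D (η s)))
      (momentumRate a c w (u t) (η t)) t := by
  have h1 := (hasDerivAt_const t ψ).T (h.du t) (h.dη t)
  have h2 := hasDerivAt_T_D_D hψ 1 0 a c h.cu h.cη (continuous_lowerU c h.cu h.cη)
    (continuous_lowerη a h.cu h.cη) h.du h.dη t
  rw [← momentum_identity a c hψ]
  refine ((h1.add h2).congr_deriv ?_).congr_of_eventuallyEq (Eventually.of_forall fun s => ?_)
  · simp only [T_zero_weight]; ring
  · simp only [Pi.add_apply]; ring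

/-- The potential whose derivative is `-∂ₜu`. -/
noncomputable def potU (c : ℝ) (u η : H1) : H1 :=
  (1 + c) • G (ι η) - c • η + (1 / 2 : ℝ) • G (prodL2 u u)

/-- The potential whose derivative is `-∂ₜη`. -/
noncomputable def potη (a : ℝ) (u η : H1) : H1 :=
  (1 + a) • G (ι u) - a • u + G (prodL2 u η)

theorem D_potU (c : ℝ) (u η : H1) : D (potU c u η) = -velU c u η := by
  simp only [potU, velU, lowerU, map_add, map_sub, map_smul, D_G]
  module

theorem D_potη (a : ℝ) (u η : H1) : D (potη a u η) = -velη a u η := by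
  simp only [potη, velη, lowerη, map_add, map_sub, map_smul, D_G]
  module

theorem potU_add_D_lowerU (c : ℝ) (u η : H1) :
    ι η + (1 / 2 : ℝ) • prodL2 u u = ι (potU c u η) + D (lowerU c u η) := by
  simp only [potU, lowerU, map_add, map_sub, map_smul, D_K]
  module

theorem potη_add_D_lowerη (a : ℝ) (u η : H1) :
    ι u + prodL2 u η = ι (potη a u η) + D (lowerη a u η) := by
  simp only [potη, lowerη, map_add, map_sub, map_smul, D_K]
  module

/-- The localized energy. -/
noncomputable def energy (a c : ℝ) (θ : ℝ →ᵇ ℝ) (u η : H1) : ℝ :=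
  1 / 2 * (-(a * T θ (D u) (D u) + c * T θ (D η) (D η)) + T θ (ι u) (ι u) + T θ (ι η) (ι η)
    + T θ (prodL2 u η) (ι u))

/-- The flux of energy. -/
noncomputable def energyFlux (a c : ℝ) (θ' : ℝ →ᵇ ℝ) (u η : H1) : ℝ :=
  a * c * T θ' (D u) (D η) - T θ' (ι (lowerU c u η)) (ι (lowerη a u η))
    + T θ' (ι (potη a u η)) (ι (potU c u η))

/-- By `potU_add_D_lowerU` and `potη_add_D_lowerη`, the zero-order variations of the energy split
into a potential and the derivative of a lower-order term. The velocities being minus the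
derivatives of the potentials, the potentials combine into one total derivative (`i2`) and the
lower-order terms into another (`i1`). -/
theorem energy_identity (a c : ℝ) {θ θ' : ℝ →ᵇ ℝ} (hθ : IsDer θ θ') (u η : H1) :
    -(-(a * c) * T θ' (D u) (D η) + a * T θ (D u) (D (lowerU c u η))
        + c * T θ (D η) (D (lowerη a u η)))
      + T θ (velU c u η) (ι u + prodL2 u η) + T θ (velη a u η) (ι η + (1 / 2 : ℝ) • prodL2 u u) =
      energyFlux a c θ' u η := by
  have i1 := T_by_parts hθ (lowerU c u η) (lowerη a u η)
  have i2 := T_by_parts hθ (potη a u η) (potU c u η)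
  rw [D_potU, D_potη, T_neg_left, T_neg_right] at i2
  rw [potU_add_D_lowerU c, potη_add_D_lowerη a, T_add_right, T_add_right, energyFlux]
  have e1 : T θ (velU c u η) (D (lowerη a u η)) =
      c * T θ (D η) (D (lowerη a u η)) + T θ (ι (lowerU c u η)) (D (lowerη a u η)) := by
    rw [velU, T_add_left, T_smul_left]
  have e2 : T θ (velη a u η) (D (lowerU c u η)) =
      a * T θ (D u) (D (lowerU c u η)) + T θ (D (lowerU c u η)) (ι (lowerη a u η)) := by
    rw [velη, T_add_left, T_smul_left, T_comm θ (ι _) (D _)]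
  rw [e1, e2]
  linear_combination i1 - i2 + T_comm θ (velU c u η) (ι (potη a u η))

theorem IsL2Solution.hasDerivAt_energy {a c : ℝ} {u η : ℝ → H1} (h : IsL2Solution a c u η)
    {θ θ' : ℝ →ᵇ ℝ} (hθ : IsDer θ θ') (t : ℝ) :
    HasDerivAt (fun s => energy a c θ (u s) (η s)) (energyFlux a c θ' (u t) (η t)) t := by
  have h0 := hasDerivAt_const t θ
  have h1 := h0.T (h.du t) (h.du t)
  have h2 := h0.T (h.dη t) (h.dη t)
  have h3 := h0.T (hasDerivAt_M_rep h.cu.continuousAt (h.du t) (h.dη t)) (h.du t)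
  have h4 := hasDerivAt_T_D_D hθ 0 (-1) a c h.cu h.cη (continuous_lowerU c h.cu h.cη)
    (continuous_lowerη a h.cu h.cη) h.du h.dη t
  rw [← energy_identity a c hθ]
  refine ((h4.add (((h1.add h2).add h3).const_mul (1 / 2))).congr_deriv ?_).congr_of_eventuallyEq
    (Eventually.of_forall fun s => ?_)
  · have e1 : T θ (M (rep (u t)) (velη a (u t) (η t))) (ι (u t)) =
        T θ (velη a (u t) (η t)) (prodL2 (u t) (u t)) := T_M_swap _ _ _ _
    have e2 : T θ (M (rep (η t)) (velU c (u t) (η t))) (ι (u t)) =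
        T θ (velU c (u t) (η t)) (prodL2 (u t) (η t)) := by
      rw [prodL2_comm]; exact T_M_swap _ _ _ _
    have e3 : M (rep (u t)) (ι (η t)) = prodL2 (u t) (η t) := rfl
    simp only [T_zero_weight, T_add_left, T_add_right, T_smul_right, e1, e2, e3]
    rw [T_comm θ (prodL2 _ _) (velU _ _ _), T_comm θ (ι (u t)) (velU _ _ _),
      T_comm θ (ι (η t)) (velη _ _ _)]
    ring
  · simp only [Pi.add_apply, energy, prodL2]; ring

/-! ### Choice of the multiplier and coercivity of the quadratic form. -/

/-- Here `z` stands for `1 + β`. If `z < 3A` then `s = 0` works; otherwise `A < 2/3` and the claim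
reduces to `z - 3A < 2 √(A (2 - z))`, `s` being chosen strictly between `(z - 3A)/2` and the square
root. -/
theorem exists_completing_square_aux {A z : ℝ} (hA : 0 < A) (hz : z < 2)
    (h : z * (1 + A) < 5 * A) : ∃ s, 0 ≤ s ∧ s ^ 2 < A * (2 - z) ∧ z - 3 * A < 2 * s := by
  have hp : 0 < A * (2 - z) := mul_pos hA (by linarith)
  rcases lt_or_ge z (3 * A) with h1 | h1
  · exact ⟨0, le_rfl, by simpa using hp, by linarith⟩
  have hA2 : A < 2 / 3 := by
    have : 3 * A * (1 + A) < 5 * A := (mul_le_mul_of_nonneg_right h1 (by linarith)).trans_lt h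
    by_contra hcon
    push Not at hcon
    nlinarith
  have key : (z - 3 * A) ^ 2 < 4 * (A * (2 - z)) := by
    set Z := z * (1 + A) with hZ
    have h2 : 9 * A ^ 3 + 8 * A - 8 < 0 := by nlinarith [sq_nonneg A, mul_pos hA hA]
    have h3 : 0 < (5 * A - Z) * (5 * A + Z - 2 * A * (1 + A)) := by
      refine mul_pos (by linarith) ?_
      have : 3 * A * (1 + A) ≤ Z := mul_le_mul_of_nonneg_right h1 (by linarith)
      nlinarith
    have h4 : A * (9 * A ^ 3 + 8 * A - 8) < 0 := mul_neg_of_pos_of_neg hA h2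
    -- The quadratic polynomial in `Z = z (1 + A)` is expanded about `Z = 5A`, where its value is `A
    -- (9A³ + 8A - 8)`, negative for `A < 2/3`.
    have h5 : ((z - 3 * A) ^ 2 - 4 * (A * (2 - z))) * (1 + A) ^ 2 < 0 := by
      have : ((z - 3 * A) ^ 2 - 4 * (A * (2 - z))) * (1 + A) ^ 2 =
          A * (9 * A ^ 3 + 8 * A - 8) - (5 * A - Z) * (5 * A + Z - 2 * A * (1 + A)) := by
        rw [hZ]; ring
      linarith
    have h6 : 0 < (1 + A) ^ 2 := by positivity
    by_contra hcon
    push Not at hcon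
    have := mul_nonneg (sub_nonneg.2 hcon) h6.le
    linarith
  set y := √(A * (2 - z)) with hy
  have hy0 : 0 < y := Real.sqrt_pos.2 hp
  have hy2 : y ^ 2 = A * (2 - z) := Real.sq_sqrt hp.le
  have h7 : (z - 3 * A) / 2 < y := by
    refine lt_of_pow_lt_pow_left₀ 2 hy0.le ?_
    rw [hy2, div_pow]; linarith
  refine ⟨((z - 3 * A) / 2 + y) / 2, by linarith, ?_, by linarith⟩
  rw [← hy2]
  exact pow_lt_pow_left₀ (by linarith) (by linarith) two_ne_zero

/-- The algebraic content of the condition on the parameters. -/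
theorem exists_multiplier {A C : ℝ} (hA : 0 < A) (hC : 0 < C) (h : 2 < 3 * (A + C) + 8 * (A * C)) :
    ∃ β, |β| < 1 ∧ (∃ s, 0 ≤ s ∧ s ^ 2 < A * (1 - β) ∧ 1 + β - 3 * A < 2 * s) ∧
      ∃ s, 0 ≤ s ∧ s ^ 2 < C * (1 + β) ∧ 1 - β - 3 * C < 2 * s := by
  -- The conditions on `z = 1 + β` are `z < 5A/(1+A)`, `2 - z < 5C/(1+C)` and `0 < z < 2`. The first
  -- two are compatible exactly when `5A/(1+A) + 5C/(1+C) > 2`, that is, `3(A + C) + 8AC > 2`.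
  have h1 : max 0 (2 - 5 * C / (1 + C)) < min 2 (5 * A / (1 + A)) := by
    have hA' : 0 < 5 * A / (1 + A) := by positivity
    have hC' : 0 < 5 * C / (1 + C) := by positivity
    refine max_lt (lt_min two_pos hA') (lt_min (by linarith) ?_)
    have : 0 < 5 * A / (1 + A) + 5 * C / (1 + C) - 2 := by
      have e : 5 * A / (1 + A) + 5 * C / (1 + C) - 2 =
          (3 * (A + C) + 8 * (A * C) - 2) / ((1 + A) * (1 + C)) := by
        field_simp; ring
      rw [e]
      exact div_pos (by linarith) (by positivity)
    linarith
  obtain ⟨z, hz1, hz2⟩ := exists_between h1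
  rw [max_lt_iff] at hz1
  rw [lt_min_iff] at hz2
  have e1 : z * (1 + A) < 5 * A := (lt_div_iff₀ (by linarith)).1 hz2.2
  have e2 : (2 - z) * (1 + C) < 5 * C := (lt_div_iff₀ (by linarith)).1 (by linarith)
  obtain ⟨s, hs0, hs1, hs2⟩ := exists_completing_square_aux hA hz2.1 e1
  obtain ⟨r, hr0, hr1, hr2⟩ := exists_completing_square_aux hC (z := 2 - z) (by linarith) e2
  refine ⟨z - 1, ?_, ⟨s, hs0, ?_, by linarith⟩, r, hr0, ?_, by linarith⟩
  · rw [abs_lt]; constructor <;> linarith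
  · convert hs1 using 2; ring
  · convert hr1 using 2; ring

/-- `w` is a nonnegative weight that varies at the scale `κ⁻¹`, with derivative `w'`. -/
structure IsSlow (κ : ℝ) (w w' : ℝ →ᵇ ℝ) : Prop where
  nonneg : ∀ x, 0 ≤ w x
  isDer : IsDer w w'
  le : ∀ x, |w' x| ≤ κ * w x

theorem IsSlow.mono {κ κ' : ℝ} {w w' : ℝ →ᵇ ℝ} (h : IsSlow κ w w') (hκ : κ ≤ κ') :
    IsSlow κ' w w' :=
  ⟨h.nonneg, h.isDer, fun x => (h.le x).trans (mul_le_mul_of_nonneg_right hκ (h.nonneg x))⟩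

theorem IsSlow.abs_T_le {κ : ℝ} {w w' : ℝ →ᵇ ℝ} (h : IsSlow κ w w') (f g : L2) :
    |T w' f g| ≤ κ / 2 * (T w f f + T w g g) := by
  have := Abcd.abs_T_le (ψ := w') (w := κ • w) (fun x => by simpa using h.le x) f g
  rw [T_smul_weight, T_smul_weight] at this
  linarith

theorem T_add_self_le {w : ℝ →ᵇ ℝ} (hw : ∀ x, 0 ≤ w x) (f g : L2) :
    T w (f + g) (f + g) ≤ 2 * T w f f + 2 * T w g g := by
  have := T_nonneg hw (f - g)
  simp only [T_add_left, T_add_right, T_sub_left, T_sub_right] at this ⊢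
  linarith

theorem T_sub_self_le {w : ℝ →ᵇ ℝ} (hw : ∀ x, 0 ≤ w x) (f g : L2) :
    T w (f - g) (f - g) ≤ 2 * T w f f + 2 * T w g g := by
  have := T_nonneg hw (f + g)
  simp only [T_add_left, T_add_right, T_sub_left, T_sub_right] at this ⊢
  linarith

theorem T_smul_self (w : ℝ →ᵇ ℝ) (r : ℝ) (f : L2) : T w (r • f) (r • f) = r ^ 2 * T w f f := by
  rw [T_smul_left, T_smul_right]; ring

theorem abs_T_le_mul {w : ℝ →ᵇ ℝ} (hw : ∀ x, 0 ≤ w x) {f g : L2} {k X : ℝ} (hk : 0 < k)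
    (hf : T w f f ≤ X) (hg : T w g g ≤ k ^ 2 * X) : |T w f g| ≤ k * X := by
  have h := Abcd.abs_T_le (ψ := w) (w := w) (fun x => (abs_of_nonneg (hw x)).le) f (k⁻¹ • g)
  rw [T_smul_self, T_smul_right, abs_mul, abs_of_pos (inv_pos.2 hk)] at h
  have h1 : k⁻¹ ^ 2 * T w g g ≤ X := by
    rw [inv_pow, inv_mul_le_iff₀ (by positivity)]; exact hg
  have h2 : k⁻¹ * |T w f g| ≤ X := by linarith
  rwa [inv_mul_le_iff₀ hk] at h2

/-- The equation `g - g'' = v` is tested against `w g`. The commutator term in `w'` costs at most a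
quarter of the left side since `κ ≤ 1/2`, and Young's inequality handles `w g v`. -/
theorem IsSlow.T_G_add_T_K_le {κ : ℝ} {w w' : ℝ →ᵇ ℝ} (h : IsSlow κ w w') (hκ : κ ≤ 1 / 2) (v : L2) :
    T w (ι (G v)) (ι (G v)) + T w (ι (K v)) (ι (K v)) ≤ 2 * T w v v := by
  have i := T_by_parts h.isDer (G v) (K v)
  rw [D_G, D_K, T_sub_right] at i
  have h1 := (abs_le.1 (h.abs_T_le (ι (G v)) (ι (K v)))).1
  have h2 := (abs_le.1 (Abcd.abs_T_le (ψ := w) (w := w) (fun x => (abs_of_nonneg (h.nonneg x)).le)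
    (ι (G v)) v)).2
  have h3 := T_nonneg h.nonneg (ι (G v))
  have h4 := T_nonneg h.nonneg (ι (K v))
  nlinarith

theorem IsSlow.T_G_le {κ : ℝ} {w w' : ℝ →ᵇ ℝ} (h : IsSlow κ w w') (hκ : κ ≤ 1 / 2) (v : L2) :
    T w (ι (G v)) (ι (G v)) ≤ 2 * T w v v := by
  linarith [h.T_G_add_T_K_le hκ v, T_nonneg h.nonneg (ι (K v))]

theorem IsSlow.T_K_le {κ : ℝ} {w w' : ℝ →ᵇ ℝ} (h : IsSlow κ w w') (hκ : κ ≤ 1 / 2) (v : L2) :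
    T w (ι (K v)) (ι (K v)) ≤ 2 * T w v v := by
  linarith [h.T_G_add_T_K_le hκ v, T_nonneg h.nonneg (ι (G v))]

/-- The quadratic part of the virial rate in one of the two unknowns. -/
noncomputable def virialForm (A β : ℝ) (w : ℝ →ᵇ ℝ) (u : H1) : ℝ :=
  A / 2 * T w (D u) (D u) + (A - 1 / 2) * T w (ι u) (ι u) + (1 - A) * T w (ι u) (ι (G (ι u)))
    - β / 2 * (A * T w (D u) (D u) + (1 - A) * T w (D u) (ι (K (ι u))))

/-- Coercivity of the virial form. -/
theorem exists_virialForm_ge {A β s : ℝ} (hA : 0 < A) (hβ : |β| < 1) (hs0 : 0 ≤ s)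
    (hs1 : s ^ 2 < A * (1 - β)) (hs2 : 1 + β - 3 * A < 2 * s) :
    ∃ δ κ, 0 < δ ∧ 0 < κ ∧ ∀ w w', IsSlow κ w w' → ∀ u : H1,
      δ * (T w (ι u) (ι u) + T w (D u) (D u)) ≤ virialForm A β w u := by
  obtain ⟨hβ1, hβ2⟩ := abs_lt.1 hβ
  set n := A * (1 - β) with hn
  have hn0 : 0 < n := mul_pos hA (by linarith)
  set δ := (n - s ^ 2) / (2 * (1 + n)) with hδ
  have hδ0 : 0 < δ := div_pos (by linarith) (by linarith)
  have hδe : δ * (1 + n) = (n - s ^ 2) / 2 := by rw [hδ]; field_simp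
  have hδ1 : δ < 1 := by
    by_contra hcon
    push Not at hcon
    nlinarith [sq_nonneg s]
  have hδ2 : s ^ 2 ≤ (1 - δ) * (n - δ) := by nlinarith [sq_nonneg δ]
  set C := 4 * A + 2 + 2 * s with hC
  have hC0 : 0 < C := by linarith
  refine ⟨δ / 8, δ / (2 * C), by positivity, by positivity, fun w w' hw u => ?_⟩
  set κ := δ / (2 * C) with hκ
  have hκ0 : 0 < κ := by positivity
  have hκC : C * κ = δ / 2 := by rw [hκ]; field_simp
  -- With `F = G u`, the functions `F0` to `F3` are `F` and its first three derivatives, so that `u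
  -- = F - F''` and `∂ₓu = F' - F'''`.
  set F0 : L2 := ι (G (ι u)) with hF0
  set F1 : L2 := ι (K (ι u)) with hF1
  set F2 : L2 := F0 - ι u with hF2
  set F3 : L2 := F1 - D u with hF3
  have eu : ι u = F0 - F2 := by rw [hF2]; abel
  have eD : D u = F1 - F3 := by rw [hF3]; abel
  have i1 : T w' F0 F1 + T w F1 F1 + T w F0 F2 = 0 := by
    have := T_by_parts hw.isDer (G (ι u)) (K (ι u))
    rwa [D_G, D_K] at this
  have i2 : T w' F1 F2 + T w F2 F2 + T w F1 F3 = 0 := by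
    have := T_by_parts hw.isDer (K (ι u)) (G (ι u) - u)
    rwa [D_K, map_sub, map_sub, D_G] at this
  have b1 := abs_le.1 (hw.abs_T_le F0 F1)
  have b2 := abs_le.1 (hw.abs_T_le F1 F2)
  -- `δ` was chosen so that `s² ≤ (1 - δ)(n - δ)`: the form with coefficients `1`, `2s`, `n` stays
  -- nonnegative after subtracting `δ` from both squares.
  have sq : ∀ f g : L2, 0 ≤ (1 - δ) * T w f f + 2 * s * T w f g + (n - δ) * T w g g := by
    intro f g
    have h0 := T_nonneg hw.nonneg ((1 - δ) • f + s • g)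
    simp only [T_add_left, T_add_right, T_smul_left, T_smul_right, T_comm w g f] at h0
    have hg := T_nonneg hw.nonneg g
    have h1 : 0 ≤ (1 - δ) * ((1 - δ) * T w f f + 2 * s * T w f g + (n - δ) * T w g g) := by
      nlinarith [mul_le_mul_of_nonneg_right hδ2 hg]
    exact nonneg_of_mul_nonneg_right h1 (by linarith)
  have q1 := sq F0 F2
  have q2 := sq F1 F3
  have n0 := T_nonneg hw.nonneg F0
  have n1 := T_nonneg hw.nonneg F1
  have n2 := T_nonneg hw.nonneg F2
  have n3 := T_nonneg hw.nonneg F3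
  have hsum : T w (ι u) (ι u) + T w (D u) (D u) ≤
      2 * (T w F0 F0 + T w F1 F1 + T w F2 F2 + T w F3 F3) := by
    rw [eu, eD]
    linarith [T_sub_self_le hw.nonneg F0 F2, T_sub_self_le hw.nonneg F1 F3]
  have key : δ * (T w F0 F0 + T w F1 F1 + T w F2 F2 + T w F3 F3) ≤ 4 * virialForm A β w u := by
    -- Up to terms in `w'`, `i1` and `i2` exchange the products `F F''` and `F' F'''` for `-F'²` and
    -- `-F''²`. The coefficient `3A - 1 - β` may be negative; adding `2s` times these identities
    -- makes it `2s + 3A - 1 - β > 0`, at the price of the cross terms that `sq` absorbs.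
    have e : 2 * virialForm A β w u =
        (T w F0 F0 + (3 * A - 1 - β) * T w F1 F1 + n * T w F2 F2)
        + (T w F1 F1 + (3 * A - 1 - β) * T w F2 F2 + n * T w F3 F3)
        + 2 * A * T w' F0 F1 + (2 * A - 2 * β * A - β * (1 - A)) * T w' F1 F2 := by
      rw [virialForm, ← hF0, ← hF1, eu, eD]
      simp only [T_sub_left, T_sub_right, T_comm w F2 F0, T_comm w F3 F1]
      rw [hn]
      linear_combination (-(2 * A)) * i1 - (2 * A - 2 * β * A - β * (1 - A)) * i2
    have c1 : |(2 * A + 2 * s) * T w' F0 F1| ≤ C * (κ / 2 * (T w F0 F0 + T w F1 F1)) := by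
      rw [abs_mul]
      refine mul_le_mul ?_ (hw.abs_T_le F0 F1) (abs_nonneg _) hC0.le
      rw [abs_le]; constructor <;> linarith
    have c2 : |(2 * A - 2 * β * A - β * (1 - A) + 2 * s) * T w' F1 F2| ≤
        C * (κ / 2 * (T w F1 F1 + T w F2 F2)) := by
      rw [abs_mul]
      refine mul_le_mul ?_ (hw.abs_T_le F1 F2) (abs_nonneg _) hC0.le
      have := mul_lt_mul_of_pos_right hβ1 hA
      have := mul_lt_mul_of_pos_right hβ2 hA
      rw [abs_le]; constructor <;> linarith
    have c1' := (abs_le.1 c1).1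
    have c2' := (abs_le.1 c2).1
    rw [← mul_assoc, show C * (κ / 2) = δ / 4 by linarith] at c1' c2'
    have m1 : 0 ≤ (2 * s + 3 * A - 1 - β) * T w F1 F1 := mul_nonneg (by linarith) n1
    have m2 : 0 ≤ (2 * s + 3 * A - 1 - β) * T w F2 F2 := mul_nonneg (by linarith) n2
    have d0 := mul_nonneg hδ0.le n0
    have d1 := mul_nonneg hδ0.le n1
    have d2 := mul_nonneg hδ0.le n2
    have d3 := mul_nonneg hδ0.le n3
    have i1' : T w F0 F2 = -T w F1 F1 - T w' F0 F1 := by linarith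
    have i2' : T w F1 F3 = -T w F2 F2 - T w' F1 F2 := by linarith
    rw [i1'] at q1
    rw [i2'] at q2
    linarith
  have := mul_le_mul_of_nonneg_left hsum hδ0.le
  linarith

/-! ### Bounds by the local energy norm. -/

/-- The local energy norm, with a weight. -/
noncomputable def E (w : ℝ →ᵇ ℝ) (u η : H1) : ℝ :=
  T w (ι u) (ι u) + T w (D u) (D u) + (T w (ι η) (ι η) + T w (D η) (D η))

theorem E_nonneg {w : ℝ →ᵇ ℝ} (hw : ∀ x, 0 ≤ w x) (u η : H1) : 0 ≤ E w u η := by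
  have := T_nonneg hw (ι u)
  have := T_nonneg hw (D u)
  have := T_nonneg hw (ι η)
  have := T_nonneg hw (D η)
  unfold E; positivity

/-- A bound for the operators of order zero of the system. -/
noncomputable def bd (k : ℝ) : ℝ := 3 * (2 * (1 + k) ^ 2 + k ^ 2 + 2)

section bounds
variable {κ : ℝ} {w w' : ℝ →ᵇ ℝ}

theorem IsSlow.T_lower_le (h : IsSlow κ w w') (hκ : κ ≤ 1 / 2) (k X : ℝ) (v : H1) (p : L2)
    (hv : T w (ι v) (ι v) ≤ X) (hp : T w p p ≤ X) :
    T w (ι ((-(1 + k)) • K (ι v) - K p)) (ι ((-(1 + k)) • K (ι v) - K p)) ≤ bd k * X := by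
  have hX : 0 ≤ X := (T_nonneg h.nonneg p).trans hp
  rw [map_sub, map_smul]
  refine (T_sub_self_le h.nonneg _ _).trans ?_
  rw [T_smul_self, bd]
  have h1 := h.T_K_le hκ (ι v)
  have h2 := h.T_K_le hκ p
  have h3 : T w (ι (K (ι v))) (ι (K (ι v))) ≤ 2 * X := by linarith
  have := mul_le_mul_of_nonneg_left h3 (sq_nonneg (-(1 + k)))
  nlinarith [mul_nonneg (sq_nonneg k) hX, mul_nonneg (sq_nonneg (1 + k)) hX]

theorem IsSlow.T_vel_le (h : IsSlow κ w w') (hκ : κ ≤ 1 / 2) (k X : ℝ) (v : H1) (p : L2)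
    (hv : T w (ι v) (ι v) ≤ X) (hDv : T w (D v) (D v) ≤ X) (hp : T w p p ≤ X) :
    T w (k • D v + ι ((-(1 + k)) • K (ι v) - K p)) (k • D v + ι ((-(1 + k)) • K (ι v) - K p)) ≤
      2 * (k ^ 2 + bd k) * X := by
  refine (T_add_self_le h.nonneg _ _).trans ?_
  have h1 := h.T_lower_le hκ k X v p hv hp
  rw [T_smul_self]
  have := mul_le_mul_of_nonneg_left hDv (sq_nonneg k)
  linarith

theorem IsSlow.T_pot_le (h : IsSlow κ w w') (hκ : κ ≤ 1 / 2) (k X : ℝ) (v : H1) (p : L2)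
    (hv : T w (ι v) (ι v) ≤ X) (hp : T w p p ≤ X) :
    T w (ι ((1 + k) • G (ι v) - k • v + G p)) (ι ((1 + k) • G (ι v) - k • v + G p)) ≤
      2 * (k ^ 2 + bd k) * X := by
  have hX : 0 ≤ X := (T_nonneg h.nonneg p).trans hp
  rw [map_add, map_sub, map_smul, map_smul]
  refine (T_add_self_le h.nonneg _ _).trans ?_
  have h0 := T_sub_self_le h.nonneg ((1 + k) • ι (G (ι v))) (k • ι v)
  rw [T_smul_self, T_smul_self] at h0
  have h1 := h.T_G_le hκ (ι v)
  have h2 := h.T_G_le hκ p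
  have h3 : T w (ι (G (ι v))) (ι (G (ι v))) ≤ 2 * X := by linarith
  have := mul_le_mul_of_nonneg_left h3 (sq_nonneg (1 + k))
  have := mul_le_mul_of_nonneg_left hv (sq_nonneg k)
  rw [bd]
  nlinarith [mul_nonneg (sq_nonneg k) hX, mul_nonneg (sq_nonneg (1 + k)) hX]

theorem T_prodL2_le (hw : ∀ x, 0 ≤ w x) {μ : ℝ} (u v : H1) (hu : ∀ x, |rep u x| ≤ μ) :
    T w (prodL2 u v) (prodL2 u v) ≤ μ ^ 2 * T w (ι v) (ι v) :=
  T_M_M_le hw _ hu _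

end bounds

theorem lowerU_eq (c : ℝ) (u η : H1) : lowerU c u η =
    (-(1 + c)) • K (ι η) - K ((1 / 2 : ℝ) • prodL2 u u) := by
  rw [map_smul]; rfl

theorem potU_eq (c : ℝ) (u η : H1) : potU c u η =
    (1 + c) • G (ι η) - c • η + G ((1 / 2 : ℝ) • prodL2 u u) := by
  rw [map_smul]; rfl

/-- The flux of energy is controlled by the local energy norm. -/
theorem abs_energyFlux_le {a c κ : ℝ} {w w' θ' : ℝ →ᵇ ℝ} (h : IsSlow κ w w') (hκ : κ ≤ 1 / 2)
    (hθ : ∀ x, |θ' x| ≤ w x) (u η : H1) (hu : ∀ x, |rep u x| ≤ 1) :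
    |energyFlux a c θ' u η| ≤
      (|a * c| + bd a + bd c + 2 * (a ^ 2 + bd a) + 2 * (c ^ 2 + bd c)) * E w u η := by
  set X := E w u η with hX
  have p1 := T_nonneg h.nonneg (ι u)
  have p2 := T_nonneg h.nonneg (D u)
  have p3 := T_nonneg h.nonneg (ι η)
  have p4 := T_nonneg h.nonneg (D η)
  have q1 : T w (ι u) (ι u) ≤ X := by rw [hX, E]; linarith
  have q2 : T w (D u) (D u) ≤ X := by rw [hX, E]; linarith
  have q3 : T w (ι η) (ι η) ≤ X := by rw [hX, E]; linarith
  have q4 : T w (D η) (D η) ≤ X := by rw [hX, E]; linarith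
  have r1 : T w (prodL2 u η) (prodL2 u η) ≤ X := by
    have := T_prodL2_le h.nonneg u η hu
    linarith
  have r2 : T w ((1 / 2 : ℝ) • prodL2 u u) ((1 / 2 : ℝ) • prodL2 u u) ≤ X := by
    have := T_prodL2_le h.nonneg u u hu
    rw [T_smul_self]
    linarith
  have s1 := h.T_lower_le hκ a X u _ q1 r1
  have s2 := h.T_lower_le hκ c X η _ q3 r2
  have s3 := h.T_pot_le hκ a X u _ q1 r1
  have s4 := h.T_pot_le hκ c X η _ q3 r2
  rw [← lowerU_eq] at s2
  rw [← potU_eq] at s4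
  have t1 := Abcd.abs_T_le hθ (D u) (D η)
  have t2 := Abcd.abs_T_le hθ (ι (lowerU c u η)) (ι (lowerη a u η))
  have t3 := Abcd.abs_T_le hθ (ι (potη a u η)) (ι (potU c u η))
  have t1' : |a * c * T θ' (D u) (D η)| ≤ |a * c| * X := by
    rw [abs_mul]
    exact mul_le_mul_of_nonneg_left (by linarith) (abs_nonneg _)
  have s1' : T w (ι (lowerη a u η)) (ι (lowerη a u η)) ≤ bd a * X := s1
  have s3' : T w (ι (potη a u η)) (ι (potη a u η)) ≤ 2 * (a ^ 2 + bd a) * X := s3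
  have hb : ∀ k, 0 ≤ bd k := fun k => by unfold bd; positivity
  have hX0 : 0 ≤ X := p1.trans q1
  have v1 := mul_nonneg (hb a) hX0
  have v2 := mul_nonneg (hb c) hX0
  have v3 := mul_nonneg (sq_nonneg a) hX0
  have v4 := mul_nonneg (sq_nonneg c) hX0
  rw [energyFlux]
  rw [abs_le] at t1' t2 t3 ⊢
  constructor <;> nlinarith

/-! ### Positivity of the virial rate. -/

/-- The time derivative, with a frozen weight, of the virial functional
`∫ ψ (u η + ∂ₓu ∂ₓη) - β / 2 ∫ w u ∂ₓη`, where `w = ψ'`. -/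
noncomputable def virialRate (a c β : ℝ) (w w' : ℝ →ᵇ ℝ) (u η : H1) : ℝ :=
  momentumRate a c w u η - β / 2 * (T w (velU c u η) (D η) - T w' (ι u) (velη a u η)
    - T w (D u) (velη a u η))

/-- The correction `u ∂ₓη` contributes to the forms in `u` and `η` with opposite signs, hence `β` in
one and `-β` in the other. What remains is cubic or carries `w'`. -/
theorem virialRate_eq (a c β : ℝ) (w w' : ℝ →ᵇ ℝ) (u η : H1) :
    virialRate a c β w w' u η =
      virialForm (-a) β w u + virialForm (-c) (-β) w η
      + (T w (ι u) (ι (G (prodL2 u η))) + 1 / 2 * T w (ι η) (ι (G (prodL2 u u)))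
        - 1 / 2 * T w (ι u) (prodL2 u η)
        + β / 4 * T w (D η) (ι (K (prodL2 u u))) - β / 2 * T w (D u) (ι (K (prodL2 u η)))
        + β / 2 * T w' (ι u) (velη a u η)) := by
  have e1 : T w (velU c u η) (D η) = c * T w (D η) (D η) - (1 + c) * T w (D η) (ι (K (ι η)))
      - 1 / 2 * T w (D η) (ι (K (prodL2 u u))) := by
    rw [T_comm, velU, lowerU]
    simp only [map_sub, map_smul, T_add_right, T_sub_right, T_smul_right]
    ring
  have e2 : T w (D u) (velη a u η) = a * T w (D u) (D u) - (1 + a) * T w (D u) (ι (K (ι u)))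
      - T w (D u) (ι (K (prodL2 u η))) := by
    rw [velη, lowerη]
    simp only [map_sub, map_smul, T_add_right, T_sub_right, T_smul_right]
    ring
  rw [virialRate, e1, e2, momentumRate, virialForm, virialForm]
  ring

/-- The nonlinear terms and the error terms in the virial rate. -/
theorem abs_virialRemainder_le (a : ℝ) {β κ μ : ℝ} {w w' : ℝ →ᵇ ℝ} (hw : IsSlow κ w w')
    (hκ0 : 0 ≤ κ) (hκ1 : κ ≤ 1 / 2) (hμ0 : 0 < μ) (hμ1 : μ ≤ 1) (hβ : |β| < 1) (u η : H1)
    (hu : ∀ x, |rep u x| ≤ μ) :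
    |T w (ι u) (ι (G (prodL2 u η))) + 1 / 2 * T w (ι η) (ι (G (prodL2 u u)))
        - 1 / 2 * T w (ι u) (prodL2 u η)
        + β / 4 * T w (D η) (ι (K (prodL2 u u))) - β / 2 * T w (D u) (ι (K (prodL2 u η)))
        + β / 2 * T w' (ι u) (velη a u η)| ≤
      (8 * μ + κ * (1 + 2 * (a ^ 2 + bd a))) * E w u η := by
  have p1 := T_nonneg hw.nonneg (ι u)
  have p2 := T_nonneg hw.nonneg (D u)
  have p3 := T_nonneg hw.nonneg (ι η)
  have p4 := T_nonneg hw.nonneg (D η)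
  have q1 : T w (ι u) (ι u) ≤ E w u η := by rw [E]; linarith
  have q2 : T w (D u) (D u) ≤ E w u η := by rw [E]; linarith
  have q3 : T w (ι η) (ι η) ≤ E w u η := by rw [E]; linarith
  have q4 : T w (D η) (D η) ≤ E w u η := by rw [E]; linarith
  generalize E w u η = X at *
  have hX0 : 0 ≤ X := p1.trans q1
  have r1 : T w (prodL2 u η) (prodL2 u η) ≤ μ ^ 2 * X :=
    (T_prodL2_le hw.nonneg u η hu).trans (mul_le_mul_of_nonneg_left q3 (sq_nonneg _))
  have r2 : T w (prodL2 u u) (prodL2 u u) ≤ μ ^ 2 * X :=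
    (T_prodL2_le hw.nonneg u u hu).trans (mul_le_mul_of_nonneg_left q1 (sq_nonneg _))
  have hμX : 0 ≤ μ ^ 2 * X := mul_nonneg (sq_nonneg _) hX0
  have hμ2 : (2 * μ) ^ 2 * X = 4 * (μ ^ 2 * X) := by ring
  have g1 := hw.T_G_le hκ1 (prodL2 u η)
  have g2 := hw.T_G_le hκ1 (prodL2 u u)
  have g3 := hw.T_K_le hκ1 (prodL2 u η)
  have g4 := hw.T_K_le hκ1 (prodL2 u u)
  have hk : 0 < 2 * μ := by linarith
  have n1 := abs_le.1 (abs_T_le_mul hw.nonneg (g := ι (G (prodL2 u η))) hk q1 (by linarith))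
  have n2 := abs_le.1 (abs_T_le_mul hw.nonneg (g := ι (G (prodL2 u u))) hk q3 (by linarith))
  have n3 := abs_le.1 (abs_T_le_mul hw.nonneg (g := prodL2 u η) hk q1 (by linarith))
  have n4 := abs_T_le_mul hw.nonneg (g := ι (K (prodL2 u u))) hk q4 (by linarith)
  have n5 := abs_T_le_mul hw.nonneg (g := ι (K (prodL2 u η))) hk q2 (by linarith)
  have r1' : T w (prodL2 u η) (prodL2 u η) ≤ X := by
    have h1 : μ ^ 2 ≤ 1 := pow_le_one₀ hμ0.le hμ1
    have h2 := mul_le_mul_of_nonneg_right h1 hX0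
    linarith
  have hv : T w (velη a u η) (velη a u η) ≤ 2 * (a ^ 2 + bd a) * X :=
    hw.T_vel_le hκ1 a X u _ q1 q2 r1'
  have n6 : |T w' (ι u) (velη a u η)| ≤ κ / 2 * ((1 + 2 * (a ^ 2 + bd a)) * X) :=
    (hw.abs_T_le _ _).trans (mul_le_mul_of_nonneg_left (by linarith) (by linarith))
  have hb : ∀ y Y : ℝ, |y| ≤ Y → |β * y| ≤ Y := fun y Y hy => by
    rw [abs_mul]
    exact (mul_le_of_le_one_left (abs_nonneg y) hβ.le).trans hy
  have n4' := abs_le.1 (hb _ _ n4)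
  have n5' := abs_le.1 (hb _ _ n5)
  have n6' := abs_le.1 (hb _ _ n6)
  have hμX' : 0 ≤ μ * X := mul_nonneg hμ0.le hX0
  have hlast : 0 ≤ κ / 2 * ((1 + 2 * (a ^ 2 + bd a)) * X) := (abs_nonneg _).trans n6
  rw [abs_le]
  constructor <;> linarith

/-- Positivity of the virial rate for small solutions. -/
theorem exists_virialRate_ge {a c : ℝ} (ha : a < 0) (hc : c < 0)
    (h : 3 * (a + c) + 2 < 8 * a * c) :
    ∃ β δ κ μ : ℝ, 0 < δ ∧ 0 < κ ∧ κ ≤ 1 / 2 ∧ 0 < μ ∧ μ ≤ 1 ∧ |β| < 1 ∧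
      ∀ w w', IsSlow κ w w' → ∀ u η : H1, (∀ x, |rep u x| ≤ μ) →
        δ * E w u η ≤ virialRate a c β w w' u η := by
  obtain ⟨β, hβ, ⟨s, hs0, hs1, hs2⟩, r, hr0, hr1, hr2⟩ :=
    exists_multiplier (A := -a) (C := -c) (by linarith) (by linarith) (by linarith)
  obtain ⟨δ₁, κ₁, hδ₁, hκ₁, H₁⟩ := exists_virialForm_ge (A := -a) (by linarith) hβ hs0 hs1 hs2
  obtain ⟨δ₂, κ₂, hδ₂, hκ₂, H₂⟩ := exists_virialForm_ge (A := -c) (β := -β) (s := r) (by linarith)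
    (by rwa [abs_neg]) hr0 (by rwa [sub_neg_eq_add]) (by linarith)
  obtain ⟨δ, hδ0, hδ1, hδ2⟩ : ∃ δ, 0 < δ ∧ δ ≤ δ₁ ∧ δ ≤ δ₂ :=
    ⟨min δ₁ δ₂, lt_min hδ₁ hδ₂, min_le_left _ _, min_le_right _ _⟩
  have hL0 : 0 < 1 + 2 * (a ^ 2 + bd a) := by unfold bd; positivity
  -- The slow-weight errors and, with `μ ≤ δ / 32`, the cubic terms are each allowed a quarter of
  -- `δ`, which leaves `δ / 2`.
  obtain ⟨κ, hκ0, hκ1, hκ2, hκ3, hκ4⟩ : ∃ κ, 0 < κ ∧ κ ≤ κ₁ ∧ κ ≤ κ₂ ∧ κ ≤ 1 / 2 ∧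
      κ * (1 + 2 * (a ^ 2 + bd a)) ≤ δ / 4 := by
    refine ⟨min (min κ₁ κ₂) (min (1 / 2) (δ / 4 / (1 + 2 * (a ^ 2 + bd a)))),
      lt_min (lt_min hκ₁ hκ₂) (lt_min (by norm_num) (by positivity)),
      (min_le_left _ _).trans (min_le_left _ _), (min_le_left _ _).trans (min_le_right _ _),
      (min_le_right _ _).trans (min_le_left _ _), ?_⟩
    rw [← le_div_iff₀ hL0]
    exact (min_le_right _ _).trans (min_le_right _ _)
  obtain ⟨μ, hμ0, hμ1, hμ2⟩ : ∃ μ, 0 < μ ∧ μ ≤ 1 ∧ μ ≤ δ / 32 :=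
    ⟨min 1 (δ / 32), lt_min one_pos (by positivity), min_le_left _ _, min_le_right _ _⟩
  refine ⟨β, δ / 2, κ, μ, by positivity, hκ0, hκ3, hμ0, hμ1, hβ, fun w w' hw u η hu => ?_⟩
  have f1 := H₁ w w' (hw.mono hκ1) u
  have f2 := H₂ w w' (hw.mono hκ2) η
  have p1 := T_nonneg hw.nonneg (ι u)
  have p2 := T_nonneg hw.nonneg (D u)
  have p3 := T_nonneg hw.nonneg (ι η)
  have p4 := T_nonneg hw.nonneg (D η)
  have d0 := (abs_le.1 (abs_virialRemainder_le a hw hκ0.le hκ3 hμ0 hμ1 hβ u η hu)).1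
  have d1 := mul_le_mul_of_nonneg_right hδ1 (add_nonneg p1 p2)
  have d2 := mul_le_mul_of_nonneg_right hδ2 (add_nonneg p3 p4)
  have hX0 := E_nonneg hw.nonneg u η
  have d3 : (8 * μ + κ * (1 + 2 * (a ^ 2 + bd a))) * E w u η ≤ δ / 2 * E w u η :=
    mul_le_mul_of_nonneg_right (by linarith) hX0
  have d4 : δ * E w u η ≤ virialForm (-a) β w u + virialForm (-c) (-β) w η := by
    rw [E]; linarith
  rw [virialRate_eq]
  linarith

/-! ### The weights and their dependence on the scale. -/

theorem sq_add_sq_pos (l x : ℝ) : 0 < max 1 l ^ 2 + x ^ 2 := by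
  have : 0 < max 1 l := lt_max_of_lt_left one_pos
  positivity

theorem one_le_sq_add_sq (l x : ℝ) : 1 ≤ max 1 l ^ 2 + x ^ 2 := by
  have : 1 ≤ max 1 l := le_max_left _ _
  nlinarith [sq_nonneg x]

/-- The function `1 / (l² + x²)`, for `l ≥ 1`. -/
noncomputable def cauchyWeight (l : ℝ) : ℝ →ᵇ ℝ :=
  BoundedContinuousFunction.ofNormedAddCommGroup (fun x => 1 / (max 1 l ^ 2 + x ^ 2))
    (continuous_const.div (by fun_prop) fun x => (sq_add_sq_pos l x).ne') 1 fun x => by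
      rw [Real.norm_eq_abs, abs_of_pos (one_div_pos.2 (sq_add_sq_pos l x))]
      exact (div_le_one (sq_add_sq_pos l x)).2 (one_le_sq_add_sq l x)

/-- The function `x / (l² + x²)`, for `l ≥ 1`. -/
noncomputable def oddWeight (l : ℝ) : ℝ →ᵇ ℝ :=
  BoundedContinuousFunction.ofNormedAddCommGroup (fun x => x / (max 1 l ^ 2 + x ^ 2))
    (continuous_id.div (by fun_prop) fun x => (sq_add_sq_pos l x).ne') 1 fun x => by
      rw [Real.norm_eq_abs, abs_div, abs_of_pos (sq_add_sq_pos l x)]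
      refine (div_le_one (sq_add_sq_pos l x)).2 ?_
      have : 1 ≤ max 1 l := le_max_left _ _
      nlinarith [sq_nonneg (|x| - 1), sq_abs x, abs_nonneg x]

/-- The function `arctan (x / l)`. -/
noncomputable def arctanWeight (l : ℝ) : ℝ →ᵇ ℝ :=
  BoundedContinuousFunction.ofNormedAddCommGroup (fun x => Real.arctan (x / l))
    (Real.continuous_arctan.comp (by fun_prop)) 2 fun x => by
      rw [Real.norm_eq_abs, abs_le]
      have h1 := Real.arctan_lt_pi_div_two (x / l)
      have h2 := Real.neg_pi_div_two_lt_arctan (x / l)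
      have h3 := Real.pi_le_four
      constructor <;> linarith

/-- The function `l / (l² + x²)`. -/
noncomputable def bumpWeight (l : ℝ) : ℝ →ᵇ ℝ := l • cauchyWeight l

/-- The derivative of `bumpWeight l`. -/
noncomputable def bumpWeight' (l : ℝ) : ℝ →ᵇ ℝ := (-(2 * l)) • (oddWeight l * cauchyWeight l)

section weights
variable {l : ℝ}

theorem cauchyWeight_apply (hl : 1 ≤ l) (x : ℝ) : cauchyWeight l x = 1 / (l ^ 2 + x ^ 2) := by
  change 1 / (max 1 l ^ 2 + x ^ 2) = _
  rw [max_eq_right hl]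

theorem oddWeight_apply (hl : 1 ≤ l) (x : ℝ) : oddWeight l x = x / (l ^ 2 + x ^ 2) := by
  change x / (max 1 l ^ 2 + x ^ 2) = _
  rw [max_eq_right hl]

theorem arctanWeight_apply (l x : ℝ) : arctanWeight l x = Real.arctan (x / l) := rfl

theorem bumpWeight_apply (hl : 1 ≤ l) (x : ℝ) : bumpWeight l x = l / (l ^ 2 + x ^ 2) := by
  rw [bumpWeight, BoundedContinuousFunction.smul_apply, cauchyWeight_apply hl, smul_eq_mul,
    mul_one_div]

theorem bumpWeight'_apply (hl : 1 ≤ l) (x : ℝ) :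
    bumpWeight' l x = -(2 * l * x) / (l ^ 2 + x ^ 2) ^ 2 := by
  rw [bumpWeight', BoundedContinuousFunction.smul_apply, BoundedContinuousFunction.mul_apply,
    cauchyWeight_apply hl, oddWeight_apply hl, smul_eq_mul]
  field_simp

theorem isDer_arctanWeight (hl : 1 ≤ l) : IsDer (arctanWeight l) (bumpWeight l) := fun x => by
  have h := ((hasDerivAt_id x).div_const l).arctan
  refine h.congr_deriv ?_
  have : 0 < l := by linarith
  rw [bumpWeight_apply hl, id]
  field_simp

theorem isDer_bumpWeight (hl : 1 ≤ l) : IsDer (bumpWeight l) (bumpWeight' l) := fun x => by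
  have h0 : l ^ 2 + x ^ 2 ≠ 0 := by positivity
  have h := (hasDerivAt_const x l).div (((hasDerivAt_id x).pow 2).const_add (l ^ 2)) h0
  refine (h.congr_deriv ?_).congr_of_eventuallyEq (Eventually.of_forall fun y => ?_)
  · rw [bumpWeight'_apply hl]
    simp [mul_left_comm, mul_assoc]
  · rw [bumpWeight_apply hl]; simp

theorem isSlow_bumpWeight (hl : 1 ≤ l) : IsSlow (1 / l) (bumpWeight l) (bumpWeight' l) where
  nonneg x := by rw [bumpWeight_apply hl]; positivity
  isDer := isDer_bumpWeight hl
  le x := by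
    have h0 : 0 < l ^ 2 + x ^ 2 := by positivity
    have h1 : 0 < l := by linarith
    rw [bumpWeight_apply hl, bumpWeight'_apply hl, abs_div, abs_neg, abs_of_pos (pow_pos h0 2),
      one_div, ← mul_div_assoc, inv_mul_cancel₀ h1.ne', div_le_div_iff₀ (by positivity) h0]
    have h2 : |2 * l * x| ≤ l ^ 2 + x ^ 2 := by
      rw [abs_le]; constructor <;> nlinarith [sq_nonneg (l - x), sq_nonneg (l + x)]
    rw [one_mul, sq (l ^ 2 + x ^ 2)]
    exact mul_le_mul_of_nonneg_right h2 h0.le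

theorem isDer_smul_bumpWeight (hl : 1 ≤ l) :
    IsDer (l • bumpWeight l) (l • bumpWeight' l) := fun x =>
  ((isDer_bumpWeight hl x).const_mul l)

theorem abs_smul_bumpWeight'_le (hl : 1 ≤ l) (x : ℝ) : |(l • bumpWeight' l) x| ≤ bumpWeight l x := by
  have h := (isSlow_bumpWeight hl).le x
  have h1 : 0 < l := by linarith
  rw [BoundedContinuousFunction.smul_apply, smul_eq_mul, abs_mul, abs_of_pos h1]
  rw [one_div, ← div_eq_inv_mul, le_div_iff₀ h1] at h
  linarith

theorem cauchyWeight_sub {m : ℝ} (hl : 1 ≤ l) (hm : 1 ≤ m) :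
    cauchyWeight m - cauchyWeight l = (l ^ 2 - m ^ 2) • (cauchyWeight m * cauchyWeight l) := by
  ext x
  simp only [BoundedContinuousFunction.sub_apply, BoundedContinuousFunction.smul_apply,
    BoundedContinuousFunction.mul_apply, cauchyWeight_apply hl, cauchyWeight_apply hm, smul_eq_mul]
  have h1 : 0 < l ^ 2 + x ^ 2 := by positivity
  have h2 : 0 < m ^ 2 + x ^ 2 := by positivity
  field_simp
  ring

theorem oddWeight_sub {m : ℝ} (hl : 1 ≤ l) (hm : 1 ≤ m) :
    oddWeight m - oddWeight l = (l ^ 2 - m ^ 2) • (oddWeight m * cauchyWeight l) := by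
  ext x
  simp only [BoundedContinuousFunction.sub_apply, BoundedContinuousFunction.smul_apply,
    BoundedContinuousFunction.mul_apply, cauchyWeight_apply hl, oddWeight_apply hl,
    oddWeight_apply hm, smul_eq_mul]
  have h1 : 0 < l ^ 2 + x ^ 2 := by positivity
  have h2 : 0 < m ^ 2 + x ^ 2 := by positivity
  field_simp
  ring

theorem norm_cauchyWeight_le (l : ℝ) : ‖cauchyWeight l‖ ≤ 1 :=
  BoundedContinuousFunction.norm_ofNormedAddCommGroup_le _ zero_le_one _

theorem norm_oddWeight_le (l : ℝ) : ‖oddWeight l‖ ≤ 1 :=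
  BoundedContinuousFunction.norm_ofNormedAddCommGroup_le _ zero_le_one _

/-- As with a resolvent identity, the difference is a scalar tending to zero times a product bounded
by one. This yields continuity in the uniform norm for both rational weights. -/
theorem continuousAt_of_sub_eq {R S : ℝ → ℝ →ᵇ ℝ} (hR : ∀ m, ‖R m‖ ≤ 1) (hS : ∀ m, ‖S m‖ ≤ 1)
    (h : ∀ m, 1 ≤ m → R m - R l = (l ^ 2 - m ^ 2) • (R m * S l)) (hl : 1 < l) :
    ContinuousAt R l := by
  rw [ContinuousAt, tendsto_iff_norm_sub_tendsto_zero]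
  have h1 : Tendsto (fun m : ℝ => |l ^ 2 - m ^ 2|) (𝓝 l) (𝓝 0) := by
    have : Continuous fun m : ℝ => |l ^ 2 - m ^ 2| := by fun_prop
    simpa using this.tendsto l
  refine squeeze_zero' (Eventually.of_forall fun _ => norm_nonneg _) ?_ h1
  filter_upwards [lt_mem_nhds hl] with m hm
  rw [h m hm.le, norm_smul, Real.norm_eq_abs]
  refine mul_le_of_le_one_right (abs_nonneg _) ((norm_mul_le _ _).trans ?_)
  exact mul_le_one₀ (hR m) (norm_nonneg _) (hS l)

theorem continuousAt_cauchyWeight (hl : 1 < l) : ContinuousAt cauchyWeight l :=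
  continuousAt_of_sub_eq norm_cauchyWeight_le norm_cauchyWeight_le
    (fun _ hm => cauchyWeight_sub hl.le hm) hl

theorem continuousAt_oddWeight (hl : 1 < l) : ContinuousAt oddWeight l :=
  continuousAt_of_sub_eq norm_oddWeight_le norm_cauchyWeight_le
    (fun _ hm => oddWeight_sub hl.le hm) hl

/-- A curve of bounded continuous functions that is differentiable pointwise, with a derivative
that is continuous in the uniform norm, is differentiable in the uniform norm. -/
theorem hasDerivAt_bcf {Φ Φ' : ℝ → ℝ →ᵇ ℝ} {l : ℝ}
    (h : ∀ᶠ m in 𝓝 l, ∀ x, HasDerivAt (fun n => Φ n x) (Φ' m x) m) (hc : ContinuousAt Φ' l) :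
    HasDerivAt Φ (Φ' l) l := by
  rw [hasDerivAt_iff_isLittleO, Asymptotics.isLittleO_iff]
  intro ε hε
  have h1 : ∀ᶠ m in 𝓝 l, ‖Φ' m - Φ' l‖ ≤ ε := by
    have := (tendsto_iff_norm_sub_tendsto_zero.1 hc).eventually (ge_mem_nhds hε)
    exact this
  obtain ⟨r, hr, hball⟩ := Metric.eventually_nhds_iff_ball.1 (h.and h1)
  filter_upwards [Metric.ball_mem_nhds l hr] with m hm
  refine (BoundedContinuousFunction.norm_le (by positivity)).2 fun x => ?_
  have hd : ∀ n ∈ Metric.ball l r, HasDerivWithinAt (fun n => Φ n x - n * Φ' l x)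
      (Φ' n x - Φ' l x) (Metric.ball l r) n := fun n hn =>
    (((hball n hn).1 x).sub (((hasDerivAt_id n).mul_const (Φ' l x)).congr_deriv
      (one_mul _))).hasDerivWithinAt
  have := (convex_ball l r).norm_image_sub_le_of_norm_hasDerivWithin_le hd
    (fun n hn => ((Φ' n - Φ' l).norm_coe_le_norm x).trans (hball n hn).2)
    (Metric.mem_ball_self hr) hm
  refine le_trans (le_of_eq ?_) this
  congr 1
  simp only [BoundedContinuousFunction.sub_apply, BoundedContinuousFunction.smul_apply, smul_eq_mul]
  ring

theorem hasDerivAt_cauchyWeight (hl : 1 < l) :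
    HasDerivAt cauchyWeight ((-(2 * l)) • (cauchyWeight l * cauchyWeight l)) l := by
  refine hasDerivAt_bcf (Φ' := fun l => (-(2 * l)) • (cauchyWeight l * cauchyWeight l)) ?_ ?_
  · filter_upwards [lt_mem_nhds hl] with m hm x
    have h0 : m ^ 2 + x ^ 2 ≠ 0 := by positivity
    have h := (hasDerivAt_const m (1 : ℝ)).div (((hasDerivAt_id m).pow 2).add_const (x ^ 2)) h0
    refine (h.congr_deriv ?_).congr_of_eventuallyEq ?_
    · simp only [BoundedContinuousFunction.smul_apply, BoundedContinuousFunction.mul_apply,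
        cauchyWeight_apply hm.le, smul_eq_mul, id]
      simp
      field_simp
    · filter_upwards [lt_mem_nhds hm] with n hn
      rw [cauchyWeight_apply hn.le]; simp
  · have := continuousAt_cauchyWeight hl
    fun_prop

theorem hasDerivAt_arctanWeight (hl : 1 < l) : HasDerivAt arctanWeight (-oddWeight l) l := by
  refine hasDerivAt_bcf (Φ' := fun l => -oddWeight l) ?_ (continuousAt_oddWeight hl).neg
  filter_upwards [lt_mem_nhds hl] with m hm x
  have hm0 : m ≠ 0 := by positivity
  have h := ((hasDerivAt_const m x).div (hasDerivAt_id m) hm0).arctan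
  refine h.congr_deriv ?_
  rw [BoundedContinuousFunction.neg_apply, oddWeight_apply hm.le]
  simp
  field_simp

theorem hasDerivAt_bumpWeight (hl : 1 < l) :
    HasDerivAt bumpWeight
      (cauchyWeight l + l • (-(2 * l)) • (cauchyWeight l * cauchyWeight l)) l := by
  refine ((hasDerivAt_id l).smul (hasDerivAt_cauchyWeight hl)).congr_deriv ?_
  simp only [id, one_smul]
  abel

theorem hasDerivAt_smul_bumpWeight (hl : 1 < l) :
    HasDerivAt (fun l => l • bumpWeight l)
      (bumpWeight l + l • (cauchyWeight l + l • (-(2 * l)) • (cauchyWeight l * cauchyWeight l)))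
      l := by
  refine ((hasDerivAt_id l).smul (hasDerivAt_bumpWeight hl)).congr_deriv ?_
  simp only [id, one_smul]
  abel

theorem abs_deriv_bumpWeight_le (hl : 1 ≤ l) (x : ℝ) :
    l * |(cauchyWeight l + l • (-(2 * l)) • (cauchyWeight l * cauchyWeight l)) x| ≤
      bumpWeight l x := by
  simp only [BoundedContinuousFunction.add_apply, BoundedContinuousFunction.smul_apply,
    BoundedContinuousFunction.mul_apply, cauchyWeight_apply hl, bumpWeight_apply hl, smul_eq_mul]
  have h1 : 0 < l ^ 2 + x ^ 2 := by positivity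
  have e : 1 / (l ^ 2 + x ^ 2) + l * (-(2 * l) * (1 / (l ^ 2 + x ^ 2) * (1 / (l ^ 2 + x ^ 2)))) =
      (x ^ 2 - l ^ 2) / (l ^ 2 + x ^ 2) / (l ^ 2 + x ^ 2) := by
    field_simp; ring
  rw [e, abs_div, abs_of_pos h1, ← mul_div_assoc]
  refine div_le_div_of_nonneg_right ?_ h1.le
  refine mul_le_of_le_one_right (by linarith) ?_
  rw [abs_div, abs_of_pos h1, div_le_one h1, abs_le]
  constructor <;> nlinarith [sq_nonneg x, sq_nonneg l]

theorem abs_deriv_smul_bumpWeight_le (hl : 1 ≤ l) (x : ℝ) :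
    |(bumpWeight l + l • (cauchyWeight l + l • (-(2 * l)) • (cauchyWeight l * cauchyWeight l))) x|
      ≤ 2 * bumpWeight l x := by
  have h := abs_deriv_bumpWeight_le hl x
  rw [BoundedContinuousFunction.add_apply]
  refine (abs_add_le _ _).trans ?_
  rw [BoundedContinuousFunction.smul_apply, smul_eq_mul, abs_mul, abs_of_nonneg (by linarith : 0 ≤ l),
    abs_of_nonneg ((isSlow_bumpWeight hl).nonneg x)]
  linarith

/-- `x / (l² + x²)` decays too slowly to be dominated by the bump weight. Young's inequality leaves
a constant remainder, which will be paid for by the global norm; with `p` the speed of the scale it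
is of size `p² / l`. -/
theorem abs_mul_oddWeight_le (hl : 1 ≤ l) {σ : ℝ} (hσ : 0 < σ) (p x : ℝ) :
    |p * oddWeight l x| ≤ σ * bumpWeight l x + p ^ 2 / (4 * σ * l) := by
  have h1 : 0 < l ^ 2 + x ^ 2 := by positivity
  have h2 : 0 < l := by linarith
  rw [oddWeight_apply hl, bumpWeight_apply hl, abs_mul, abs_div, abs_of_pos h1, ← mul_div_assoc,
    ← mul_div_assoc, div_add' _ _ _ h1.ne', div_le_div_iff_of_pos_right h1, ← abs_mul]
  have h3 : p ^ 2 / (4 * σ * l) * x ^ 2 + σ * l - |p * x| =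
      (|p * x| - 2 * (σ * l)) ^ 2 / (4 * (σ * l)) := by
    rw [sub_sq, sq_abs]
    field_simp
    ring
  have h4 : 0 ≤ (|p * x| - 2 * (σ * l)) ^ 2 / (4 * (σ * l)) := by positivity
  have h5 : 0 ≤ p ^ 2 / (4 * σ * l) * l ^ 2 := by positivity
  rw [mul_add]
  linarith

end weights

/-! ### Coercivity and conservation of energy. -/

theorem E_one (u η : H1) : E 1 u η = ‖u‖ ^ 2 + ‖η‖ ^ 2 := by
  simp only [E, T_one, real_inner_self_eq_norm_sq, H1.norm_sq]

theorem E_add_weight (w v : ℝ →ᵇ ℝ) (u η : H1) : E (w + v) u η = E w u η + E v u η := by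
  simp only [E, T_add_weight]; ring

theorem E_smul_weight (r : ℝ) (w : ℝ →ᵇ ℝ) (u η : H1) : E (r • w) u η = r * E w u η := by
  simp only [E, T_smul_weight]; ring

theorem abs_T_self_le {θ w : ℝ →ᵇ ℝ} (h : ∀ x, |θ x| ≤ w x) (f : L2) : |T θ f f| ≤ T w f f := by
  have := abs_T_le h f f
  linarith

theorem T_prodL2_self (θ : ℝ →ᵇ ℝ) (u η : H1) :
    T θ (prodL2 u η) (ι u) = T (θ * rep η) (ι u) (ι u) := by
  rw [prodL2_comm, prodL2, T_M_left]

theorem abs_mul_rep_le {θ w : ℝ →ᵇ ℝ} (h : ∀ x, |θ x| ≤ w x) {η : H1} {μ : ℝ}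
    (hη : ∀ x, |rep η x| ≤ μ) (x : ℝ) : |(θ * rep η) x| ≤ (μ • w) x := by
  rw [BoundedContinuousFunction.mul_apply, abs_mul, BoundedContinuousFunction.smul_apply,
    smul_eq_mul, mul_comm]
  exact mul_le_mul (hη x) (h x) (abs_nonneg _) ((abs_nonneg _).trans (hη x))

/-- The local energy is coercive for small solutions. -/
theorem energy_ge {a c : ℝ} {θ : ℝ →ᵇ ℝ} (hθ : ∀ x, 0 ≤ θ x)
    {u η : H1} (hη : ∀ x, |rep η x| ≤ 1 / 2) :
    min (1 / 4) (min (-a / 2) (-c / 2)) * E θ u η ≤ energy a c θ u η := by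
  have h1 := abs_T_self_le (abs_mul_rep_le (fun x => (abs_of_nonneg (hθ x)).le) hη) (ι u)
  rw [T_smul_weight] at h1
  have h2 := (abs_le.1 h1).1
  have p1 := T_nonneg hθ (ι u)
  have p2 := T_nonneg hθ (D u)
  have p3 := T_nonneg hθ (ι η)
  have p4 := T_nonneg hθ (D η)
  obtain ⟨k, hk⟩ : ∃ k, k = min (1 / 4) (min (-a / 2) (-c / 2)) := ⟨_, rfl⟩
  have k1 : k ≤ 1 / 4 := hk ▸ min_le_left _ _
  have k2 : k ≤ -a / 2 := hk ▸ (min_le_right _ _).trans (min_le_left _ _)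
  have k3 : k ≤ -c / 2 := hk ▸ (min_le_right _ _).trans (min_le_right _ _)
  rw [← hk, energy, E, T_prodL2_self]
  have m1 := mul_le_mul_of_nonneg_right k1 p1
  have m2 := mul_le_mul_of_nonneg_right k2 p2
  have m3 := mul_le_mul_of_nonneg_right k1 p3
  have m4 := mul_le_mul_of_nonneg_right k3 p4
  linarith

theorem abs_energy_le (a c : ℝ) {θ w : ℝ →ᵇ ℝ} (h : ∀ x, |θ x| ≤ w x) {u η : H1}
    (hη : ∀ x, |rep η x| ≤ 1) :
    |energy a c θ u η| ≤ (|a| + |c| + 1) * E w u η := by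
  have hw : ∀ x, 0 ≤ w x := fun x => (abs_nonneg _).trans (h x)
  have h1 := abs_T_self_le (abs_mul_rep_le h hη) (ι u)
  rw [one_smul] at h1
  have p1 := T_nonneg hw (ι u)
  have p2 := T_nonneg hw (D u)
  have p3 := T_nonneg hw (ι η)
  have p4 := T_nonneg hw (D η)
  have t1 := abs_le.1 (abs_T_self_le h (ι u))
  have t3 := abs_le.1 (abs_T_self_le h (ι η))
  have t2 : |a * T θ (D u) (D u)| ≤ |a| * T w (D u) (D u) := by
    rw [abs_mul]; exact mul_le_mul_of_nonneg_left (abs_T_self_le h _) (abs_nonneg _)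
  have t4 : |c * T θ (D η) (D η)| ≤ |c| * T w (D η) (D η) := by
    rw [abs_mul]; exact mul_le_mul_of_nonneg_left (abs_T_self_le h _) (abs_nonneg _)
  have q1 := mul_nonneg (abs_nonneg a) p1
  have q2 := mul_nonneg (abs_nonneg a) p2
  have q3 := mul_nonneg (abs_nonneg a) p3
  have q4 := mul_nonneg (abs_nonneg a) p4
  have r1 := mul_nonneg (abs_nonneg c) p1
  have r2 := mul_nonneg (abs_nonneg c) p2
  have r3 := mul_nonneg (abs_nonneg c) p3
  have r4 := mul_nonneg (abs_nonneg c) p4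
  rw [energy, E, T_prodL2_self]
  rw [abs_le] at h1 t2 t4 ⊢
  constructor <;> linarith

theorem energyFlux_zero (a c : ℝ) (u η : H1) : energyFlux a c 0 u η = 0 := by
  simp [energyFlux, T_zero_weight]

/-- The weight one has zero derivative, so there is no flux: this is conservation of the
Hamiltonian. -/
theorem IsL2Solution.energy_one {a c : ℝ} {u η : ℝ → H1} (h : IsL2Solution a c u η) (t : ℝ) :
    energy a c 1 (u t) (η t) = energy a c 1 (u 0) (η 0) := by
  have hd : ∀ t, HasDerivAt (fun s => energy a c 1 (u s) (η s)) 0 t := fun t => by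
    have := h.hasDerivAt_energy isDer_one t
    rwa [energyFlux_zero] at this
  exact is_const_of_deriv_eq_zero (fun x => (hd x).differentiableAt) (fun x => (hd x).deriv) t 0

theorem abs_rep_le_of_E_one_le {u η : H1} {ρ : ℝ} (hρ : 0 ≤ ρ) (h : E 1 u η ≤ ρ ^ 2) :
    (∀ x, |rep u x| ≤ 2 * ρ) ∧ ∀ x, |rep η x| ≤ 2 * ρ := by
  rw [E_one] at h
  have h1 : ‖u‖ ≤ ρ := abs_le_of_sq_le_sq' (by nlinarith [sq_nonneg ‖η‖]) hρ |>.2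
  have h2 : ‖η‖ ≤ ρ := abs_le_of_sq_le_sq' (by nlinarith [sq_nonneg ‖u‖]) hρ |>.2
  exact ⟨fun x => (abs_rep_le u x).trans (by linarith),
    fun x => (abs_rep_le η x).trans (by linarith)⟩

/-- Small solutions stay small, by conservation of energy. -/
theorem exists_forall_small {a c : ℝ} (ha : a < 0) (hc : c < 0) {μ : ℝ} (hμ : 0 < μ) :
    ∃ ε, 0 < ε ∧ ∀ u η : ℝ → H1, IsL2Solution a c u η → E 1 (u 0) (η 0) < ε ^ 2 →
      ∀ t, E 1 (u t) (η t) ≤ 1 ∧ (∀ x, |rep (u t) x| ≤ μ) ∧ ∀ x, |rep (η t) x| ≤ μ := by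
  obtain ⟨ρ, hρ0, hρ1, hρ2⟩ : ∃ ρ, 0 < ρ ∧ 2 * ρ ≤ μ ∧ 2 * ρ ≤ 1 / 2 := by
    refine ⟨min (μ / 2) (1 / 4), lt_min (by positivity) (by norm_num), ?_, ?_⟩
    · linarith [min_le_left (μ / 2) (1 / 4)]
    · linarith [min_le_right (μ / 2) (1 / 4)]
  obtain ⟨k, hk⟩ : ∃ k, k = min (1 / 4) (min (-a / 2) (-c / 2)) := ⟨_, rfl⟩
  have hk0 : 0 < k := hk ▸ lt_min (by norm_num) (lt_min (by linarith) (by linarith))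
  have hk1 : k ≤ 1 / 4 := hk ▸ min_le_left _ _
  have hC0 : 0 < |a| + |c| + 1 := by positivity
  -- The factor `y` compensates for the ratio between the upper and lower energy constants, so that
  -- the initial energy lies below `k ρ²`.
  obtain ⟨y, hy0, hy1, hy2⟩ : ∃ y, 0 < y ∧ y ≤ 1 ∧ (|a| + |c| + 1) * y ≤ k := by
    refine ⟨k / (|a| + |c| + 1), by positivity, ?_, by field_simp; rfl⟩
    rw [div_le_one hC0]; linarith [abs_nonneg a, abs_nonneg c]
  refine ⟨ρ * y, by positivity, fun u η h h0 => ?_⟩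
  have hy3 : y ^ 2 ≤ y := by nlinarith
  have hX0 : E 1 (u 0) (η 0) < ρ ^ 2 * y := by
    refine h0.trans_le ?_
    rw [mul_pow]
    exact mul_le_mul_of_nonneg_left hy3 (sq_nonneg _)
  have hX0' : E 1 (u 0) (η 0) < ρ ^ 2 :=
    hX0.trans_le (mul_le_of_le_one_right (sq_nonneg _) hy1)
  have h1 : ∀ x : ℝ, |(1 : ℝ →ᵇ ℝ) x| ≤ (1 : ℝ →ᵇ ℝ) x := fun x => by simp
  have h10 : ∀ x : ℝ, 0 ≤ (1 : ℝ →ᵇ ℝ) x := fun x => by simp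
  have hen : energy a c 1 (u 0) (η 0) < k * ρ ^ 2 := by
    have h2 := (abs_le.1 (abs_energy_le a c h1 (u := u 0) (η := η 0) fun x =>
      ((abs_rep_le_of_E_one_le hρ0.le hX0'.le).2 x).trans (by linarith))).2
    have h3 := mul_lt_mul_of_pos_left hX0 hC0
    have h4 := mul_le_mul_of_nonneg_left hy2 (sq_nonneg ρ)
    linarith
  have hcont : Continuous fun t => E 1 (u t) (η t) := by
    simp only [E_one]
    exact (h.cu.norm.pow 2).add (h.cη.norm.pow 2)
  have hlt : ∀ t, E 1 (u t) (η t) ≤ ρ ^ 2 := by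
    intro t
    by_contra hcon
    push Not at hcon
    -- Continuity argument: leaving the ball would require the norm squared to equal `ρ²` at some
    -- time, and there coercivity would give an energy of at least `k ρ²`.
    obtain ⟨r, hr⟩ := mem_range_of_exists_le_of_exists_ge hcont ⟨0, hX0'.le⟩ ⟨t, hcon.le⟩
    replace hr : E 1 (u r) (η r) = ρ ^ 2 := hr
    have h2 := energy_ge h10 (a := a) (c := c) (u := u r) (η := η r) fun x =>
      ((abs_rep_le_of_E_one_le hρ0.le (le_of_eq hr)).2 x).trans hρ2
    rw [← hk, hr, h.energy_one] at h2
    linarith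
  intro t
  obtain ⟨h2, h3⟩ := abs_rep_le_of_E_one_le hρ0.le (hlt t)
  refine ⟨(hlt t).trans ?_, fun x => (h2 x).trans hρ1, fun x => (h3 x).trans hρ1⟩
  exact pow_le_one₀ hρ0.le (by linarith)

/-! ### Virial and energy along a moving scale. -/

/-- The virial functional at the scale `l`. -/
noncomputable def virial (β l : ℝ) (u η : H1) : ℝ :=
  T (arctanWeight l) (ι u) (ι η) + T (arctanWeight l) (D u) (D η)
    - β / 2 * T (bumpWeight l) (ι u) (D η)

theorem abs_virial_le {β l : ℝ} (hβ : |β| < 1) (hl : 1 ≤ l) {u η : H1} (h : E 1 u η ≤ 1) :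
    |virial β l u η| ≤ 3 := by
  have h1 : ∀ x, |arctanWeight l x| ≤ ((2 : ℝ) • (1 : ℝ →ᵇ ℝ)) x := fun x => by
    rw [arctanWeight_apply, abs_le]
    have h1 := Real.arctan_lt_pi_div_two (x / l)
    have h2 := Real.neg_pi_div_two_lt_arctan (x / l)
    have h3 := Real.pi_le_four
    simp only [BoundedContinuousFunction.smul_apply, BoundedContinuousFunction.coe_one, Pi.one_apply,
      smul_eq_mul, mul_one]
    constructor <;> linarith
  have h2 : ∀ x, |bumpWeight l x| ≤ (1 : ℝ →ᵇ ℝ) x := fun x => by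
    have h0 : 0 < l ^ 2 + x ^ 2 := by positivity
    rw [bumpWeight_apply hl, abs_of_nonneg (by positivity), BoundedContinuousFunction.coe_one, Pi.one_apply,
      div_le_one h0]
    nlinarith [sq_nonneg x]
  have t1 := abs_T_le h1 (ι u) (ι η)
  have t2 := abs_T_le h1 (D u) (D η)
  have t3 := abs_T_le h2 (ι u) (D η)
  have t3' : |β * T (bumpWeight l) (ι u) (D η)| ≤
      (T 1 (ι u) (ι u) + T 1 (D η) (D η)) / 2 := by
    rw [abs_mul]
    exact (mul_le_of_le_one_left (abs_nonneg _) hβ.le).trans t3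
  simp only [T_smul_weight] at t1 t2
  rw [E] at h
  have h10 : ∀ x : ℝ, 0 ≤ (1 : ℝ →ᵇ ℝ) x := fun x => by simp
  have p1 := T_nonneg h10 (ι u)
  have p2 := T_nonneg h10 (D u)
  have p3 := T_nonneg h10 (ι η)
  have p4 := T_nonneg h10 (D η)
  rw [virial]
  rw [abs_le] at t1 t2 t3' ⊢
  constructor <;> linarith

/-- The variation of the weights (`d1`, `d2`, `d3`) is separated from that of the solution with
weights frozen at time `t` (`d4`, `d5`); the latter is the virial rate. -/
theorem IsL2Solution.hasDerivAt_virial {a c : ℝ} {u η : ℝ → H1} (h : IsL2Solution a c u η) (β : ℝ)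
    {l : ℝ → ℝ} {p t : ℝ} (hl : HasDerivAt l p t) (hl1 : 1 < l t) :
    HasDerivAt (fun s => virial β (l s) (u s) (η s))
      (virialRate a c β (bumpWeight (l t)) (bumpWeight' (l t)) (u t) (η t)
        - T (p • oddWeight (l t)) (ι (u t)) (ι (η t)) - T (p • oddWeight (l t)) (D (u t)) (D (η t))
        - β / 2 * (p * T (cauchyWeight (l t) + l t • (-(2 * l t)) •
          (cauchyWeight (l t) * cauchyWeight (l t))) (ι (u t)) (D (η t)))) t := by
  have hψ := (hasDerivAt_arctanWeight hl1).scomp t hl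
  have hw := (hasDerivAt_bumpWeight hl1).scomp t hl
  have cιu : ContinuousAt (fun s => ι (u s)) t := (ι.continuous.comp h.cu).continuousAt
  have cιη : ContinuousAt (fun s => ι (η s)) t := (ι.continuous.comp h.cη).continuousAt
  have cDu : ContinuousAt (fun s => D (u s)) t := (D.continuous.comp h.cu).continuousAt
  have cDη : ContinuousAt (fun s => D (η s)) t := (D.continuous.comp h.cη).continuousAt
  have d1 := hasDerivAt_T_sub_weight hψ cιu cιη
  have d2 := hasDerivAt_T_sub_weight hψ cDu cDη
  have d3 := hasDerivAt_T_sub_weight hw cιu cDη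
  have d4 := h.hasDerivAt_momentum (isDer_arctanWeight hl1.le) t
  have d5 := hasDerivAt_T_D (isDer_bumpWeight hl1.le) h.cη.continuousAt (h.du t) (h.dη t)
  refine ((((d1.add d2).add d4).sub ((d3.add d5).const_mul (β / 2))).congr_deriv ?_
    ).congr_of_eventuallyEq (Eventually.of_forall fun s => ?_)
  · have e := T_smul_weight (cauchyWeight (l t) + l t • (-(2 * l t)) •
      (cauchyWeight (l t) * cauchyWeight (l t))) (ι (u t)) (D (η t)) p
    simp only [smul_neg, T_neg_weight, virialRate, e]
    ring
  · simp only [Pi.add_apply, Pi.sub_apply, virial, T_sub_weight, Function.comp_apply]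
    ring

/-- Growth of the virial functional. -/
theorem virial_deriv_ge {a c β δ p l : ℝ} (hβ : |β| < 1) (hδ : 0 < δ) (hl : 1 ≤ l) (hp : |p| ≤ δ)
    {u η : H1} (h1 : E 1 u η ≤ 1)
    (h : δ * E (bumpWeight l) u η ≤ virialRate a c β (bumpWeight l) (bumpWeight' l) u η) :
    δ / 4 * E (bumpWeight l) u η - p ^ 2 / (8 * δ * l) ≤
      virialRate a c β (bumpWeight l) (bumpWeight' l) u η
        - T (p • oddWeight l) (ι u) (ι η) - T (p • oddWeight l) (D u) (D η)
        - β / 2 * (p * T (cauchyWeight l + l • (-(2 * l)) •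
          (cauchyWeight l * cauchyWeight l)) (ι u) (D η)) := by
  set w := bumpWeight l with hw
  have hw0 : ∀ x, 0 ≤ w x := (isSlow_bumpWeight hl).nonneg
  set R := p ^ 2 / (4 * δ * l) with hR
  have hR0 : 0 ≤ R := by positivity
  have b1 : ∀ x, |(p • oddWeight l) x| ≤ (δ • w + R • (1 : ℝ →ᵇ ℝ)) x := fun x => by
    have := abs_mul_oddWeight_le hl hδ p x
    simpa using this
  have b2 : ∀ x, |(cauchyWeight l + l • (-(2 * l)) • (cauchyWeight l * cauchyWeight l)) x| ≤ w x :=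
    fun x => by
      have h2 := abs_deriv_bumpWeight_le hl x
      have h3 := abs_nonneg
        ((cauchyWeight l + l • (-(2 * l)) • (cauchyWeight l * cauchyWeight l)) x)
      nlinarith
  have t1 := abs_T_le b1 (ι u) (ι η)
  have t2 := abs_T_le b1 (D u) (D η)
  have t3 := abs_T_le b2 (ι u) (D η)
  have p1 := T_nonneg hw0 (ι u)
  have p2 := T_nonneg hw0 (D u)
  have p3 := T_nonneg hw0 (ι η)
  have p4 := T_nonneg hw0 (D η)
  -- Of the coercivity `δ`, the two odd-weight terms together consume `δ / 2` and leave the error `R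
  -- / 2`; the correction term consumes another `δ / 4`.
  have hE : E (δ • w + R • (1 : ℝ →ᵇ ℝ)) u η ≤ δ * E w u η + R := by
    rw [E_add_weight, E_smul_weight, E_smul_weight]
    have := mul_le_mul_of_nonneg_left h1 hR0
    linarith
  have t3' : |β * (p * T (cauchyWeight l + l • (-(2 * l)) •
      (cauchyWeight l * cauchyWeight l)) (ι u) (D η))| ≤ δ * (E w u η / 2) := by
    rw [abs_mul]
    refine (mul_le_of_le_one_left (abs_nonneg _) hβ.le).trans ?_
    rw [abs_mul]
    refine mul_le_mul hp (t3.trans ?_) (abs_nonneg _) hδ.le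
    rw [E]; linarith
  have e : p ^ 2 / (8 * δ * l) = R / 2 := by rw [hR]; ring
  rw [e]
  rw [E] at hE
  rw [abs_le] at t1 t2 t3'
  linarith

theorem IsL2Solution.hasDerivAt_energy_weight {a c : ℝ} {u η : ℝ → H1} (h : IsL2Solution a c u η)
    {Φ : ℝ → ℝ →ᵇ ℝ} {Φ' θ' : ℝ →ᵇ ℝ} {t : ℝ} (hΦ : HasDerivAt Φ Φ' t) (hθ : IsDer (Φ t) θ') :
    HasDerivAt (fun s => energy a c (Φ s) (u s) (η s))
      (energy a c Φ' (u t) (η t) + energyFlux a c θ' (u t) (η t)) t := by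
  have cιu : ContinuousAt (fun s => ι (u s)) t := (ι.continuous.comp h.cu).continuousAt
  have cιη : ContinuousAt (fun s => ι (η s)) t := (ι.continuous.comp h.cη).continuousAt
  have cDu : ContinuousAt (fun s => D (u s)) t := (D.continuous.comp h.cu).continuousAt
  have cDη : ContinuousAt (fun s => D (η s)) t := (D.continuous.comp h.cη).continuousAt
  have cp : ContinuousAt (fun s => prodL2 (u s) (η s)) t :=
    (continuous_prodL2 h.cu h.cη).continuousAt
  have d := (((((hasDerivAt_T_sub_weight hΦ cDu cDu).const_mul a).add
    ((hasDerivAt_T_sub_weight hΦ cDη cDη).const_mul c)).neg.add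
    (hasDerivAt_T_sub_weight hΦ cιu cιu)).add (hasDerivAt_T_sub_weight hΦ cιη cιη)).add
    (hasDerivAt_T_sub_weight hΦ cp cιu)
  refine ((d.const_mul (1 / 2)).add (h.hasDerivAt_energy hθ t)).congr_of_eventuallyEq
    (Eventually.of_forall fun s => ?_)
  simp only [Pi.add_apply, Pi.neg_apply, energy, T_sub_weight]
  ring

/-- Growth of the energy at the scale `l`. -/
theorem abs_energy_deriv_le (a c : ℝ) {l p : ℝ} (hl : 2 ≤ l) (hp : |p| ≤ 1) {u η : H1}
    (hu : ∀ x, |rep u x| ≤ 1) (hη : ∀ x, |rep η x| ≤ 1) :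
    |energy a c (p • (bumpWeight l + l • (cauchyWeight l + l • (-(2 * l)) •
        (cauchyWeight l * cauchyWeight l)))) u η + energyFlux a c (l • bumpWeight' l) u η| ≤
      (2 * (|a| + |c| + 1) + (|a * c| + bd a + bd c + 2 * (a ^ 2 + bd a) + 2 * (c ^ 2 + bd c)))
        * E (bumpWeight l) u η := by
  have hl1 : 1 ≤ l := by linarith
  have h1 : ∀ x, |(p • (bumpWeight l + l • (cauchyWeight l + l • (-(2 * l)) •
        (cauchyWeight l * cauchyWeight l)))) x| ≤ ((2 : ℝ) • bumpWeight l) x := fun x => by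
    rw [BoundedContinuousFunction.smul_apply, smul_eq_mul, abs_mul]
    exact (mul_le_of_le_one_left (abs_nonneg _) hp).trans (abs_deriv_smul_bumpWeight_le hl1 x)
  have h2 := abs_energy_le a c h1 (u := u) hη
  have h3 := abs_energyFlux_le (a := a) (c := c) (isSlow_bumpWeight hl1)
    (by rw [div_le_div_iff₀ (by linarith) two_pos]; linarith) (abs_smul_bumpWeight'_le hl1) u η hu
  rw [E_smul_weight] at h2
  refine (abs_add_le _ _).trans ?_
  linarith

/-! ### From the virial inequality to decay. -/

theorem monotoneOn_Ici_of_hasDerivAt {f f' : ℝ → ℝ} {T₀ : ℝ}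
    (hf : ∀ t, T₀ ≤ t → HasDerivAt f (f' t) t) (h0 : ∀ t, T₀ ≤ t → 0 ≤ f' t) :
    MonotoneOn f (Set.Ici T₀) :=
  monotoneOn_of_hasDerivWithinAt_nonneg (convex_Ici T₀)
    (fun t ht => (hf t ht).continuousAt.continuousWithinAt)
    (fun t ht => (hf t (interior_subset ht)).hasDerivWithinAt)
    (fun t ht => h0 t (interior_subset ht))

theorem exists_tendsto_of_hasDerivAt {f f' : ℝ → ℝ} {T₀ B : ℝ}
    (hf : ∀ t, T₀ ≤ t → HasDerivAt f (f' t) t) (h0 : ∀ t, T₀ ≤ t → 0 ≤ f' t)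
    (hB : ∀ t, T₀ ≤ t → f t ≤ B) : ∃ L, Tendsto f atTop (𝓝 L) := by
  have hm : Monotone fun t => f (max t T₀) := fun s t hst =>
    monotoneOn_Ici_of_hasDerivAt hf h0 (Set.mem_Ici.2 (le_max_right _ _))
      (Set.mem_Ici.2 (le_max_right _ _))
      (max_le_max_right _ hst)
  have hb : BddAbove (Set.range fun t => f (max t T₀)) :=
    ⟨B, by rintro _ ⟨t, rfl⟩; exact hB _ (le_max_right _ _)⟩
  refine ⟨_, (tendsto_atTop_ciSup hm hb).congr' ?_⟩
  filter_upwards [eventually_ge_atTop T₀] with t ht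
  rw [max_eq_left ht]

/-- If a bounded functional grows at the rate `e` up to an integrable error, then a quantity that
is dominated by `t e / log² t` and varies at most at the rate `e` tends to zero. -/
theorem tendsto_zero_of_virial {V V' S S' e : ℝ → ℝ} {T₀ δ R B C : ℝ} (hT : Real.exp 1 ≤ T₀)
    (hδ : 0 < δ) (hR : 0 ≤ R) (hC : 0 < C) (hV : ∀ t, T₀ ≤ t → HasDerivAt V (V' t) t)
    (hV' : ∀ t, T₀ ≤ t → δ * e t - R / (t * Real.log t ^ 2) ≤ V' t)
    (hB : ∀ t, T₀ ≤ t → V t ≤ B) (hS : ∀ t, T₀ ≤ t → HasDerivAt S (S' t) t)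
    (hS' : ∀ t, T₀ ≤ t → |S' t| ≤ C * e t) (hS0 : ∀ t, T₀ ≤ t → 0 ≤ S t)
    (hSe : ∀ t, T₀ ≤ t → S t ≤ C * (t / Real.log t ^ 2 * e t)) :
    Tendsto S atTop (𝓝 0) := by
  have hpos : ∀ t, T₀ ≤ t → 0 < t := fun t ht => (Real.exp_pos 1).trans_le (hT.trans ht)
  have hlog : ∀ t, T₀ ≤ t → 1 ≤ Real.log t := fun t ht =>
    (Real.le_log_iff_exp_le (hpos t ht)).2 (hT.trans ht)
  have he : ∀ t, T₀ ≤ t → 0 ≤ e t := fun t ht =>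
    nonneg_of_mul_nonneg_right ((abs_nonneg _).trans (hS' t ht)) hC
  -- `-1 / log t` is a primitive of `1 / (t log² t)`: subtracting `R / log t` absorbs the error and
  -- leaves a nondecreasing bounded function.
  have hW : ∀ t, T₀ ≤ t → HasDerivAt (fun t => V t - R * (Real.log t)⁻¹)
      (V' t + R / (t * Real.log t ^ 2)) t := fun t ht => by
    have h1 := (hpos t ht).ne'
    have h2 : Real.log t ≠ 0 := by linarith [hlog t ht]
    refine ((hV t ht).sub (((Real.hasDerivAt_log h1).inv h2).const_mul R)).congr_deriv ?_
    field_simp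
    ring
  have hWe : ∀ t, T₀ ≤ t → δ * e t ≤ V' t + R / (t * Real.log t ^ 2) := fun t ht => by
    linarith [hV' t ht]
  have hWB : ∀ t, T₀ ≤ t → V t - R * (Real.log t)⁻¹ ≤ B := fun t ht => by
    have := inv_nonneg.2 (zero_le_one.trans (hlog t ht))
    have := hB t ht
    have : 0 ≤ R * (Real.log t)⁻¹ := by positivity
    linarith
  obtain ⟨Lw, hLw⟩ := exists_tendsto_of_hasDerivAt hW
    (fun t ht => (mul_nonneg hδ.le (he t ht)).trans (hWe t ht)) hWB
  -- Since `|S'| ≤ C e`, the combination `(C/δ) W - S`, with `W = V - R / log t`, is also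
  -- nondecreasing and bounded above. Hence `S` converges, with no need to integrate `e`.
  obtain ⟨Ln, hLn⟩ := exists_tendsto_of_hasDerivAt (B := C / δ * B)
    (fun t ht => ((hW t ht).const_mul (C / δ)).sub (hS t ht))
    (fun t ht => by
      have h1 := mul_le_mul_of_nonneg_left (hWe t ht) (div_pos hC hδ).le
      have h2 : C / δ * (δ * e t) = C * e t := by field_simp
      linarith [(abs_le.1 (hS' t ht)).2])
    (fun t ht => by
      have h1 := mul_le_mul_of_nonneg_left (hWB t ht) (div_pos hC hδ).le
      have := hS0 t ht
      simp only [Pi.sub_apply]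
      linarith)
  obtain ⟨L, hL⟩ : ∃ L, Tendsto S atTop (𝓝 L) := by
    refine ⟨_, ((hLw.const_mul (C / δ)).sub hLn).congr fun t => ?_⟩
    simp only [Pi.sub_apply]
    ring
  have hL0 : 0 ≤ L := ge_of_tendsto hL ((eventually_ge_atTop T₀).mono hS0)
  rcases hL0.eq_or_lt with rfl | hLpos
  · exact hL
  exfalso
  obtain ⟨T₁, hT₁, hge⟩ : ∃ T₁, T₀ ≤ T₁ ∧ ∀ t, T₁ ≤ t → L / 2 ≤ S t := by
    obtain ⟨T₁, h⟩ := eventually_atTop.1 (hL.eventually_const_le (half_lt_self hLpos))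
    exact ⟨max T₀ T₁, le_max_left _ _, fun t ht => h t ((le_max_right _ _).trans ht)⟩
  -- If `S ≥ L / 2`, then `e ≥ L log² t / (2 C t)`. The factor `log² t ≥ 1` is dropped, since `1/t`
  -- is enough to make `W` grow at least like `log t`, against its convergence.
  have hk : ∀ t, T₁ ≤ t → δ * L / (2 * C) * t⁻¹ ≤ δ * e t := fun t ht => by
    have ht0 := hT₁.trans ht
    have h1 := hpos t ht0
    have h2 := hlog t ht0
    have h3 : L / 2 ≤ C * (t * e t) := by
      refine ((hge t ht).trans (hSe t ht0)).trans (mul_le_mul_of_nonneg_left ?_ hC.le)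
      refine mul_le_mul_of_nonneg_right (div_le_self h1.le ?_) (he t ht0)
      exact one_le_pow₀ h2
    rw [← div_eq_mul_inv, div_div, div_le_iff₀ (by positivity)]
    have := mul_le_mul_of_nonneg_left h3 hδ.le
    linarith
  have hmono := monotoneOn_Ici_of_hasDerivAt (T₀ := T₁)
    (fun t ht => (hW t (hT₁.trans ht)).sub
      ((Real.hasDerivAt_log (hpos t (hT₁.trans ht)).ne').const_mul (δ * L / (2 * C))))
    (fun t ht => by linarith [hk t ht, hWe t (hT₁.trans ht)])
  have hinf : Tendsto (fun t => V t - R * (Real.log t)⁻¹) atTop atTop := by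
    refine tendsto_atTop_mono' _ ?_ (tendsto_atTop_add_const_right _
      ((V T₁ - R * (Real.log T₁)⁻¹) - δ * L / (2 * C) * Real.log T₁)
      (Real.tendsto_log_atTop.const_mul_atTop (r := δ * L / (2 * C)) (by positivity)))
    filter_upwards [eventually_ge_atTop T₁] with t ht
    have := hmono Set.self_mem_Ici ht ht
    simp only [Pi.sub_apply] at this
    linarith
  exact not_tendsto_nhds_of_tendsto_atTop hinf _ hLw

/-! ### The scale `t / log² t` and decay of the weighted norm. -/

/-- The scale `t / log² t`. -/
noncomputable def scale (t : ℝ) : ℝ := t / Real.log t ^ 2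

/-- The derivative of the scale `t / log² t`. -/
noncomputable def scale' (t : ℝ) : ℝ := 1 / Real.log t ^ 2 - 2 / Real.log t ^ 3

theorem hasDerivAt_scale {t : ℝ} (ht : 1 < t) : HasDerivAt scale (scale' t) t := by
  have h1 : t ≠ 0 := by positivity
  have h2 : Real.log t ≠ 0 := (Real.log_pos ht).ne'
  refine ((hasDerivAt_id t).div ((Real.hasDerivAt_log h1).pow 2) (pow_ne_zero 2 h2)).congr_deriv ?_
  simp only [id, scale', Pi.pow_apply]
  field_simp
  ring

theorem abs_scale'_le {t : ℝ} (ht : 1 ≤ Real.log t) : |scale' t| ≤ 1 / Real.log t ^ 2 := by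
  have h : scale' t = (1 - 2 / Real.log t) / Real.log t ^ 2 := by
    rw [scale']; field_simp
  rw [h, abs_div, abs_of_pos (by positivity : 0 < Real.log t ^ 2)]
  refine div_le_div_of_nonneg_right ?_ (by positivity)
  have h1 : 2 / Real.log t ≤ 2 := div_le_self two_pos.le ht
  have h2 : 0 ≤ 2 / Real.log t := by positivity
  rw [abs_le]; constructor <;> linarith

/-- The bound is integrable at infinity, which is what the virial argument needs of the error caused
by the motion of the scale. -/
theorem scale'_sq_div_scale_le {t : ℝ} (h0 : 0 < t) (ht : 1 ≤ Real.log t) :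
    scale' t ^ 2 / scale t ≤ 1 / (t * Real.log t ^ 2) := by
  have h1 : scale' t ^ 2 ≤ (1 / Real.log t ^ 2) ^ 2 := by
    rw [← sq_abs]; exact pow_le_pow_left₀ (abs_nonneg _) (abs_scale'_le ht) 2
  have h2 : 0 < scale t := by unfold scale; positivity
  refine (div_le_div_of_nonneg_right h1 h2.le).trans (le_of_eq ?_)
  rw [scale]; field_simp

theorem tendsto_scale : Tendsto scale atTop atTop := by
  have h := (Real.isLittleO_pow_log_id_atTop (n := 2)).tendsto_div_nhds_zero
  have h1 : Tendsto (fun t => Real.log t ^ 2 / id t) atTop (𝓝[>] 0) := by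
    refine tendsto_nhdsWithin_iff.2 ⟨h, ?_⟩
    filter_upwards [eventually_gt_atTop 1] with t ht
    have := Real.log_pos ht
    exact div_pos (by positivity) (zero_lt_one.trans ht)
  refine (tendsto_inv_nhdsGT_zero.comp h1).congr fun t => ?_
  simp [scale]

/-- Decay of small solutions at the scale `t / log² t`. -/
theorem exists_tendsto_E {a c : ℝ} (ha : a < 0) (hc : c < 0) (h : 3 * (a + c) + 2 < 8 * a * c) :
    ∃ ε, 0 < ε ∧ ∀ u η : ℝ → H1, IsL2Solution a c u η → E 1 (u 0) (η 0) < ε ^ 2 →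
      Tendsto (fun t => E (scale t • bumpWeight (scale t)) (u t) (η t)) atTop (𝓝 0) := by
  obtain ⟨β, δ, κ, μ, hδ, hκ, -, hμ, hμ1, hβ, H⟩ := exists_virialRate_ge ha hc h
  obtain ⟨ε, hε, hsmall⟩ := exists_forall_small ha hc (lt_min hμ one_half_pos)
  refine ⟨ε, hε, fun u η hs h0 => ?_⟩
  have hE1 := fun t => (hsmall u η hs h0 t).1
  have hu := fun t x => ((hsmall u η hs h0 t).2.1 x).trans (min_le_left _ _)
  have hη := fun t x => ((hsmall u η hs h0 t).2.2 x).trans (min_le_right _ _)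
  have hu1 := fun t x => (hu t x).trans hμ1
  have hη1 := fun t x => (hη t x).trans one_half_lt_one.le
  -- Beyond `T₀`: logarithms are at least one, the scale exceeds the `2` required by the energy
  -- estimate and the `1 / κ` that makes the bump slow enough, and its speed is at most `min δ 1`.
  obtain ⟨T₀, hT⟩ : ∃ T₀, ∀ t, T₀ ≤ t → Real.exp 1 ≤ t ∧ 2 ≤ scale t ∧ 1 / κ ≤ scale t ∧
      1 / Real.log t ^ 2 ≤ min δ 1 := by
    have h1 : Tendsto (fun t => 1 / Real.log t ^ 2) atTop (𝓝 0) :=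
      tendsto_const_nhds.div_atTop ((tendsto_pow_atTop two_ne_zero).comp Real.tendsto_log_atTop)
    exact eventually_atTop.1 ((eventually_ge_atTop _).and ((tendsto_scale.eventually_ge_atTop 2).and
      ((tendsto_scale.eventually_ge_atTop (1 / κ)).and
        (h1.eventually_le_const (lt_min hδ one_pos)))))
  have hlog : ∀ t, T₀ ≤ t → 1 ≤ Real.log t := fun t ht =>
    (Real.le_log_iff_exp_le ((Real.exp_pos 1).trans_le (hT t ht).1)).2 (hT t ht).1
  have hpos : ∀ t, T₀ ≤ t → 1 < t := fun t ht => by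
    have := Real.add_one_lt_exp one_ne_zero
    linarith [(hT t ht).1]
  have hp : ∀ t, T₀ ≤ t → |scale' t| ≤ min δ 1 := fun t ht =>
    (abs_scale'_le (hlog t ht)).trans (hT t ht).2.2.2
  have hw0 : ∀ t, T₀ ≤ t → ∀ x, 0 ≤ bumpWeight (scale t) x := fun t ht =>
    (isSlow_bumpWeight (by linarith [(hT t ht).2.1])).nonneg
  have hlw0 : ∀ t, T₀ ≤ t → ∀ x, 0 ≤ (scale t • bumpWeight (scale t)) x := fun t ht x =>
    mul_nonneg (by linarith [(hT t ht).2.1]) (hw0 t ht x)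
  obtain ⟨C, hC⟩ : ∃ C, C = 2 * (|a| + |c| + 1) +
    (|a * c| + bd a + bd c + 2 * (a ^ 2 + bd a) + 2 * (c ^ 2 + bd c)) := ⟨_, rfl⟩
  have hbd : ∀ k, 0 ≤ bd k := fun k => by unfold bd; positivity
  have hC1 : |a| + |c| + 1 ≤ C := by
    have := abs_nonneg a
    have := abs_nonneg c
    have := abs_nonneg (a * c)
    linarith [hbd a, hbd c, sq_nonneg a, sq_nonneg c]
  have hC0 : 0 < C := lt_of_lt_of_le (by positivity) hC1
  -- `V` is the virial, `S` the energy with weight `l² / (l² + x²)` and `e` the local norm with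
  -- weight `l / (l² + x²)`; the factor `l` between these weights is the `t / log² t` required by
  -- the abstract lemma.
  have key := tendsto_zero_of_virial (T₀ := T₀) (δ := δ / 4) (R := 1 / (8 * δ)) (B := 3) (C := C)
    (V := fun t => virial β (scale t) (u t) (η t))
    (S := fun t => energy a c (scale t • bumpWeight (scale t)) (u t) (η t))
    (e := fun t => E (bumpWeight (scale t)) (u t) (η t))
    (hT T₀ le_rfl).1 (by positivity) (by positivity) hC0
    (fun t ht => hs.hasDerivAt_virial β (hasDerivAt_scale (hpos t ht))
      (by linarith [(hT t ht).2.1]))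
    (fun t ht => by
      have hl := (hT t ht).2.1
      refine le_trans ?_ (virial_deriv_ge hβ hδ (by linarith) ((hp t ht).trans (min_le_left _ _))
        (hE1 t) (H _ _ ((isSlow_bumpWeight (by linarith)).mono ?_) _ _ (hu t)))
      · have h1 := mul_le_mul_of_nonneg_left
          (scale'_sq_div_scale_le (zero_lt_one.trans (hpos t ht)) (hlog t ht))
          (by positivity : 0 ≤ 1 / (8 * δ))
        have h2 : scale' t ^ 2 / (8 * δ * scale t) = 1 / (8 * δ) * (scale' t ^ 2 / scale t) := by
          rw [div_mul_div_comm, one_mul]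
        have h3 : 1 / (8 * δ) / (t * Real.log t ^ 2) =
            1 / (8 * δ) * (1 / (t * Real.log t ^ 2)) := by rw [← div_eq_mul_one_div]
        rw [h2, h3]
        linarith
      · exact (one_div_le (by linarith) hκ).2 (hT t ht).2.2.1)
    (fun t ht => (abs_le.1 (abs_virial_le hβ (by linarith [(hT t ht).2.1]) (hE1 t))).2)
    (fun t ht => hs.hasDerivAt_energy_weight
      ((hasDerivAt_smul_bumpWeight (by linarith [(hT t ht).2.1])).scomp t
        (hasDerivAt_scale (hpos t ht)))
      (isDer_smul_bumpWeight (by linarith [(hT t ht).2.1])))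
    (fun t ht => by
      rw [hC]
      exact abs_energy_deriv_le a c (hT t ht).2.1 ((hp t ht).trans (min_le_right _ _))
        (hu1 t) (hη1 t))
    (fun t ht => le_trans (mul_nonneg (le_min (by norm_num) (le_min (by linarith) (by linarith)))
      (E_nonneg (hlw0 t ht) _ _)) (energy_ge (hlw0 t ht) (hη t)))
    (fun t ht => by
      have h1 := (abs_le.1 (abs_energy_le a c (fun x => (abs_of_nonneg (hlw0 t ht x)).le)
        (u := u t) (hη1 t))).2
      rw [E_smul_weight] at h1
      exact h1.trans (mul_le_mul_of_nonneg_right hC1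
        (mul_nonneg (by linarith [(hT t ht).2.1]) (E_nonneg (hw0 t ht) _ _))))
  obtain ⟨k, hk⟩ : ∃ k, k = min (1 / 4) (min (-a / 2) (-c / 2)) := ⟨_, rfl⟩
  have hk0 : 0 < k := hk ▸ lt_min (by norm_num) (lt_min (by linarith) (by linarith))
  have key' := key.const_mul k⁻¹
  rw [mul_zero] at key'
  refine squeeze_zero' ?_ ?_ key'
  · filter_upwards [eventually_ge_atTop T₀] with t ht using E_nonneg (hlw0 t ht) _ _
  · filter_upwards [eventually_ge_atTop T₀] with t ht
    rw [le_inv_mul_iff₀ hk0, hk]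
    exact energy_ge (hlw0 t ht) (hη t)

/-! ### Norm on the interval and time reversal. -/

/-- On `|x| < C₀ l` the weight `l² / (l² + x²)` is at least `1 / (1 + C₀²)`. The constant `C₀`
enters only here, so the smallness threshold does not depend on it. -/
theorem localNorm_sq_le {C₀ l : ℝ} (hl : 1 ≤ l) (u η : H1) :
    localNorm (Set.Ioo (-(C₀ * l)) (C₀ * l)) u η ≤
      Real.sqrt ((1 + C₀ ^ 2) * E (l • bumpWeight l) u η) := by
  refine Real.sqrt_le_sqrt ?_
  obtain ⟨θ, hθ⟩ : ∃ θ, θ = (1 + C₀ ^ 2) • (l • bumpWeight l) := ⟨_, rfl⟩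
  have hi : ∀ f : L2, Integrable (fun x => f x ^ 2) volume := fun f => by
    simpa [sq] using integrable_T 1 f f
  have hg := (((hi (ι u)).add (hi (D u))).add (hi (ι η))).add (hi (D η))
  have hθi : ∀ f : L2, Integrable (fun x => θ x * f x ^ 2) volume := fun f => by
    simpa [sq, mul_assoc] using integrable_T θ f f
  have hT : ∀ f : L2, T θ f f = ∫ x, θ x * f x ^ 2 := fun f => by
    simp only [T_eq_integral, sq, mul_assoc]
  have h0 : ∀ x, 0 ≤ θ x := fun x => by
    rw [hθ]
    simp only [BoundedContinuousFunction.smul_apply, smul_eq_mul, bumpWeight_apply hl]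
    positivity
  have h1 : ∀ x ∈ Set.Ioo (-(C₀ * l)) (C₀ * l), 1 ≤ θ x := fun x hx => by
    rw [hθ]
    simp only [BoundedContinuousFunction.smul_apply, smul_eq_mul, bumpWeight_apply hl]
    have h2 : 0 < l ^ 2 + x ^ 2 := by positivity
    have h3 : x ^ 2 ≤ (C₀ * l) ^ 2 := sq_le_sq' hx.1.le hx.2.le
    rw [← mul_div_assoc, ← mul_div_assoc, one_le_div h2]
    linarith
  rw [← E_smul_weight, ← hθ, E, hT, hT, hT, hT, ← integral_add' (hθi _) (hθi _),
    ← integral_add' (hθi _) (hθi _), ← integral_add' ((hθi _).add (hθi _)) ((hθi _).add (hθi _))]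
  have hG := ((hθi (ι u)).add (hθi (D u))).add ((hθi (ι η)).add (hθi (D η)))
  refine (setIntegral_mono_on hg.integrableOn hG.integrableOn measurableSet_Ioo
    fun x hx => ?_).trans (setIntegral_le_integral hG (Eventually.of_forall fun x => ?_))
  · simp only [Pi.add_apply]
    have h2 := h1 x hx
    have q := fun f : L2 => mul_le_mul_of_nonneg_right h2 (sq_nonneg (f x))
    linarith [q (ι u), q (D u), q (ι η), q (D η)]
  · have := h0 x
    simp only [Pi.add_apply, Pi.zero_apply]
    positivity

theorem localNorm_neg (I : Set ℝ) (u η : H1) : localNorm I (-u) η = localNorm I u η := by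
  rw [localNorm, localNorm]
  congr 1
  refine integral_congr_ae (ae_restrict_of_ae ?_)
  filter_upwards [Lp.coeFn_neg (ι u), Lp.coeFn_neg (D u)] with x h1 h2
  rw [← map_neg] at h1 h2
  simp only [H1.fn_eq, H1.dx_eq, h1, h2, Pi.neg_apply, neg_sq]

/-- The terms of `∂ₜu` are even in `u` and those of `∂ₜη` are odd, so reversing time together with
the sign of `u` preserves the system. -/
theorem IsL2Solution.reverse {a c : ℝ} {u η : ℝ → H1} (h : IsL2Solution a c u η) :
    IsL2Solution a c (fun t => -u (-t)) fun t => η (-t) where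
  cu := (h.cu.comp continuous_neg).neg
  cη := h.cη.comp continuous_neg
  du t := by
    have h1 := ((h.du (-t)).scomp t (hasDerivAt_neg t)).neg
    refine (h1.congr_deriv ?_).congr_of_eventuallyEq (Eventually.of_forall fun s => ?_)
    · simp [velU, lowerU, prodL2]
      abel
    · simp
  dη t := by
    have h1 := (h.dη (-t)).scomp t (hasDerivAt_neg t)
    refine (h1.congr_deriv ?_).congr_of_eventuallyEq (Eventually.of_forall fun s => ?_)
    · simp [velη, lowerη, prodL2]
      abel
    · simp

theorem E_neg_left (w : ℝ →ᵇ ℝ) (u η : H1) : E w (-u) η = E w u η := by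
  simp [E, T_neg_left, T_neg_right]

theorem tendsto_localNorm_of_tendsto_E {u η : ℝ → H1}
    (h : Tendsto (fun t => E (scale t • bumpWeight (scale t)) (u t) (η t)) atTop (𝓝 0)) (C₀ : ℝ) :
    Tendsto (fun t => localNorm (decayInterval C₀ t) (u t) (η t)) atTop (𝓝 0) := by
  have h1 := (h.const_mul (1 + C₀ ^ 2)).sqrt
  rw [mul_zero, Real.sqrt_zero] at h1
  refine squeeze_zero' (Eventually.of_forall fun t => Real.sqrt_nonneg _) ?_ h1
  filter_upwards [eventually_ge_atTop 0, tendsto_scale.eventually_ge_atTop 1] with t ht hl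
  have := localNorm_sq_le (C₀ := C₀) hl (u t) (η t)
  have e : C₀ * scale t = C₀ * t / Real.log t ^ 2 := (mul_div_assoc _ _ _).symm
  rwa [e, ← abs_of_nonneg ht, ← decayInterval, abs_of_nonneg ht] at this

end Abcd

theorem theorem1p1 (a b c : ℝ) (hdisp : Abcd.DispersionLike a b c) :
    ∃ ε : ℝ, 0 < ε ∧
      ∀ u η : ℝ → Abcd.H1, Abcd.IsGlobalSolution a c u η →
        Abcd.pairNorm (u 0) (η 0) < ε →
        ∀ C₀ : ℝ, 0 < C₀ →
          Tendsto (fun t : ℝ => Abcd.localNorm (Abcd.decayInterval C₀ t) (u t) (η t))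
              atTop (𝓝 0) ∧
          Tendsto (fun t : ℝ => Abcd.localNorm (Abcd.decayInterval C₀ t) (u t) (η t))
              atBot (𝓝 0) := by
  obtain ⟨⟨ha, hc, -, -⟩, h⟩ := hdisp
  obtain ⟨ε, hε, H⟩ := Abcd.exists_tendsto_E ha hc h
  refine ⟨ε, hε, fun u η hs h0 C₀ _ => ?_⟩
  have h2 := hs.isL2Solution
  have h3 : Abcd.E 1 (u 0) (η 0) < ε ^ 2 := by
    rw [Abcd.E_one]
    exact (Real.sqrt_lt' hε).1 h0
  refine ⟨Abcd.tendsto_localNorm_of_tendsto_E (H u η h2 h3) C₀, ?_⟩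
  -- The reversed solution has the same initial norm, and both the local norm and the interval are
  -- unchanged under `u ↦ -u` and `t ↦ -t`.
  have h4 := Abcd.tendsto_localNorm_of_tendsto_E
    (H _ _ h2.reverse (by simpa [Abcd.E_neg_left] using h3)) C₀
  refine (h4.comp tendsto_neg_atBot_atTop).congr fun t => ?_
  simp [Abcd.localNorm_neg, Abcd.decayInterval]
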